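/- **Setting.** Let $(\mathbf X_i,Y_i,\delta_i)$, $i\ge 1$, be i.i.d. copies of $(\mathbf X,Y,\delta)$, where $\mathbf X$ and $Y$ take values in standard Borel spaces and $\delta\in\{0,1\}$ indicates whether $Y$ is observed, $0<\mathbb P(\delta=1)<1$. Let $\mathbf b=(b_1,\dots,b_L)$ be a measurable integrable function of $\mathbf x$, $\mathbf z=\mathbf z(\mathbf x)=(1,\mathbf b(\mathbf x)^{\rm T})^{\rm T}$, $\Theta\subset\mathbb R^p$, $\mathbf U(\boldsymbol\theta;\mathbf x,y)\in\mathbb R^p$, $\bar{\mathbf U}(\boldsymbol\theta;\mathbf X)=\mathbb E\{\mathbf U(\boldsymbol\theta;\mathbf X,Y)\mid\mathbf X\}$, and let $\boldsymbol\theta_0$ be the unique solution in $\Theta$ of $\mathbb E\{\mathbf U(\boldsymbol\theta;\mathbf X,Y)\}=\mathbf 0$. Put $c=\mathbb P(\delta=0)/\mathbb P(\delta=1)$. For a sample of size $N$ let $N_1=\sum_{i\le N}\delta_i$, $N_0=N-N_1$. Let $\hat{\boldsymbol\lambda}$ and $\hat{\boldsymbol\theta}_{\rm SPS}\in\Theta$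 be random vectors which, with probability tending to one, solve $$\sum_{i=1}^N\delta_i\Big\{1+\tfrac{N_0}{N_1}e^{\mathbf z_i^{\rm T}\hat{\boldsymbol\lambda}}\Big\}\mathbf z_i=\sum_{i=1}^N\mathbf z_i,\qquad \frac1N\sum_{i=1}^N\delta_i\Big\{1+\tfrac{N_0}{N_1}e^{\mathbf z_i^{\rm T}\hat{\boldsymbol\lambda}}\Big\}\mathbf U(\hat{\boldsymbol\theta}_{\rm SPS};\mathbf X_i,Y_i)=\mathbf 0 .$$ **Assumptions.** 1. (Missing at random) $Y\perp\delta\mid\mathbf X$. 2. (Density ratio model) The law of $\mathbf X$ given $\delta=0$ is absolutely continuous with respect to the law given $\delta=1$, with density ratio $r=f_0/f_1$, and $r^\star(\mathbf X):=\mathbb E\{r(\mathbf X)\mid\mathbf b(\mathbf X),\delta=1\}=\exp(\mathbf z^{\rm T}\boldsymbol\lambda^\star)$ almost surely given $\delta=1$. 3. (Regularity) - $1,b_1(\mathbf X),\dots,b_L(\mathbf X)$ are linearly independent. - $\Theta$ is compact and $\boldsymbol\theta_0$ is an interior point of $\Theta$. - For every $\boldsymbol\theta\in\Theta$, $\mathbf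 U(\boldsymbol\theta;\cdot)$ is measurable and $\mathbb E\|\mathbf U(\boldsymbol\theta;\mathbf X,Y)\|^2<\infty$. - Almost surely $\mathbf U(\cdot;\mathbf X,Y)$ is continuous on $\Theta$ and $C^1$ on a ball $B\subset\Theta$ around $\boldsymbol\theta_0$. - $\boldsymbol\tau=\mathbb E\{\partial\mathbf U(\boldsymbol\theta_0;\mathbf X,Y)/\partial\boldsymbol\theta^{\rm T}\}$ is nonsingular. - $\mathbb E[\delta e^{2\mathbf z^{\rm T}\boldsymbol\lambda^\star}\{\|\mathbf z\|^2+\|\mathbf U(\boldsymbol\theta_0;\mathbf X,Y)\|^2\}]<\infty$. - There are a function $G(\mathbf x,y)$ and $\varepsilon>0$ such that almost surely $\|\mathbf U(\boldsymbol\theta;\mathbf X,Y)\|\le G(\mathbf X,Y)$ for all $\boldsymbol\theta\in\Theta$ and $\|\partial\mathbf U(\boldsymbol\theta;\mathbf X,Y)/\partial\boldsymbol\theta^{\rm T}\|\le G(\mathbf X,Y)$ for all $\boldsymbol\theta\in B$, and such that $\mathbb E\,G(\mathbf X,Y)<\infty$ and $\mathbb E[\delta e^{\mathbf z^{\rm T}\boldsymbol\lambda^\star+\varepsilon\|\mathbf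 z\|}\{1+G(\mathbf X,Y)\}]<\infty$. 4. For every $\boldsymbol\theta\in\Theta$, each coordinate of $\bar{\mathbf U}(\boldsymbol\theta;\mathbf X)$ lies in $\mathrm{span}\{1,b_1(\mathbf X),\dots,b_L(\mathbf X)\}$ almost surely. **Conclusion.** For every $\boldsymbol\theta\in\Theta$, with probability tending to one the equation $$\sum_{i=1}^N\delta_i\exp(\mathbf z_i^{\rm T}\boldsymbol\lambda^\star)\,\mathbf z_i\{\mathbf U(\boldsymbol\theta;\mathbf X_i,Y_i)^{\rm T}-\mathbf z_i^{\rm T}\boldsymbol\beta\}=\mathbf 0$$ has exactly one solution $\boldsymbol\beta\in\mathbb R^{(L+1)\times p}$; it converges in probability to a limit $\boldsymbol\beta^\star(\boldsymbol\theta)$; and $\bar{\mathbf U}(\boldsymbol\theta;\mathbf X)^{\rm T}=\mathbf z^{\rm T}\boldsymbol\beta^\star(\boldsymbol\theta)$ almost surely. Moreover $$\sqrt N\,(\hat{\boldsymbol\theta}_{\rm SPS}-\boldsymbol\theta_0)\ \stackrel{\mathcal L}{\longrightarrow}\ N\big(\mathbf 0,\ \boldsymbol\tau^{-1}V_1(\boldsymbol\tau^{-1})^{\rm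 T}\big),$$ $$V_1=\mathbb V\{\bar{\mathbf U}(\boldsymbol\theta_0;\mathbf X)\}+\mathbb E\big[\delta\,\omega^\star(\mathbf X;\boldsymbol\lambda^\star)^2\,\mathbb V\{\mathbf U(\boldsymbol\theta_0;\mathbf X,Y)\mid\mathbf X\}\big],\qquad \omega^\star(\mathbf x;\boldsymbol\lambda^\star)=1+c\,\exp(\mathbf z^{\rm T}\boldsymbol\lambda^\star).$$ -/

import Mathlib

open MeasureTheory ProbabilityTheory Filter Topology

namespace SPS

noncomputable section

/-- Real coordinate space with the Euclidean norm. -/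
abbrev Vec (n : ℕ) : Type := EuclideanSpace ℝ (Fin n)

/-- One unit `(x, y, δ)`: covariate, study variable, response indicator
(`true` when `y` is observed). -/
abbrev Obs (𝒳 𝒴 : Type*) : Type _ := 𝒳 × 𝒴 × Bool

/-- The response indicator as a real number. -/
def delta {𝒳 𝒴 : Type*} (w : Obs 𝒳 𝒴) : ℝ := if w.2.2 = true then 1 else 0

/-- The vector `z = (1, b₁(x), …, b_L(x))`. -/
def zvec {𝒳 : Type*} {L : ℕ} (b : 𝒳 → Vec L) (x : 𝒳) : Vec (L + 1) :=
  WithLp.toLp 2 (Fin.cons 1 (fun j => b x j))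

/-- The linear combination `zᵀ β`, where the rows `β k` of `β` lie in `ℝᵖ`. -/
def linComb {𝒳 : Type*} {L p : ℕ} (b : 𝒳 → Vec L) (β : Fin (L + 1) → Vec p) (x : 𝒳) : Vec p :=
  ∑ k, zvec b x k • β k

/-- The log-linear density ratio `exp (lam₀ + lam₁ᵀ b(x))`. -/
def expRatio {𝒳 : Type*} {L : ℕ} (b : 𝒳 → Vec L) (lam : Vec (L + 1)) (x : 𝒳) : ℝ :=
  Real.exp (inner ℝ (zvec b x) lam)

/-- The weight `1 + c exp (lam₀ + lam₁ᵀ b(x))`; `c` is `N₀ / N₁` in the sample and its limit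
`ℙ(δ = 0) / ℙ(δ = 1)` in the population. -/
def omegaStar {𝒳 : Type*} {L : ℕ} (c : ℝ) (b : 𝒳 → Vec L) (lam : Vec (L + 1)) (x : 𝒳) : ℝ :=
  1 + c * expRatio b lam x

section Sample

variable {𝒳 𝒴 : Type*} {L p : ℕ}

/-- `N₀ / N₁` in the sample `w 0, …, w (N - 1)`. -/
def cHat (w : ℕ → Obs 𝒳 𝒴) (N : ℕ) : ℝ :=
  (∑ i ∈ Finset.range N, (1 - delta (w i))) / (∑ i ∈ Finset.range N, delta (w i))

/-- `lam` solves the calibration equation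
`∑ δᵢ {1 + (N₀/N₁) exp (lam₀ + lam₁ᵀ b(xᵢ))} zᵢ = ∑ zᵢ`. -/
def Calibrates (b : 𝒳 → Vec L) (w : ℕ → Obs 𝒳 𝒴) (N : ℕ) (lam : Vec (L + 1)) : Prop :=
  ∑ i ∈ Finset.range N, (delta (w i) * omegaStar (cHat w N) b lam (w i).1) • zvec b (w i).1
    = ∑ i ∈ Finset.range N, zvec b (w i).1

/-- The smoothed propensity score estimating function
`N⁻¹ ∑ δᵢ {1 + (N₀/N₁) exp (lam₀ + lam₁ᵀ b(xᵢ))} U(θ; xᵢ, yᵢ)`. -/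
def UhatSPS (U : Vec p → 𝒳 → 𝒴 → Vec p) (b : 𝒳 → Vec L) (w : ℕ → Obs 𝒳 𝒴) (N : ℕ)
    (lam : Vec (L + 1)) (θ : Vec p) : Vec p :=
  (N : ℝ)⁻¹ • ∑ i ∈ Finset.range N,
    (delta (w i) * omegaStar (cHat w N) b lam (w i).1) • U θ (w i).1 (w i).2.1

/-- `β` solves `∑ δᵢ exp (zᵢᵀ lam) {U(θ; xᵢ, yᵢ) - zᵢᵀ β} zᵢ = 0`
(one `ℝᵖ`-valued equation for every coordinate of `zᵢ`). -/
def SolvesBeta (U : Vec p → 𝒳 → 𝒴 → Vec p) (b : 𝒳 → Vec L) (lam : Vec (L + 1))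
    (w : ℕ → Obs 𝒳 𝒴) (N : ℕ) (θ : Vec p) (β : Fin (L + 1) → Vec p) : Prop :=
  ∀ k, ∑ i ∈ Finset.range N,
    (delta (w i) * expRatio b lam (w i).1 * zvec b (w i).1 k) •
      (U θ (w i).1 (w i).2.1 - linComb b β (w i).1) = 0

end Sample

/-- `β₀` is the limit in probability of the solution of the random equations `S N ω β`:
with probability tending to one there is exactly one solution, and it is as close to `β₀` as
we please. -/
def IsProbLimitOfSolution {Ω B : Type*} [MeasurableSpace Ω] [PseudoMetricSpace B]
    (μ : Measure Ω) (S : ℕ → Ω → B → Prop) (β₀ : B) : Prop :=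
  ∀ ε > 0, Tendsto
    (fun N => μ {ω | ¬ ∃ β, (∀ β', S N ω β' ↔ β' = β) ∧ dist β β₀ < ε}) atTop (𝓝 0)

section Population

variable {𝒳 𝒴 : Type*} [MeasurableSpace 𝒳] [MeasurableSpace 𝒴] {L p : ℕ}

/-- The σ-algebra generated by the covariate. -/
abbrev sigmaX (𝒳 𝒴 : Type*) [MeasurableSpace 𝒳] : MeasurableSpace (Obs 𝒳 𝒴) :=
  MeasurableSpace.comap Prod.fst inferInstance

/-- The conditional law of `X` given `δ = j`. -/
def lawGiven (P : Measure (Obs 𝒳 𝒴)) (j : Bool) : Measure 𝒳 :=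
  (ProbabilityTheory.cond P {w | w.2.2 = j}).map Prod.fst

/-- The odds `ℙ(δ = 0) / ℙ(δ = 1)`. -/
def odds (P : Measure (Obs 𝒳 𝒴)) : ℝ :=
  P.real {w | w.2.2 = false} / P.real {w | w.2.2 = true}

/-- The true density ratio `r(x) = f₀(x) / f₁(x)`. -/
def trueRatio (P : Measure (Obs 𝒳 𝒴)) (x : 𝒳) : ℝ :=
  ((lawGiven P false).rnDeriv (lawGiven P true) x).toReal

/-- The smoothed density ratio `r⋆(x) = 𝔼{r(X) ∣ b(X), δ = 1}`. -/
def smoothedRatio (P : Measure (Obs 𝒳 𝒴)) (b : 𝒳 → Vec L) : 𝒳 → ℝ :=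
  condExp (MeasurableSpace.comap b inferInstance) (lawGiven P true) (trueRatio P)

/-- The log-linear density ratio model with true parameter `lam`: the law of `X` given `δ = 0`
has a density ratio with respect to the law given `δ = 1`, and the smoothed density ratio is
`exp (lam₀ + lam₁ᵀ b(x))`. -/
def DensityRatioModel (P : Measure (Obs 𝒳 𝒴)) (b : 𝒳 → Vec L) (lam : Vec (L + 1)) : Prop :=
  lawGiven P false ≪ lawGiven P true ∧
    smoothedRatio P b =ᵐ[lawGiven P true] expRatio b lam

/-- Missing at random: `Y` and `δ` are conditionally independent given `X`. -/
def MissingAtRandom [StandardBorelSpace 𝒳] [StandardBorelSpace 𝒴] (P : Measure (Obs 𝒳 𝒴))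
    [IsProbabilityMeasure P] : Prop :=
  CondIndepFun (sigmaX 𝒳 𝒴) measurable_fst.comap_le
    (fun w : Obs 𝒳 𝒴 => w.2.1) (fun w : Obs 𝒳 𝒴 => w.2.2) P

/-- `𝔼{U(θ; X, Y) ∣ X}`. -/
def Ubar (P : Measure (Obs 𝒳 𝒴)) (U : Vec p → 𝒳 → 𝒴 → Vec p) (θ : Vec p) : Obs 𝒳 𝒴 → Vec p :=
  condExp (sigmaX 𝒳 𝒴) P (fun w => U θ w.1 w.2.1)

/-- `𝔼{U(θ; X, Y) ∣ X}` lies in `span {1, b₁(X), …, b_L(X)}`. -/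
def UbarInSpan (P : Measure (Obs 𝒳 𝒴)) (U : Vec p → 𝒳 → 𝒴 → Vec p) (b : 𝒳 → Vec L)
    (θ : Vec p) : Prop :=
  ∃ β : Fin (L + 1) → Vec p, Ubar P U θ =ᵐ[P] fun w => linComb b β w.1

/-- Entry `(j, k)` of the conditional covariance matrix `𝕍{U(θ; X, Y) ∣ X}`. -/
def condCov (P : Measure (Obs 𝒳 𝒴)) (U : Vec p → 𝒳 → 𝒴 → Vec p) (θ : Vec p)
    (j k : Fin p) : Obs 𝒳 𝒴 → ℝ :=
  condExp (sigmaX 𝒳 𝒴) P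
    (fun w => (U θ w.1 w.2.1 j - Ubar P U θ w j) * (U θ w.1 w.2.1 k - Ubar P U θ w k))

/-- `V₁ = 𝕍{Ubar(θ; X)} + 𝔼[δ ω⋆(X; lam)² 𝕍{U(θ; X, Y) ∣ X}]`. -/
def V1 (P : Measure (Obs 𝒳 𝒴)) (U : Vec p → 𝒳 → 𝒴 → Vec p) (b : 𝒳 → Vec L)
    (θ : Vec p) (lam : Vec (L + 1)) : Matrix (Fin p) (Fin p) ℝ :=
  Matrix.of fun j k =>
    covariance (fun w => Ubar P U θ w j) (fun w => Ubar P U θ w k) P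
      + ∫ w, delta w * omegaStar (odds P) b lam w.1 ^ 2 * condCov P U θ j k w ∂P

/-- `τ = 𝔼{∂U(θ; X, Y) / ∂θᵀ}`. -/
def tau (P : Measure (Obs 𝒳 𝒴)) (U : Vec p → 𝒳 → 𝒴 → Vec p) (θ : Vec p) :
    Matrix (Fin p) (Fin p) ℝ :=
  Matrix.of fun j k =>
    ∫ w, (fderiv ℝ (fun t => U t w.1 w.2.1) θ (EuclideanSpace.single k 1)) j ∂P

/-- The conditions on the population `P`, the estimating function `U`, the functions `b`, the
parameter set `Θ`, the parameter `θ₀` and the density ratio parameter `lam`. -/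
structure RegularityConditions (P : Measure (Obs 𝒳 𝒴)) (U : Vec p → 𝒳 → 𝒴 → Vec p)
    (b : 𝒳 → Vec L) (Θ : Set (Vec p)) (θ₀ : Vec p) (lam : Vec (L + 1)) : Prop where
  /-- Respondents and nonrespondents both occur with positive probability. -/
  observed_pos : 0 < P {w | w.2.2 = true}
  missing_pos : 0 < P {w | w.2.2 = false}
  measurable_b : Measurable b
  integrable_b : Integrable (fun w => b w.1) P
  /-- `1, b₁(X), …, b_L(X)` are linearly independent. -/
  indep_b : ∀ a : Vec (L + 1), (∀ᵐ w ∂P, inner ℝ (zvec b w.1) a = 0) → a = 0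
  compact : IsCompact Θ
  interior : θ₀ ∈ interior Θ
  measurable_U : ∀ θ ∈ Θ, Measurable (fun v : 𝒳 × 𝒴 => U θ v.1 v.2)
  continuous_U : ∀ᵐ w ∂P, ContinuousOn (fun θ => U θ w.1 w.2.1) Θ
  /-- The estimating function has second moments. -/
  moment_U : ∀ θ ∈ Θ, MemLp (fun w => U θ w.1 w.2.1) 2 P
  /-- `θ₀` is the unique solution of `𝔼{U(θ; X, Y)} = 0`. -/
  unique_zero : ∀ θ ∈ Θ, (∫ w, U θ w.1 w.2.1 ∂P = 0 ↔ θ = θ₀)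
  nonsingular : IsUnit (tau P U θ₀).det
  /-- Second moments of the weighted estimating functions at the true parameters. -/
  weighted_moment : Integrable (fun w =>
    delta w * expRatio b lam w.1 ^ 2 * (‖zvec b w.1‖ ^ 2 + ‖U θ₀ w.1 w.2.1‖ ^ 2)) P
  /-- Smoothness near `θ₀`, and domination by an envelope `G` that is integrable, also with the
  weight `exp (zᵀ lam + ε ‖z‖)`, the supremum of `exp (zᵀ l)` over `‖l - lam‖ ≤ ε`. -/
  envelope : ∃ ρ > 0, ∃ ε > 0, ∃ G : 𝒳 → 𝒴 → ℝ, Metric.ball θ₀ ρ ⊆ Θ ∧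
    (∀ᵐ w ∂P, ContDiffOn ℝ 1 (fun θ => U θ w.1 w.2.1) (Metric.ball θ₀ ρ)) ∧
    (∀ᵐ w ∂P, ∀ θ ∈ Θ, ‖U θ w.1 w.2.1‖ ≤ G w.1 w.2.1) ∧
    (∀ᵐ w ∂P, ∀ θ ∈ Metric.ball θ₀ ρ,
      ‖fderiv ℝ (fun t => U t w.1 w.2.1) θ‖ ≤ G w.1 w.2.1) ∧
    Integrable (fun w => G w.1 w.2.1) P ∧
    Integrable (fun w => delta w *
      Real.exp (inner ℝ (zvec b w.1) lam + ε * ‖zvec b w.1‖) * (1 + G w.1 w.2.1)) P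

end Population

end

end SPS

/-!
The estimator solves a weighted estimating equation whose weights `δ {1 + ĉ exp (zᵀ λ̂)}` are
themselves estimated. The proof shows that, to first order, estimating the weights replaces
`δ ω⋆ U` by the influence function `ψ = zᵀβ + δ ω⋆ (U - zᵀβ)`, where `zᵀβ = 𝔼{U(θ₀) ∣ X}`.

*Convergence in probability* is convergence along a filter `whp μ` on `ℕ × Ω`, so that events with
probability tending to one can be intersected with `filter_upwards`; `BoundedInProb` is the
corresponding notion `O_P(1)`. Uniformity over a compact parameter set comes from the law of large
numbers in the Banach space of continuous functions (`uniform_avg`).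

*Moment identities.* Missing at random makes the residual `U - zᵀβ` orthogonal to all functions of
`X` among the respondents (`integral_delta_smul_residual`). The density ratio model makes the
nonrespondents look like the respondents with weight `c exp (zᵀ lam)`, as far as functions of `b(X)`
are concerned (`integral_one_sub_delta`). Together they give that the weighted estimating function is
unbiased at every `θ` (`integral_weighted_U`), that its derivative at `θ₀` has mean `τ`
(`integral_weighted_dU`), and that `ψ` has mean zero and covariance matrix `V₁`
(`integral_influence_mul`).

*The calibration parameter.* The calibration equation is the gradient of a convex problem whose
curvature is bounded below with probability tending to one (`eventually_infoForm`), and its score at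
the true parameter has order `N ^ (-1 / 2)`. Hence `√N (λ̂ - lam)` is bounded in probability
(`boundedInProb_lamHat`); no consistency of `λ̂` has to be assumed.

*Linearization.* Calibration turns the weighted mean of `zᵀβ` into its plain mean exactly
(`Calibrates.avg_linComb`). What remains is the weighted mean of the residual, and there the
first-order effects of `ĉ` and `λ̂` are multiplied by sample means of `δ exp (zᵀ lam) (U - zᵀβ)` and
`δ exp (zᵀ lam) z (U - zᵀβ)`, which tend to zero (`tendsto_sqrt_mul_sub_influence`). With
consistency (`tendsto_thetaHat`) and a first-order expansion around `θ₀` (`eventually_expansion`) this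
gives `√N (θ̂ - θ₀) = - τ⁻¹ √N (mean of ψ) + o_P(1)` (`tendsto_asymptotic_linearity`), and the central
limit theorem and Slutsky's lemma finish the proof.

*The regression coefficients* solve linear equations with a positive definite matrix, again by
`eventually_infoForm`, whose right-hand side, centred at the coefficients of `𝔼{U ∣ X}`, tends to
zero (`isProbLimitOfSolution_solvesBeta`).
-/

namespace SPS

noncomputable section

/-! ### Convergence in probability and sample means -/

section Whp

variable {Ω : Type*} [MeasurableSpace Ω]

/-- The filter on `ℕ × Ω` of the events that hold with probability tending to one: `S` belongs to
it when the (outer) measure of `{ω | (N, ω) ∉ S}` tends to `0`. Convergence along this filter is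
convergence in probability. -/
def whp (μ : Measure Ω) : Filter (ℕ × Ω) where
  sets := {S | Tendsto (fun N => μ {ω | (N, ω) ∉ S}) atTop (𝓝 0)}
  univ_sets := by simp
  sets_of_superset := by
    intro S T hS hST
    refine tendsto_of_tendsto_of_tendsto_of_le_of_le tendsto_const_nhds hS (fun _ => zero_le)
      fun N => measure_mono fun ω hω h => hω (hST h)
  inter_sets := by
    intro S T hS hT
    have h := Tendsto.add hS hT
    rw [add_zero] at h
    refine tendsto_of_tendsto_of_tendsto_of_le_of_le tendsto_const_nhds h (fun _ => zero_le)
      fun N => ?_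
    refine le_trans (measure_mono ?_) (measure_union_le _ _)
    intro ω hω
    by_contra hc
    simp only [Set.mem_union, Set.mem_ofPred_eq, not_or, not_not] at hc
    exact hω ⟨hc.1, hc.2⟩

variable {μ : Measure Ω}

lemma eventually_whp {p : ℕ × Ω → Prop} :
    (∀ᶠ q in whp μ, p q) ↔ Tendsto (fun N => μ {ω | ¬ p (N, ω)}) atTop (𝓝 0) := Iff.rfl

lemma tendsto_fst_whp : Tendsto Prod.fst (whp μ) atTop := by
  refine tendsto_atTop.2 fun n => ?_
  rw [eventually_whp]
  refine tendsto_const_nhds.congr' ?_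
  filter_upwards [eventually_ge_atTop n] with N hN
  simp [hN]

lemma tendsto_whp_iff {E : Type*} [PseudoMetricSpace E] {X : ℕ × Ω → E} {x : E} :
    Tendsto X (whp μ) (𝓝 x) ↔ TendstoInMeasure μ (fun N ω => X (N, ω)) atTop (fun _ => x) := by
  simp only [tendstoInMeasure_iff_dist, Metric.tendsto_nhds, eventually_whp, not_lt]

/-- `X` is bounded in probability (tight): `|X N|` exceeds a large constant with small
probability, for all large `N`. -/
def BoundedInProb (μ : Measure Ω) (X : ℕ × Ω → ℝ) : Prop :=
  ∀ ε : ENNReal, 0 < ε → ∃ M : ℝ, ∀ᶠ N in atTop, μ {ω | M < |X (N, ω)|} ≤ ε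

lemma BoundedInProb.mono {X Y : ℕ × Ω → ℝ} (hY : BoundedInProb μ Y)
    (h : ∀ᶠ q in whp μ, |X q| ≤ |Y q|) : BoundedInProb μ X := by
  intro ε hε
  obtain ⟨M, hM⟩ := hY (ε / 2) (ENNReal.half_pos hε.ne')
  refine ⟨M, ?_⟩
  have h' := (ENNReal.tendsto_nhds_zero.1 (eventually_whp.1 h)) (ε / 2) (ENNReal.half_pos hε.ne')
  filter_upwards [hM, h'] with N h1 h2
  calc μ {ω | M < |X (N, ω)|}
      ≤ μ ({ω | M < |Y (N, ω)|} ∪ {ω | ¬ |X (N, ω)| ≤ |Y (N, ω)|}) := by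
        refine measure_mono fun ω hω => ?_
        by_cases hc : |X (N, ω)| ≤ |Y (N, ω)|
        · exact Or.inl (lt_of_lt_of_le hω hc)
        · exact Or.inr hc
    _ ≤ ε / 2 + ε / 2 := (measure_union_le _ _).trans (add_le_add h1 h2)
    _ = ε := ENNReal.add_halves ε

lemma BoundedInProb.add {X Y : ℕ × Ω → ℝ} (hX : BoundedInProb μ X) (hY : BoundedInProb μ Y) :
    BoundedInProb μ (fun q => X q + Y q) := by
  intro ε hε
  obtain ⟨M, hM⟩ := hX (ε / 2) (ENNReal.half_pos hε.ne')
  obtain ⟨M', hM'⟩ := hY (ε / 2) (ENNReal.half_pos hε.ne')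
  refine ⟨M + M', ?_⟩
  filter_upwards [hM, hM'] with N h1 h2
  calc μ {ω | M + M' < |X (N, ω) + Y (N, ω)|}
      ≤ μ ({ω | M < |X (N, ω)|} ∪ {ω | M' < |Y (N, ω)|}) := by
        refine measure_mono fun ω hω => ?_
        by_contra hc
        simp only [Set.mem_union, Set.mem_ofPred_eq, not_or, not_lt] at hc hω
        linarith [abs_add_le (X (N, ω)) (Y (N, ω))]
    _ ≤ ε / 2 + ε / 2 := (measure_union_le _ _).trans (add_le_add h1 h2)
    _ = ε := ENNReal.add_halves ε

lemma BoundedInProb.sum {ι : Type*} {s : Finset ι} {X : ι → ℕ × Ω → ℝ}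
    (hX : ∀ i ∈ s, BoundedInProb μ (X i)) : BoundedInProb μ (fun q => ∑ i ∈ s, X i q) := by
  classical
  induction s using Finset.induction_on with
  | empty => exact fun ε hε => ⟨0, by simp⟩
  | insert a s ha ih =>
    simp only [Finset.sum_insert ha]
    exact (hX a (by simp)).add (ih fun i hi => hX i (by simp [hi]))

lemma BoundedInProb.const_mul {X : ℕ × Ω → ℝ} (hX : BoundedInProb μ X) (c : ℝ) :
    BoundedInProb μ (fun q => c * X q) := by
  intro ε hε
  obtain ⟨M, hM⟩ := hX ε hε
  refine ⟨|c| * M, ?_⟩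
  filter_upwards [hM] with N h1
  refine le_trans (measure_mono fun ω hω => ?_) h1
  simp only [Set.mem_ofPred_eq, abs_mul] at hω ⊢
  exact lt_of_mul_lt_mul_left hω (abs_nonneg c)

lemma BoundedInProb.mul_tendsto_zero {X Y : ℕ × Ω → ℝ} (hX : BoundedInProb μ X)
    (hY : Tendsto Y (whp μ) (𝓝 0)) : Tendsto (fun q => X q * Y q) (whp μ) (𝓝 0) := by
  rw [Metric.tendsto_nhds]
  intro η hη
  rw [eventually_whp, ENNReal.tendsto_nhds_zero]
  intro ε hε
  obtain ⟨M, hM⟩ := hX (ε / 2) (ENNReal.half_pos hε.ne')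
  have h1 := Metric.tendsto_nhds.1 hY (η / (|M| + 1)) (by positivity)
  rw [eventually_whp, ENNReal.tendsto_nhds_zero] at h1
  filter_upwards [hM, h1 (ε / 2) (ENNReal.half_pos hε.ne')] with N h2 h3
  refine le_trans (measure_mono ?_) ((measure_union_le _ _).trans
    ((add_le_add h2 h3).trans (ENNReal.add_halves ε).le))
  intro ω hω
  by_contra hc
  simp only [Set.mem_union, Set.mem_ofPred_eq, not_or, not_lt, dist_zero_right,
    Real.norm_eq_abs, abs_mul] at hc hω
  have h4 : |X (N, ω)| ≤ |M| := hc.1.trans (le_abs_self M)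
  have h5 : |X (N, ω)| * |Y (N, ω)| ≤ |M| * (η / (|M| + 1)) := by
    gcongr
    exact (lt_of_not_ge hc.2).le
  have h6 : |M| * (η / (|M| + 1)) < η := by
    rw [← mul_div_assoc, div_lt_iff₀ (by positivity)]
    nlinarith [abs_nonneg M]
  linarith

lemma boundedInProb_of_tendsto {X : ℕ × Ω → ℝ} {x : ℝ} (hX : Tendsto X (whp μ) (𝓝 x)) :
    BoundedInProb μ X := by
  intro ε hε
  refine ⟨|x| + 1, ?_⟩
  have h1 := Metric.tendsto_nhds.1 hX 1 one_pos
  rw [eventually_whp, ENNReal.tendsto_nhds_zero] at h1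
  filter_upwards [h1 ε hε] with N h2
  refine le_trans (measure_mono ?_) h2
  intro ω hω hc
  simp only [Set.mem_ofPred_eq, Real.dist_eq] at hω hc
  linarith [abs_sub_abs_le_abs_sub (X (N, ω)) x]

end Whp

section Averages

variable {Ω 𝒮 E : Type*}

/-- The sample mean `N⁻¹ ∑_{i < N} f(W i)`, as a function of the sample size and the outcome. -/
def avg [AddCommMonoid E] [Module ℝ E] (W : ℕ → Ω → 𝒮) (f : 𝒮 → E) (q : ℕ × Ω) : E :=
  (q.1 : ℝ)⁻¹ • ∑ i ∈ Finset.range q.1, f (W i q.2)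

lemma avg_add [AddCommGroup E] [Module ℝ E] (W : ℕ → Ω → 𝒮) (f g : 𝒮 → E) (q : ℕ × Ω) :
    avg W (fun w => f w + g w) q = avg W f q + avg W g q := by
  simp [avg, Finset.sum_add_distrib]

lemma avg_sub [AddCommGroup E] [Module ℝ E] (W : ℕ → Ω → 𝒮) (f g : 𝒮 → E) (q : ℕ × Ω) :
    avg W (fun w => f w - g w) q = avg W f q - avg W g q := by
  simp [avg, Finset.sum_sub_distrib, smul_sub]

lemma avg_map [AddCommGroup E] [Module ℝ E] {F : Type*} [AddCommGroup F] [Module ℝ F]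
    (W : ℕ → Ω → 𝒮) (f : 𝒮 → E) (T : E →ₗ[ℝ] F) (q : ℕ × Ω) :
    avg W (fun w => T (f w)) q = T (avg W f q) := by
  simp [avg]

lemma avg_const_mul (W : ℕ → Ω → 𝒮) (f : 𝒮 → ℝ) (c : ℝ) (q : ℕ × Ω) :
    avg W (fun w => c * f w) q = c * avg W f q :=
  avg_map W f (LinearMap.mulLeft ℝ c) q

lemma avg_const_smul [AddCommGroup E] [Module ℝ E] (W : ℕ → Ω → 𝒮) (f : 𝒮 → E) (c : ℝ)
    (q : ℕ × Ω) : avg W (fun w => c • f w) q = c • avg W f q :=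
  avg_map W f (c • LinearMap.id) q

lemma avg_sum [AddCommGroup E] [Module ℝ E] {ι : Type*} (s : Finset ι) (W : ℕ → Ω → 𝒮)
    (f : ι → 𝒮 → E) (q : ℕ × Ω) :
    avg W (fun w => ∑ j ∈ s, f j w) q = ∑ j ∈ s, avg W (f j) q := by
  simp only [avg]
  rw [Finset.sum_comm, Finset.smul_sum]

lemma norm_avg_le [NormedAddCommGroup E] [NormedSpace ℝ E] (W : ℕ → Ω → 𝒮) (f : 𝒮 → E)
    (q : ℕ × Ω) : ‖avg W f q‖ ≤ avg W (fun w => ‖f w‖) q := by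
  rw [avg, avg, norm_smul, norm_inv, Real.norm_natCast, smul_eq_mul]
  gcongr
  exact norm_sum_le _ _

lemma avg_mono {W : ℕ → Ω → 𝒮} {f g : 𝒮 → ℝ} {q : ℕ × Ω}
    (h : ∀ i, f (W i q.2) ≤ g (W i q.2)) : avg W f q ≤ avg W g q := by
  simp only [avg, smul_eq_mul]
  gcongr
  exact h _

lemma avg_congr [AddCommMonoid E] [Module ℝ E] {W : ℕ → Ω → 𝒮} {f g : 𝒮 → E} {q : ℕ × Ω}
    (h : ∀ i, f (W i q.2) = g (W i q.2)) : avg W f q = avg W g q := by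
  simp only [avg, h]

variable [MeasurableSpace Ω] [MeasurableSpace 𝒮] {μ : Measure Ω}
  {P : Measure 𝒮} {W : ℕ → Ω → 𝒮}

lemma ae_sample (hlaw : ∀ i, HasLaw (W i) P μ) {p : 𝒮 → Prop} (hp : ∀ᵐ w ∂P, p w) :
    ∀ᵐ ω ∂μ, ∀ i, p (W i ω) := by
  refine ae_all_iff.2 fun i => ?_
  have := (hlaw i).map_eq ▸ hp
  exact ae_of_ae_map (hlaw i).aemeasurable this

/-- An almost sure property of one observation holds for the whole sample, with probability
tending to one. -/
lemma whp_sample (hlaw : ∀ i, HasLaw (W i) P μ) {p : 𝒮 → Prop} (hp : ∀ᵐ w ∂P, p w) :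
    ∀ᶠ q in whp μ, ∀ i, p (W i q.2) := by
  rw [eventually_whp]
  have h : μ {ω | ¬ ∀ i, p (W i ω)} = 0 := ae_sample hlaw hp
  exact tendsto_const_nhds.congr fun _ => h.symm

lemma aemeasurable_comp_sample [MeasurableSpace E] (hlaw : ∀ i, HasLaw (W i) P μ) {f : 𝒮 → E}
    (hf : AEMeasurable f P) (i : ℕ) : AEMeasurable (fun ω => f (W i ω)) μ :=
  ((hlaw i).map_eq ▸ hf : AEMeasurable f (μ.map (W i))).comp_aemeasurable (hlaw i).aemeasurable

lemma iIndepFun_comp_sample [MeasurableSpace E] (hlaw : ∀ i, HasLaw (W i) P μ)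
    (hindep : iIndepFun W μ) {f : 𝒮 → E} (hf : AEMeasurable f P) :
    iIndepFun (fun i ω => f (W i ω)) μ :=
  hindep.comp₀ (fun _ => f) (fun i => (hlaw i).aemeasurable) (fun i => (hlaw i).map_eq ▸ hf)

lemma identDistrib_comp_sample [MeasurableSpace E] (hlaw : ∀ i, HasLaw (W i) P μ) {f : 𝒮 → E}
    (hf : AEMeasurable f P) (i : ℕ) :
    IdentDistrib (fun ω => f (W i ω)) (fun ω => f (W 0 ω)) μ μ :=
  ((hlaw i).identDistrib (hlaw 0)).comp_of_aemeasurable ((hlaw i).map_eq ▸ hf)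

lemma integrable_comp_sample [NormedAddCommGroup E] (hlaw : ∀ i, HasLaw (W i) P μ) {f : 𝒮 → E}
    (hf : Integrable f P) (i : ℕ) : Integrable (fun ω => f (W i ω)) μ :=
  ((hlaw i).map_eq ▸ hf : Integrable f (μ.map (W i))).comp_aemeasurable (hlaw i).aemeasurable

variable [IsProbabilityMeasure μ] [NormedAddCommGroup E] [NormedSpace ℝ E] [MeasurableSpace E]
  [BorelSpace E]

/-- The weak law of large numbers in a Banach space. -/
theorem tendsto_avg [CompleteSpace E] (hlaw : ∀ i, HasLaw (W i) P μ) (hindep : iIndepFun W μ)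
    {f : 𝒮 → E} (hf : Integrable f P) :
    Tendsto (avg W f) (whp μ) (𝓝 (∫ w, f w ∂P)) := by
  have hm : AEMeasurable f P := hf.aestronglyMeasurable.aemeasurable
  have hsl := strong_law_ae (μ := μ) (fun i ω => f (W i ω)) (integrable_comp_sample hlaw hf 0)
    (fun i j hij => (iIndepFun_comp_sample hlaw hindep hm).indepFun hij)
    (identDistrib_comp_sample hlaw hm)
  have hint : ∫ ω, f (W 0 ω) ∂μ = ∫ w, f w ∂P := (hlaw 0).integral_comp hf.aestronglyMeasurable
  rw [hint] at hsl
  rw [tendsto_whp_iff]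
  refine tendstoInMeasure_of_tendsto_ae (fun N => ?_) hsl
  exact (Finset.aestronglyMeasurable_fun_sum (Finset.range N) fun i _ =>
    (integrable_comp_sample hlaw hf i).aestronglyMeasurable).const_smul (N : ℝ)⁻¹

omit [IsProbabilityMeasure μ] in
lemma aemeasurable_avg [SecondCountableTopology E] (hlaw : ∀ i, HasLaw (W i) P μ) {f : 𝒮 → E}
    (hf : AEMeasurable f P) (N : ℕ) : AEMeasurable (fun ω => avg W f (N, ω)) μ := by
  exact (Finset.aemeasurable_fun_sum (Finset.range N) fun i _ =>
    aemeasurable_comp_sample hlaw hf i).const_smul (N : ℝ)⁻¹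

end Averages

/-! ### Uniform laws of large numbers and the central limit theorem -/

section UniformLaw

variable {Ω 𝒮 T E : Type*} [MeasurableSpace 𝒮]
  [TopologicalSpace T] [CompactSpace T] [SecondCountableTopology T] [LocallyCompactSpace T]
  [NormedAddCommGroup E] [NormedSpace ℝ E] [SecondCountableTopology E]

omit [NormedSpace ℝ E] in
/-- The Borel σ-algebra of `C(T, E)` is generated by the evaluations at a countable dense set. -/
lemma measurable_continuousMap_of_eval [MeasurableSpace E] [BorelSpace E]
    [MeasurableSpace C(T, E)] [BorelSpace C(T, E)]
    {D : Set T} (hDc : D.Countable) (hD : Dense D) {Φ : 𝒮 → C(T, E)}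
    (h : ∀ t ∈ D, Measurable fun w => Φ w t) : Measurable Φ := by
  have hb : TopologicalSpace.IsTopologicalBasis
      {s : Set C(T, E) | ∃ g r, s = Metric.ball g r} := by
    refine TopologicalSpace.isTopologicalBasis_of_isOpen_of_nhds ?_ ?_
    · rintro _ ⟨g, r, rfl⟩
      exact Metric.isOpen_ball
    · intro g s hg hs
      obtain ⟨r, hr, hrs⟩ := Metric.isOpen_iff.1 hs g hg
      exact ⟨_, ⟨g, r, rfl⟩, Metric.mem_ball_self hr, hrs⟩
  have hgen := hb.borel_eq_generateFrom
  rw [← BorelSpace.measurable_eq (α := C(T, E))] at hgen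
  rw [hgen]
  refine measurable_generateFrom ?_
  rintro _ ⟨g, r, rfl⟩
  have hdist : Measurable fun w => dist (Φ w) g := by
    refine measurable_of_Iic fun c => ?_
    rcases lt_or_ge c 0 with hc | hc
    · convert MeasurableSet.empty
      ext w
      simpa using hc.trans_le dist_nonneg
    · have hset : (fun w => dist (Φ w) g) ⁻¹' Set.Iic c
          = ⋂ t ∈ D, {w | dist (Φ w t) (g t) ≤ c} := by
        ext w
        simp only [Set.mem_preimage, Set.mem_Iic, Set.mem_iInter, Set.mem_ofPred_eq]
        rw [ContinuousMap.dist_le hc]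
        refine ⟨fun H t _ => H t, fun H t => ?_⟩
        have hcl : IsClosed {t | dist (Φ w t) (g t) ≤ c} :=
          isClosed_le ((Φ w).continuous.dist g.continuous) continuous_const
        exact (hcl.closure_subset_iff.2 H) (hD t)
      rw [hset]
      exact MeasurableSet.biInter hDc fun t ht =>
        measurableSet_le ((h t ht).dist measurable_const) measurable_const
  exact hdist measurableSet_Iio

variable [MeasurableSpace Ω] {μ : Measure Ω} [IsProbabilityMeasure μ] {P : Measure 𝒮}
  {W : ℕ → Ω → 𝒮} [CompleteSpace E]

/-- The uniform weak law of large numbers: sample means of a dominated family of functions,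
continuous in a parameter that ranges over a compact space, converge uniformly in the parameter.
This is the law of large numbers in the separable Banach space `C(T, E)`. -/
theorem uniform_avg (hlaw : ∀ i, HasLaw (W i) P μ) (hindep : iIndepFun W μ)
    {f : T → 𝒮 → E} {H : 𝒮 → ℝ} (hm : ∀ t, AEStronglyMeasurable (f t) P)
    (hc : ∀ᵐ w ∂P, Continuous fun t => f t w) (hH : Integrable H P)
    (hb : ∀ᵐ w ∂P, ∀ t, ‖f t w‖ ≤ H w) :
    Continuous (fun t => ∫ w, f t w ∂P) ∧
      ∀ η > 0, ∀ᶠ q in whp μ, ∀ t, ‖avg W (f t) q - ∫ w, f t w ∂P‖ ≤ η := by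
  classical
  let : MeasurableSpace E := borel E
  have : BorelSpace E := ⟨rfl⟩
  let : MeasurableSpace C(T, E) := borel _
  have : BorelSpace C(T, E) := ⟨rfl⟩
  obtain ⟨D, hDc, hD⟩ := TopologicalSpace.exists_countable_dense T
  have hmk : ∀ᵐ w ∂P, ∀ t ∈ D, f t w = (hm t).mk (f t) w :=
    (ae_ball_iff hDc).2 fun t _ => (hm t).ae_eq_mk
  obtain ⟨A, hA, hAm, hAp⟩ := (hc.and (hb.and hmk)).exists_measurable_mem
  -- `Φ w` is the function `t ↦ f t w`, replaced by `0` off a measurable set `A` of full measure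
  -- on which all the hypotheses hold
  let Φ : 𝒮 → C(T, E) := fun w => if h : w ∈ A then ⟨fun t => f t w, (hAp w h).1⟩ else 0
  have hΦ : ∀ w ∈ A, ∀ t, Φ w t = f t w := by
    intro w hw t
    simp [Φ, hw]
  have hΦm : Measurable Φ := by
    refine measurable_continuousMap_of_eval hDc hD fun t ht => ?_
    have : (fun w => Φ w t) = A.indicator ((hm t).mk (f t)) := by
      ext w
      by_cases hw : w ∈ A
      · rw [hΦ w hw, Set.indicator_of_mem hw, (hAp w hw).2.2 t ht]
      · simp [Φ, hw]
    rw [this]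
    exact (hm t).stronglyMeasurable_mk.measurable.indicator hAm
  have hΦi : Integrable Φ P := by
    refine hH.abs.mono' hΦm.aestronglyMeasurable ?_
    filter_upwards [hA] with w hw
    rw [ContinuousMap.norm_le _ (abs_nonneg _)]
    intro t
    rw [hΦ w hw]
    exact ((hAp w hw).2.1 t).trans (le_abs_self _)
  have hint : ∀ t, (∫ w, Φ w ∂P) t = ∫ w, f t w ∂P := by
    intro t
    have h1 := (ContinuousMap.evalCLM ℝ (M := E) t).integral_comp_comm hΦi
    rw [ContinuousMap.evalCLM_apply] at h1
    rw [← h1]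
    refine integral_congr_ae ?_
    filter_upwards [hA] with w hw
    exact hΦ w hw t
  refine ⟨(∫ w, Φ w ∂P).continuous.congr hint, fun η hη => ?_⟩
  have hlim := Metric.tendsto_nhds.1 (tendsto_avg hlaw hindep hΦi) η hη
  filter_upwards [hlim, whp_sample hlaw hA] with q hq hqA t
  have h1 : avg W (f t) q = (avg W Φ q) t := by
    have h2 := avg_map W Φ (ContinuousMap.evalCLM ℝ (M := E) t).toLinearMap q
    refine Eq.trans (avg_congr fun i => ?_) h2
    exact (hΦ _ (hqA i) t).symm
  rw [h1, ← hint, ← dist_eq_norm]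
  exact (ContinuousMap.dist_apply_le_dist t).trans hq.le

end UniformLaw

section CentralLimit

variable {Ω 𝒮 : Type*} [MeasurableSpace 𝒮] [MeasurableSpace Ω] {μ : Measure Ω}
  [IsProbabilityMeasure μ] {P : Measure 𝒮} {W : ℕ → Ω → 𝒮}

omit [IsProbabilityMeasure μ] in
lemma memLp_comp_sample (hlaw : ∀ i, HasLaw (W i) P μ) {f : 𝒮 → ℝ}
    (hf : MemLp f 2 P) (i : ℕ) : MemLp (fun ω => f (W i ω)) 2 μ := by
  have h : MemLp f 2 (μ.map (W i)) := (hlaw i).map_eq ▸ hf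
  exact h.comp_of_map (hlaw i).aemeasurable

/-- Chebyshev's inequality: centred sample means are of order `N ^ (-1 / 2)`. -/
theorem boundedInProb_sqrt_mul_avg (hlaw : ∀ i, HasLaw (W i) P μ) (hindep : iIndepFun W μ)
    {f : 𝒮 → ℝ} (hf : MemLp f 2 P) (h0 : ∫ w, f w ∂P = 0) :
    BoundedInProb μ (fun q => √(q.1 : ℝ) * avg W f q) := by
  have : IsProbabilityMeasure P := (hlaw 0).isProbabilityMeasure_iff.1 inferInstance
  have hmeas : AEMeasurable f P := hf.aestronglyMeasurable.aemeasurable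
  have hint : ∀ i, ∫ ω, f (W i ω) ∂μ = 0 := fun i =>
    ((hlaw i).integral_comp hf.aestronglyMeasurable).trans h0
  have hmem := memLp_comp_sample hlaw hf
  set v := Var[fun ω => f (W 0 ω); μ] with hv
  have hvar : ∀ i, Var[fun ω => f (W i ω); μ] = v := fun i =>
    (identDistrib_comp_sample hlaw hmeas i).variance_eq
  let X : ℕ → Ω → ℝ := fun N ω => √(N : ℝ) * avg W f (N, ω)
  have hXeq : ∀ N, X N = (√(N : ℝ) * (N : ℝ)⁻¹) • ∑ i ∈ Finset.range N, fun ω => f (W i ω) := by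
    intro N
    ext ω
    simp [X, avg, mul_assoc]
  have hXm : ∀ N, MemLp (X N) 2 μ := fun N => by
    rw [hXeq]
    exact (memLp_finsetSum' _ fun i _ => hmem i).const_smul _
  have hX0 : ∀ N, μ[X N] = 0 := fun N => by
    rw [hXeq]
    simp only [Pi.smul_apply, Finset.sum_apply, smul_eq_mul]
    rw [integral_const_mul, integral_finsetSum _ fun i _ => (hmem i).integrable (by norm_num)]
    simp [hint]
  have hXv : ∀ N, Var[X N; μ] ≤ v := fun N => by
    rw [hXeq, variance_smul, IndepFun.variance_sum (fun i _ => hmem i)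
      (fun i _ j _ hij => (iIndepFun_comp_sample hlaw hindep hmeas).indepFun hij)]
    simp only [hvar, Finset.sum_const, Finset.card_range, nsmul_eq_mul]
    rcases Nat.eq_zero_or_pos N with rfl | hN
    · simp only [Nat.cast_zero, Real.sqrt_zero, zero_mul, mul_zero]
      exact variance_nonneg _ _
    · have hN' : (0 : ℝ) < N := by exact_mod_cast hN
      rw [mul_pow, Real.sq_sqrt hN'.le]
      apply le_of_eq
      field_simp
  intro ε hε
  -- `ε` may be infinite; `M = v / e + 1` satisfies `v / M ^ 2 ≤ e`
  set e := (min ε 1).toReal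
  have hmin : min ε 1 ≠ ⊤ := ne_top_of_le_ne_top ENNReal.one_ne_top (min_le_right _ _)
  have he : 0 < e := ENNReal.toReal_pos (by simp [hε.ne']) hmin
  have hv0 : 0 ≤ v := variance_nonneg _ _
  have hM : 0 < v / e + 1 := by positivity
  refine ⟨v / e + 1, Eventually.of_forall fun N => ?_⟩
  calc μ {ω | v / e + 1 < |√(N : ℝ) * avg W f (N, ω)|}
      ≤ μ {ω | v / e + 1 ≤ |X N ω - μ[X N]|} := by
        refine measure_mono fun ω hω => ?_
        rw [Set.mem_ofPred_eq] at hω ⊢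
        rw [hX0, sub_zero]
        exact hω.le
    _ ≤ ENNReal.ofReal (Var[X N; μ] / (v / e + 1) ^ 2) := meas_ge_le_variance_div_sq (hXm N) hM
    _ ≤ ENNReal.ofReal e := by
        apply ENNReal.ofReal_le_ofReal
        rw [div_le_iff₀ (by positivity)]
        refine (hXv N).trans ?_
        have h1 : e * (v / e) = v := by field_simp
        have h2 : 0 ≤ v / e := by positivity
        nlinarith [mul_nonneg he.le h2, mul_nonneg he.le (mul_nonneg h2 h2)]
    _ = min ε 1 := ENNReal.ofReal_toReal hmin
    _ ≤ ε := min_le_left _ _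

lemma inner_eq_sum {n : ℕ} (x y : Vec n) : inner ℝ x y = ∑ j, x j * y j := by
  simp [PiLp.inner_apply, mul_comm]

lemma norm_le_sum_abs {n : ℕ} (v : Vec n) : ‖v‖ ≤ ∑ k, |v k| := by
  calc ‖v‖ = ‖∑ k, EuclideanSpace.single k (v k)‖ := by
        congr 1
        ext j
        simp [Pi.single_apply]
    _ ≤ ∑ k, ‖EuclideanSpace.single k (v k)‖ := norm_sum_le _ _
    _ = ∑ k, |v k| := by simp only [PiLp.norm_single, Real.norm_eq_abs]

lemma memLp_coord {p : ℕ} {ψ : 𝒮 → Vec p} (hψ : MemLp ψ 2 P) (j : Fin p) :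
    MemLp (fun w => ψ w j) 2 P :=
  (EuclideanSpace.proj (𝕜 := ℝ) j).comp_memLp' hψ

open Matrix in
/-- The second moment matrix of `ψ` determines the second moments of the projections. -/
lemma integral_inner_sq {p : ℕ} {ψ : 𝒮 → Vec p} (hψ : MemLp ψ 2 P)
    {S : Matrix (Fin p) (Fin p) ℝ} (hS : ∀ j k, S j k = ∫ w, ψ w j * ψ w k ∂P) (t : Vec p) :
    ∫ w, (inner ℝ (ψ w) t) ^ 2 ∂P = t ⬝ᵥ S *ᵥ t := by
  have hcc : ∀ j k, Integrable (fun w => ψ w j * ψ w k) P := fun j k =>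
    (memLp_coord hψ j).integrable_mul (memLp_coord hψ k)
  have h1 : ∀ w, (inner ℝ (ψ w) t) ^ 2 = ∑ j, ∑ k, (t j * t k) * (ψ w j * ψ w k) := fun w => by
    rw [inner_eq_sum, sq, Finset.sum_mul_sum]
    refine Finset.sum_congr rfl fun j _ => Finset.sum_congr rfl fun k _ => ?_
    ring
  simp only [h1]
  rw [integral_finsetSum _ fun j _ => integrable_finsetSum _ fun k _ => (hcc j k).const_mul _]
  simp only [dotProduct, mulVec, Finset.mul_sum]
  refine Finset.sum_congr rfl fun j _ => ?_
  rw [integral_finsetSum _ fun k _ => (hcc j k).const_mul _]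
  refine Finset.sum_congr rfl fun k _ => ?_
  rw [integral_const_mul, hS]
  ring

lemma posSemidef_of_secondMoment {p : ℕ} {ψ : 𝒮 → Vec p} (hψ : MemLp ψ 2 P)
    {S : Matrix (Fin p) (Fin p) ℝ} (hS : ∀ j k, S j k = ∫ w, ψ w j * ψ w k ∂P) :
    S.PosSemidef := by
  refine Matrix.PosSemidef.of_dotProduct_mulVec_nonneg ?_ fun x => ?_
  · ext j k
    simp [hS, mul_comm]
  · have := integral_inner_sq hψ hS (WithLp.toLp 2 x)
    simp only [star_trivial]
    rw [← this]
    exact integral_nonneg fun w => sq_nonneg _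

/-- The one-dimensional central limit theorem, read off at one value of the characteristic
function. -/
lemma tendsto_charFun_inv_sqrt_mul_sum {X : ℕ → Ω → ℝ} (hX : MemLp (X 0) 2 μ)
    (hindep : iIndepFun X μ) (hident : ∀ i, IdentDistrib (X i) (X 0) μ μ) (h0 : μ[X 0] = 0) :
    Tendsto (fun N : ℕ => charFun (μ.map fun ω =>
      (√(N : ℝ))⁻¹ * ∑ i ∈ Finset.range N, X i ω) 1) atTop
      (𝓝 (Complex.exp (-(Var[X 0; μ] : ℂ) / 2))) := by
  have hclt := (tendstoInDistribution_inv_sqrt_mul_sum_sub (Y := id)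
    (P' := gaussianReal 0 Var[X 0; μ].toNNReal) HasLaw.id hX hindep hident).tendsto
  have hch := ProbabilityMeasure.tendsto_iff_tendsto_charFun.1 hclt 1
  have hnn : 0 ≤ Var[X 0; μ] := variance_nonneg _ _
  simp only [ProbabilityMeasure.coe_mk, Measure.map_id, charFun_gaussianReal, h0,
    mul_zero, sub_zero] at hch
  convert hch using 2
  simp [hnn, neg_div]

open Matrix in
/-- The central limit theorem for the projections of a sample mean, in terms of characteristic
functions. -/
lemma tendsto_charFun_inner {p : ℕ} (hlaw : ∀ i, HasLaw (W i) P μ)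
    (hindep : iIndepFun W μ) {ψ : 𝒮 → Vec p} (hψ : MemLp ψ 2 P) (h0 : ∫ w, ψ w ∂P = 0)
    {S : Matrix (Fin p) (Fin p) ℝ} (hS : ∀ j k, S j k = ∫ w, ψ w j * ψ w k ∂P) (t : Vec p) :
    Tendsto (fun N : ℕ => charFun (μ.map fun ω =>
      (√(N : ℝ))⁻¹ * ∑ i ∈ Finset.range N, inner ℝ (ψ (W i ω)) t) 1) atTop
      (𝓝 (Complex.exp (-((t ⬝ᵥ S *ᵥ t : ℝ) : ℂ) / 2))) := by
  have : IsProbabilityMeasure P := (hlaw 0).isProbabilityMeasure_iff.1 inferInstance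
  have hinner : MemLp (fun w => inner ℝ (ψ w) t) 2 P := by
    have h := (innerSL ℝ t).comp_memLp' hψ
    simp only [Function.comp_def, innerSL_apply_apply] at h
    simpa only [real_inner_comm] using h
  have hinner0 : ∫ w, inner ℝ (ψ w) t ∂P = 0 := by
    have h := (innerSL ℝ t).integral_comp_comm (hψ.integrable (by norm_num))
    simp only [innerSL_apply_apply, h0, inner_zero_right] at h
    simpa only [real_inner_comm] using h
  have hg : AEMeasurable (fun w => inner ℝ (ψ w) t) P := hinner.aestronglyMeasurable.aemeasurable
  have hmean : ∫ ω, inner ℝ (ψ (W 0 ω)) t ∂μ = 0 :=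
    ((hlaw 0).integral_comp hinner.aestronglyMeasurable).trans hinner0
  have hvar : Var[fun ω => inner ℝ (ψ (W 0 ω)) t; μ] = t ⬝ᵥ S *ᵥ t := by
    rw [variance_of_integral_eq_zero (aemeasurable_comp_sample hlaw hg 0) hmean,
      ← integral_inner_sq hψ hS]
    exact (hlaw 0).integral_comp (f := fun w => (inner ℝ (ψ w) t) ^ 2)
      (hinner.aestronglyMeasurable.pow 2)
  rw [← hvar]
  exact tendsto_charFun_inv_sqrt_mul_sum (memLp_comp_sample hlaw hinner 0)
    (iIndepFun_comp_sample hlaw hindep hg) (identDistrib_comp_sample hlaw hg) hmean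

open Matrix in
/-- The multivariate central limit theorem for sample means. By Lévy's continuity theorem it
reduces to the one-dimensional theorem for the projections `⟪ψ, t⟫`. -/
theorem tendstoInDistribution_sqrt_smul_avg {p : ℕ} (hlaw : ∀ i, HasLaw (W i) P μ)
    (hindep : iIndepFun W μ) {ψ : 𝒮 → Vec p} (hψ : MemLp ψ 2 P) (h0 : ∫ w, ψ w ∂P = 0)
    {S : Matrix (Fin p) (Fin p) ℝ} (hS : ∀ j k, S j k = ∫ w, ψ w j * ψ w k ∂P) :
    TendstoInDistribution (fun (N : ℕ) ω => √(N : ℝ) • avg W ψ (N, ω)) atTop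
      id (fun _ => μ) (multivariateGaussian 0 S) := by
  have hmeas : AEMeasurable ψ P := hψ.aestronglyMeasurable.aemeasurable
  have haem : ∀ N : ℕ, AEMeasurable (fun ω => √(N : ℝ) • avg W ψ (N, ω)) μ := fun N =>
    (aemeasurable_avg hlaw hmeas N).const_smul √(N : ℝ)
  refine ⟨haem, aemeasurable_id, ?_⟩
  refine ProbabilityMeasure.tendsto_iff_tendsto_charFun.2 fun t => ?_
  have hg : AEMeasurable (fun w => inner ℝ (ψ w) t) P := by fun_prop
  have hch := tendsto_charFun_inner hlaw hindep hψ h0 hS t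
  have hrhs : charFun (multivariateGaussian 0 S) t
      = Complex.exp (-((t ⬝ᵥ S *ᵥ t : ℝ) : ℂ) / 2) := by
    rw [charFun_multivariateGaussian (posSemidef_of_secondMoment hψ hS)]
    simp [neg_div]
  simp only [ProbabilityMeasure.coe_mk, Measure.map_id]
  rw [hrhs]
  refine hch.congr fun N => ?_
  rw [charFun_apply, charFun_apply, integral_map (haem N) (by fun_prop), integral_map]
  · refine integral_congr_ae (Eventually.of_forall fun ω => ?_)
    have h1 : (√(N : ℝ))⁻¹ = √(N : ℝ) * (N : ℝ)⁻¹ := by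
      rw [← div_eq_mul_inv, Real.sqrt_div_self]
    simp only [avg, real_inner_smul_left, sum_inner]
    rw [← mul_assoc, ← h1]
    simp
  · exact (Finset.aemeasurable_fun_sum _ fun i _ =>
      aemeasurable_comp_sample hlaw hg i).const_mul _
  · fun_prop

end CentralLimit

/-! ### Indicators, weights and missingness at random -/

section Basic

variable {𝒳 𝒴 : Type*} {L : ℕ}

/-- The event that `y` is observed. -/
def observed (𝒳 𝒴 : Type*) : Set (Obs 𝒳 𝒴) := {w | w.2.2 = true}

lemma delta_eq_indicator : (delta : Obs 𝒳 𝒴 → ℝ) = (observed 𝒳 𝒴).indicator 1 := by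
  ext w
  simp [delta, observed, Set.indicator_apply]

lemma delta_smul_eq_indicator {E : Type*} [AddCommGroup E] [Module ℝ E] (f : Obs 𝒳 𝒴 → E) :
    (fun w => delta w • f w) = (observed 𝒳 𝒴).indicator f := by
  ext w
  by_cases h : w.2.2 = true <;> simp [delta, observed, h]

lemma one_sub_delta_smul_eq_indicator {E : Type*} [AddCommGroup E] [Module ℝ E]
    (f : Obs 𝒳 𝒴 → E) :
    (fun w => (1 - delta w) • f w) = (observed 𝒳 𝒴)ᶜ.indicator f := by
  ext w
  by_cases h : w.2.2 = true <;> simp [delta, observed, h]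

lemma delta_nonneg (w : Obs 𝒳 𝒴) : 0 ≤ delta w := by
  unfold delta; split_ifs <;> norm_num

lemma delta_le_one (w : Obs 𝒳 𝒴) : delta w ≤ 1 := by
  unfold delta; split_ifs <;> norm_num

lemma delta_mul_self (w : Obs 𝒳 𝒴) : delta w * delta w = delta w := by
  unfold delta; split_ifs <;> norm_num

lemma zvec_zero (b : 𝒳 → Vec L) (x : 𝒳) : zvec b x 0 = 1 := rfl

lemma one_le_norm_zvec (b : 𝒳 → Vec L) (x : 𝒳) : 1 ≤ ‖zvec b x‖ := by
  have h := PiLp.norm_apply_le (zvec b x) 0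
  rwa [zvec_zero, norm_one] at h

lemma expRatio_pos (b : 𝒳 → Vec L) (lam : Vec (L + 1)) (x : 𝒳) : 0 < expRatio b lam x :=
  Real.exp_pos _

lemma norm_linComb_le {p : ℕ} (b : 𝒳 → Vec L) (β : Fin (L + 1) → Vec p) (x : 𝒳) :
    ‖linComb b β x‖ ≤ (∑ k, ‖β k‖) * ‖zvec b x‖ := by
  rw [linComb, Finset.sum_mul]
  refine (norm_sum_le _ _).trans (Finset.sum_le_sum fun k _ => ?_)
  rw [norm_smul, mul_comm]
  gcongr
  exact PiLp.norm_apply_le _ k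

variable [MeasurableSpace 𝒳] [MeasurableSpace 𝒴]

lemma measurableSet_observed : MeasurableSet (observed 𝒳 𝒴) :=
  (measurable_snd.comp measurable_snd) (measurableSet_singleton true)

@[fun_prop]
lemma measurable_delta : Measurable (delta : Obs 𝒳 𝒴 → ℝ) := by
  rw [delta_eq_indicator]
  exact measurable_one.indicator measurableSet_observed

lemma measurable_zvec {b : 𝒳 → Vec L} (hb : Measurable b) : Measurable (zvec b) := by
  refine (MeasurableEquiv.toLp 2 (Fin (L + 1) → ℝ)).measurable.comp ?_
  refine measurable_pi_lambda _ fun k => ?_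
  refine Fin.cases ?_ (fun j => ?_) k
  · exact measurable_const
  · simp only [Fin.cons_succ]
    fun_prop

lemma measurable_expRatio {b : 𝒳 → Vec L} (hb : Measurable b) (lam : Vec (L + 1)) :
    Measurable (expRatio b lam) :=
  Real.measurable_exp.comp ((measurable_zvec hb).inner measurable_const)

lemma measurable_omegaStar {b : 𝒳 → Vec L} (hb : Measurable b) (c : ℝ) (lam : Vec (L + 1)) :
    Measurable (omegaStar c b lam) :=
  measurable_const.add ((measurable_expRatio hb lam).const_mul c)

lemma measurable_linComb {p : ℕ} {b : 𝒳 → Vec L} (hb : Measurable b) (β : Fin (L + 1) → Vec p) :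
    Measurable (linComb b β) := by
  have := measurable_zvec hb
  unfold linComb
  fun_prop

variable {P : Measure (Obs 𝒳 𝒴)} {E : Type*} [NormedAddCommGroup E] [NormedSpace ℝ E]

lemma integral_delta_smul (f : Obs 𝒳 𝒴 → E) :
    ∫ w, delta w • f w ∂P = ∫ w in observed 𝒳 𝒴, f w ∂P := by
  rw [delta_smul_eq_indicator, integral_indicator measurableSet_observed]

lemma integrable_delta_smul_iff {f : Obs 𝒳 𝒴 → E} :
    Integrable (fun w => delta w • f w) P ↔ IntegrableOn f (observed 𝒳 𝒴) P := by
  rw [delta_smul_eq_indicator, integrable_indicator_iff measurableSet_observed]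

lemma integral_one_sub_delta_smul (f : Obs 𝒳 𝒴 → E) :
    ∫ w, (1 - delta w) • f w ∂P = ∫ w in (observed 𝒳 𝒴)ᶜ, f w ∂P := by
  rw [one_sub_delta_smul_eq_indicator, integral_indicator measurableSet_observed.compl]

lemma integrable_one_sub_delta_smul_iff {f : Obs 𝒳 𝒴 → E} :
    Integrable (fun w => (1 - delta w) • f w) P ↔ IntegrableOn f (observed 𝒳 𝒴)ᶜ P := by
  rw [one_sub_delta_smul_eq_indicator, integrable_indicator_iff measurableSet_observed.compl]

lemma integrable_delta [IsFiniteMeasure P] : Integrable (delta : Obs 𝒳 𝒴 → ℝ) P := by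
  rw [delta_eq_indicator]
  exact (integrable_const (1 : ℝ)).indicator measurableSet_observed

lemma integral_delta : ∫ w, delta w ∂P = P.real (observed 𝒳 𝒴) := by
  rw [delta_eq_indicator, integral_indicator_one measurableSet_observed]

end Basic

section MissingAtRandom

variable {𝒳 𝒴 : Type*} [MeasurableSpace 𝒳] [StandardBorelSpace 𝒳]
  [MeasurableSpace 𝒴] [StandardBorelSpace 𝒴] {P : Measure (Obs 𝒳 𝒴)} [IsProbabilityMeasure P]
  {E : Type*} [NormedAddCommGroup E] [NormedSpace ℝ E] [CompleteSpace E]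

omit [StandardBorelSpace 𝒳] [StandardBorelSpace 𝒴] [MeasurableSpace 𝒴] in
lemma sigmaX_le [MeasurableSpace 𝒴] :
    sigmaX 𝒳 𝒴 ≤ (inferInstance : MeasurableSpace (Obs 𝒳 𝒴)) :=
  measurable_fst.comap_le

/-- The propensity score `ℙ(δ = 1 ∣ X)`. -/
def propensity (P : Measure (Obs 𝒳 𝒴)) : Obs 𝒳 𝒴 → ℝ :=
  condExp (sigmaX 𝒳 𝒴) P ((observed 𝒳 𝒴).indicator fun _ => (1 : ℝ))

omit [StandardBorelSpace 𝒳] [StandardBorelSpace 𝒴] [IsProbabilityMeasure P] in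
lemma integrable_propensity : Integrable (propensity P) P := integrable_condExp

omit [StandardBorelSpace 𝒳] [StandardBorelSpace 𝒴] [IsProbabilityMeasure P] in
lemma propensity_nonneg : 0 ≤ᵐ[P] propensity P :=
  condExp_nonneg (Eventually.of_forall fun _ => Set.indicator_nonneg (fun _ _ => zero_le_one) _)

omit [StandardBorelSpace 𝒳] [StandardBorelSpace 𝒴] in
lemma propensity_le_one : ∀ᵐ w ∂P, propensity P w ≤ 1 := by
  have h : propensity P ≤ᵐ[P] condExp (sigmaX 𝒳 𝒴) P fun _ => (1 : ℝ) := by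
    refine condExp_mono ?_ (integrable_const _) (Eventually.of_forall fun w => ?_)
    · exact (integrable_const _).indicator measurableSet_observed
    · exact Set.indicator_le_self' (fun _ _ => zero_le_one) w
  rw [condExp_const sigmaX_le] at h
  exact h

omit [StandardBorelSpace 𝒳] [StandardBorelSpace 𝒴] [IsProbabilityMeasure P] in
lemma stronglyMeasurable_propensity : StronglyMeasurable[sigmaX 𝒳 𝒴] (propensity P) :=
  stronglyMeasurable_condExp

omit [StandardBorelSpace 𝒳] [StandardBorelSpace 𝒴] [CompleteSpace E] in
lemma integrable_propensity_smul {f : Obs 𝒳 𝒴 → E} (hf : Integrable f P) :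
    Integrable (fun w => propensity P w • f w) P := by
  refine hf.norm.mono' ((stronglyMeasurable_propensity.mono sigmaX_le).aestronglyMeasurable.smul
    hf.aestronglyMeasurable) ?_
  filter_upwards [propensity_nonneg, propensity_le_one] with w h0 h1
  rw [norm_smul, Real.norm_of_nonneg h0]
  exact mul_le_of_le_one_left (norm_nonneg _) h1

/-- Missing at random, as an identity between laws of `(X, Y)`: restricting to the respondents
amounts to weighting with the propensity score. -/
lemma map_restrict_observed (hMAR : MissingAtRandom P) :
    (P.restrict (observed 𝒳 𝒴)).map (fun w => (w.1, w.2.1))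
      = (P.withDensity fun w => ENNReal.ofReal (propensity P w)).map (fun w => (w.1, w.2.1)) := by
  have hxy : Measurable fun w : Obs 𝒳 𝒴 => (w.1, w.2.1) := by fun_prop
  have hfin : IsFiniteMeasure (P.withDensity fun w => ENNReal.ofReal (propensity P w)) :=
    isFiniteMeasure_withDensity_ofReal integrable_propensity.2
  refine Measure.ext_prod fun {A B} hA hB => ?_
  have hci := (condIndepFun_iff_condExp_inter_preimage_eq_mul
    (measurable_fst.comp measurable_snd) (measurable_snd.comp measurable_snd)).1 hMAR B {true} hB
    (measurableSet_singleton true)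
  have hY : Measurable fun w : Obs 𝒳 𝒴 => w.2.1 := by fun_prop
  have hX : MeasurableSet[sigmaX 𝒳 𝒴] ((fun w : Obs 𝒳 𝒴 => w.1) ⁻¹' A) := ⟨A, hA, rfl⟩
  have hX' : MeasurableSet ((fun w : Obs 𝒳 𝒴 => w.1) ⁻¹' A) := sigmaX_le _ hX
  have hB' : MeasurableSet ((fun w : Obs 𝒳 𝒴 => w.2.1) ⁻¹' B) := hY hB
  rw [Measure.map_apply hxy (hA.prod hB), Measure.map_apply hxy (hA.prod hB),
    Measure.restrict_apply (hxy (hA.prod hB)), withDensity_apply _ (hxy (hA.prod hB))]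
  have hpre : (fun w : Obs 𝒳 𝒴 => (w.1, w.2.1)) ⁻¹' (A ×ˢ B)
      = ((fun w : Obs 𝒳 𝒴 => w.1) ⁻¹' A) ∩ ((fun w : Obs 𝒳 𝒴 => w.2.1) ⁻¹' B) := rfl
  rw [hpre, ← ofReal_integral_eq_lintegral_ofReal integrable_propensity.integrableOn
    (ae_restrict_of_ae propensity_nonneg), ← ofReal_measureReal]
  congr 1
  set XA := (fun w : Obs 𝒳 𝒴 => w.1) ⁻¹' A
  set YB := (fun w : Obs 𝒳 𝒴 => w.2.1) ⁻¹' B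
  have hone : Integrable (fun _ : Obs 𝒳 𝒴 => (1 : ℝ)) P := integrable_const _
  -- both sides equal the integral over `X ∈ A` of `ℙ(Y ∈ B ∣ X) ℙ(δ = 1 ∣ X)`
  calc P.real (XA ∩ YB ∩ observed 𝒳 𝒴)
      = ∫ w in XA, (YB ∩ observed 𝒳 𝒴).indicator (fun _ => (1 : ℝ)) w ∂P := by
        rw [setIntegral_indicator (hB'.inter measurableSet_observed)]
        simp [Set.inter_assoc]
    _ = ∫ w in XA, condExp (sigmaX 𝒳 𝒴) P
          ((YB ∩ observed 𝒳 𝒴).indicator fun _ => (1 : ℝ)) w ∂P :=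
        (setIntegral_condExp sigmaX_le
          (hone.indicator (hB'.inter measurableSet_observed)) hX).symm
    _ = ∫ w in XA, condExp (sigmaX 𝒳 𝒴) P (YB.indicator fun _ => (1 : ℝ)) w
          * propensity P w ∂P := setIntegral_congr_ae hX' (hci.mono fun w hw _ => hw)
    _ = ∫ w in XA, condExp (sigmaX 𝒳 𝒴) P
          ((YB.indicator fun _ => (1 : ℝ)) * propensity P) w ∂P := by
        refine setIntegral_congr_ae hX' ?_
        have h := condExp_mul_of_stronglyMeasurable_right (μ := P)
          (f := YB.indicator fun _ => (1 : ℝ)) (stronglyMeasurable_propensity (P := P)) ?_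
          (hone.indicator hB')
        · exact h.mono fun w hw _ => hw.symm
        · have := integrable_propensity_smul (P := P) (hone.indicator hB')
          refine this.congr (Eventually.of_forall fun w => ?_)
          simp [mul_comm]
    _ = ∫ w in XA, ((YB.indicator fun _ => (1 : ℝ)) * propensity P) w ∂P := by
        refine setIntegral_condExp sigmaX_le ?_ hX
        have := integrable_propensity_smul (P := P) (hone.indicator hB')
        refine this.congr (Eventually.of_forall fun w => ?_)
        simp [mul_comm]
    _ = ∫ w in XA ∩ YB, propensity P w ∂P := by
        rw [← setIntegral_indicator hB']
        refine integral_congr_ae (Eventually.of_forall fun w => ?_)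
        by_cases hw : w ∈ YB <;> simp [hw]

omit [CompleteSpace E] in
lemma setIntegral_observed (hMAR : MissingAtRandom P) {k : 𝒳 × 𝒴 → E}
    (hk : StronglyMeasurable k) :
    ∫ w in observed 𝒳 𝒴, k (w.1, w.2.1) ∂P = ∫ w, propensity P w • k (w.1, w.2.1) ∂P := by
  have hxy : Measurable fun w : Obs 𝒳 𝒴 => (w.1, w.2.1) := by fun_prop
  rw [← integral_map (μ := P.restrict (observed 𝒳 𝒴)) hxy.aemeasurable hk.aestronglyMeasurable,
    map_restrict_observed hMAR, integral_map hxy.aemeasurable hk.aestronglyMeasurable,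
    integral_withDensity_eq_integral_toReal_smul
      (stronglyMeasurable_propensity.mono sigmaX_le).measurable.ennreal_ofReal
      (Eventually.of_forall fun _ => ENNReal.ofReal_lt_top)]
  refine integral_congr_ae ?_
  filter_upwards [propensity_nonneg] with w hw
  rw [ENNReal.toReal_ofReal hw]

/-- Under missing at random, conditioning on `X` commutes with restricting to the respondents. -/
theorem condExp_restrict_observed (hMAR : MissingAtRandom P) {k : 𝒳 × 𝒴 → E}
    (hk : StronglyMeasurable k) (hki : Integrable (fun w : Obs 𝒳 𝒴 => k (w.1, w.2.1)) P) :
    condExp (sigmaX 𝒳 𝒴) (P.restrict (observed 𝒳 𝒴)) (fun w => k (w.1, w.2.1))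
      =ᵐ[P.restrict (observed 𝒳 𝒴)] condExp (sigmaX 𝒳 𝒴) P (fun w => k (w.1, w.2.1)) := by
  symm
  obtain ⟨g, hg, hgeq⟩ := (stronglyMeasurable_condExp (m := sigmaX 𝒳 𝒴) (μ := P)
    (f := fun w : Obs 𝒳 𝒴 => k (w.1, w.2.1))).exists_eq_measurable_comp
  refine ae_eq_condExp_of_forall_setIntegral_eq sigmaX_le hki.integrableOn
    (fun s _ _ => integrable_condExp.integrableOn.integrableOn) ?_
    stronglyMeasurable_condExp.aestronglyMeasurable
  rintro _ ⟨A, hA, rfl⟩ -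
  have hX : MeasurableSet[sigmaX 𝒳 𝒴] ((Prod.fst : Obs 𝒳 𝒴 → 𝒳) ⁻¹' A) := ⟨A, hA, rfl⟩
  have hX' : MeasurableSet ((Prod.fst : Obs 𝒳 𝒴 → 𝒳) ⁻¹' A) := sigmaX_le _ hX
  have hind : ∀ k' : 𝒳 × 𝒴 → E, StronglyMeasurable k' →
      ∫ w in Prod.fst ⁻¹' A, k' (w.1, w.2.1) ∂(P.restrict (observed 𝒳 𝒴))
        = ∫ w in Prod.fst ⁻¹' A, propensity P w • k' (w.1, w.2.1) ∂P := by
    intro k' hk'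
    have h := setIntegral_observed hMAR (k := (Prod.fst ⁻¹' A).indicator k')
      (hk'.indicator (measurable_fst hA))
    rw [← integral_indicator hX', ← integral_indicator hX']
    refine Eq.trans ?_ (h.trans ?_)
    · rfl
    · refine integral_congr_ae (Eventually.of_forall fun w => ?_)
      by_cases hw : w.1 ∈ A <;> simp [hw]
  rw [hind k hk]
  have h1 : ∀ w : Obs 𝒳 𝒴, condExp (sigmaX 𝒳 𝒴) P (fun w => k (w.1, w.2.1)) w = g w.1 :=
    fun w => congrFun hgeq w
  simp only [h1]
  rw [hind (fun v => g v.1) (hg.comp_measurable measurable_fst)]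
  have hpull := condExp_smul_of_aestronglyMeasurable_left (m := sigmaX 𝒳 𝒴) (μ := P)
    (stronglyMeasurable_propensity (P := P)).aestronglyMeasurable
    (integrable_propensity_smul hki) hki
  rw [← setIntegral_condExp sigmaX_le (integrable_propensity_smul hki) hX]
  refine setIntegral_congr_ae hX' ?_
  filter_upwards [hpull] with w hw _
  rw [← h1]
  exact hw.symm

/-- Under missing at random, `𝔼[δ g(X) k(X, Y)] = 𝔼[δ g(X) 𝔼{k(X, Y) ∣ X}]`. Integrability of
`g(X) k(X, Y)` is required on the respondents only. -/
theorem integral_delta_smul_condExp (hMAR : MissingAtRandom P) {g : 𝒳 → ℝ} (hg : Measurable g)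
    {k : 𝒳 × 𝒴 → E} (hk : StronglyMeasurable k)
    (hki : Integrable (fun w : Obs 𝒳 𝒴 => k (w.1, w.2.1)) P)
    (hgk : Integrable (fun w => delta w • (g w.1 • k (w.1, w.2.1))) P) :
    Integrable (fun w => delta w •
      (g w.1 • condExp (sigmaX 𝒳 𝒴) P (fun w => k (w.1, w.2.1)) w)) P ∧
    ∫ w, delta w • (g w.1 • condExp (sigmaX 𝒳 𝒴) P (fun w => k (w.1, w.2.1)) w) ∂P
      = ∫ w, delta w • (g w.1 • k (w.1, w.2.1)) ∂P := by
  rw [integrable_delta_smul_iff] at hgk ⊢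
  rw [integral_delta_smul, integral_delta_smul]
  have hgm : StronglyMeasurable[sigmaX 𝒳 𝒴] fun w : Obs 𝒳 𝒴 => g w.1 :=
    (hg.comp (comap_measurable Prod.fst)).stronglyMeasurable
  have hpull := condExp_smul_of_aestronglyMeasurable_left (m := sigmaX 𝒳 𝒴)
    (μ := P.restrict (observed 𝒳 𝒴)) (f := fun w : Obs 𝒳 𝒴 => g w.1)
    (g := fun w : Obs 𝒳 𝒴 => k (w.1, w.2.1))
    hgm.aestronglyMeasurable hgk hki.integrableOn
  have heq : condExp (sigmaX 𝒳 𝒴) (P.restrict (observed 𝒳 𝒴))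
      ((fun w : Obs 𝒳 𝒴 => g w.1) • fun w : Obs 𝒳 𝒴 => k (w.1, w.2.1))
      =ᵐ[P.restrict (observed 𝒳 𝒴)]
      fun w => g w.1 • condExp (sigmaX 𝒳 𝒴) P (fun w => k (w.1, w.2.1)) w := by
    filter_upwards [hpull, condExp_restrict_observed hMAR hk hki] with w h1 h2
    rw [h1]
    simp [h2]
  refine ⟨integrable_condExp.congr heq, ?_⟩
  rw [← integral_congr_ae heq, integral_condExp sigmaX_le]
  rfl

end MissingAtRandom

/-! ### The density ratio model -/

section DensityRatio

variable {𝒳 𝒴 : Type*} [MeasurableSpace 𝒳] [MeasurableSpace 𝒴] {L : ℕ}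
  {P : Measure (Obs 𝒳 𝒴)} [IsProbabilityMeasure P] {b : 𝒳 → Vec L} {lam : Vec (L + 1)}

omit [MeasurableSpace 𝒳] [MeasurableSpace 𝒴] in
lemma compl_observed : (observed 𝒳 𝒴)ᶜ = {w | w.2.2 = false} := by
  ext w
  simp [observed]

lemma lawGiven_true (P : Measure (Obs 𝒳 𝒴)) : lawGiven P true
    = (P (observed 𝒳 𝒴))⁻¹ • (P.restrict (observed 𝒳 𝒴)).map Prod.fst := by
  rw [lawGiven, ProbabilityTheory.cond, Measure.map_smul]
  rfl

lemma lawGiven_false (P : Measure (Obs 𝒳 𝒴)) : lawGiven P false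
    = (P (observed 𝒳 𝒴)ᶜ)⁻¹ • (P.restrict (observed 𝒳 𝒴)ᶜ).map Prod.fst := by
  rw [lawGiven, ProbabilityTheory.cond, Measure.map_smul, compl_observed]

lemma odds_eq (P : Measure (Obs 𝒳 𝒴)) :
    odds P = P.real (observed 𝒳 𝒴)ᶜ / P.real (observed 𝒳 𝒴) := by
  rw [odds, compl_observed]; rfl

instance (P : Measure (Obs 𝒳 𝒴)) (j : Bool) : IsFiniteMeasure (lawGiven P j) := by
  unfold lawGiven; infer_instance

lemma odds_pos (h1 : 0 < P {w | w.2.2 = true}) (h0 : 0 < P {w | w.2.2 = false}) :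
    0 < odds P :=
  div_pos (ENNReal.toReal_pos h0.ne' (measure_ne_top _ _))
    (ENNReal.toReal_pos h1.ne' (measure_ne_top _ _))

omit [IsProbabilityMeasure P] in
/-- The law of `b(X)` given `δ = 0` has density `exp (zᵀ lam)` with respect to the law given
`δ = 1`, on events about `b(X)`. -/
lemma lawGiven_false_preimage (hb : Measurable b) (hmodel : DensityRatioModel P b lam)
    {B : Set (Vec L)} (hB : MeasurableSet B) :
    lawGiven P false (b ⁻¹' B)
      = ∫⁻ x in b ⁻¹' B, ENNReal.ofReal (expRatio b lam x) ∂(lawGiven P true) := by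
  have hm : MeasurableSpace.comap b inferInstance ≤ (inferInstance : MeasurableSpace 𝒳) :=
    hb.comap_le
  have hint : Integrable (trueRatio P) (lawGiven P true) := Measure.integrable_toReal_rnDeriv
  have he : Integrable (expRatio b lam) (lawGiven P true) := integrable_condExp.congr hmodel.2
  have hA : MeasurableSet[MeasurableSpace.comap b inferInstance] (b ⁻¹' B) := ⟨B, hB, rfl⟩
  rw [← Measure.setLIntegral_rnDeriv hmodel.1,
    ← ofReal_integral_eq_lintegral_ofReal he.integrableOn
      (Eventually.of_forall fun x => (expRatio_pos b lam x).le),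
    ← setIntegral_congr_ae (hm _ hA) (hmodel.2.mono fun x hx _ => hx), smoothedRatio,
    setIntegral_condExp hm hint hA,
    ofReal_integral_eq_lintegral_ofReal hint.integrableOn
      (Eventually.of_forall fun x => ENNReal.toReal_nonneg)]
  refine setLIntegral_congr_fun_ae (hm _ hA) ?_
  filter_upwards [Measure.rnDeriv_lt_top (lawGiven P false) (lawGiven P true)] with x hx _
  exact (ENNReal.ofReal_toReal hx.ne).symm

/-- The density ratio model, as an identity between laws of `b(X)`: the nonrespondents look like
the respondents weighted with `c exp (zᵀ lam)`. -/
lemma map_restrict_compl_observed (h1 : 0 < P {w | w.2.2 = true}) (hb : Measurable b)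
    (hmodel : DensityRatioModel P b lam) :
    (P.restrict (observed 𝒳 𝒴)ᶜ).map (fun w => b w.1)
      = ((P.restrict (observed 𝒳 𝒴)).withDensity fun w =>
          ENNReal.ofReal (odds P * expRatio b lam w.1)).map (fun w => b w.1) := by
  have hbx : Measurable fun w : Obs 𝒳 𝒴 => b w.1 := hb.comp measurable_fst
  have hem : Measurable fun x => ENNReal.ofReal (expRatio b lam x) :=
    (measurable_expRatio hb lam).ennreal_ofReal
  have h1' : P (observed 𝒳 𝒴) ≠ 0 := h1.ne'
  ext B hB
  rw [Measure.map_apply hbx hB, Measure.map_apply hbx hB, withDensity_apply _ (hbx hB)]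
  have h := lawGiven_false_preimage hb hmodel hB
  rw [lawGiven_false, lawGiven_true, Measure.restrict_smul, lintegral_smul_measure,
    Measure.smul_apply, Measure.map_apply measurable_fst (hb hB),
    setLIntegral_map (hb hB) hem measurable_fst] at h
  have hodds : ENNReal.ofReal (odds P) = P (observed 𝒳 𝒴)ᶜ * (P (observed 𝒳 𝒴))⁻¹ := by
    have hpos : 0 < P.real (observed 𝒳 𝒴) := ENNReal.toReal_pos h1' (measure_ne_top _ _)
    rw [odds_eq, ENNReal.ofReal_div_of_pos hpos,
      ofReal_measureReal, ofReal_measureReal, div_eq_mul_inv]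
  have hc0 : 0 ≤ odds P := div_nonneg measureReal_nonneg measureReal_nonneg
  simp only [ENNReal.ofReal_mul hc0]
  have hem' : Measurable fun w : Obs 𝒳 𝒴 => ENNReal.ofReal (expRatio b lam w.1) :=
    hem.comp measurable_fst
  rw [lintegral_const_mul _ hem', hodds, mul_assoc]
  change (P.restrict (observed 𝒳 𝒴)ᶜ) (Prod.fst ⁻¹' (b ⁻¹' B)) = _ * (_ * ∫⁻ x in
    Prod.fst ⁻¹' (b ⁻¹' B), ENNReal.ofReal (expRatio b lam x.1) ∂P.restrict (observed 𝒳 𝒴))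
  rw [smul_eq_mul, smul_eq_mul] at h
  rw [← h, ← mul_assoc]
  rcases eq_or_ne (P (observed 𝒳 𝒴)ᶜ) 0 with h0 | h0
  · rw [Measure.restrict_eq_zero.2 h0]
    simp [h0]
  · rw [ENNReal.mul_inv_cancel h0 (measure_ne_top _ _), one_mul]

variable {E : Type*} [NormedAddCommGroup E] [NormedSpace ℝ E]

/-- Calibration in the population: `𝔼[(1 - δ) g(b(X))] = 𝔼[δ c exp (zᵀ lam) g(b(X))]`, with
equivalence of the integrability of the two sides. -/
theorem integral_one_sub_delta (h1 : 0 < P {w | w.2.2 = true}) (hb : Measurable b)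
    (hmodel : DensityRatioModel P b lam) {G : Vec L → E} (hG : StronglyMeasurable G) :
    (Integrable (fun w => (1 - delta w) • G (b w.1)) P ↔
      Integrable (fun w => delta w • ((odds P * expRatio b lam w.1) • G (b w.1))) P) ∧
    ∫ w, (1 - delta w) • G (b w.1) ∂P
      = ∫ w, delta w • ((odds P * expRatio b lam w.1) • G (b w.1)) ∂P := by
  have hbx : Measurable fun w : Obs 𝒳 𝒴 => b w.1 := hb.comp measurable_fst
  have hc0 : 0 ≤ odds P := div_nonneg measureReal_nonneg measureReal_nonneg
  have hem : Measurable fun w : Obs 𝒳 𝒴 => ENNReal.ofReal (odds P * expRatio b lam w.1) :=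
    (((measurable_expRatio hb lam).comp measurable_fst).const_mul _).ennreal_ofReal
  have hto : ∀ w : Obs 𝒳 𝒴, (ENNReal.ofReal (odds P * expRatio b lam w.1)).toReal
      = odds P * expRatio b lam w.1 := fun w =>
    ENNReal.toReal_ofReal (mul_nonneg hc0 (expRatio_pos b lam w.1).le)
  have hmap := map_restrict_compl_observed h1 hb hmodel
  rw [integrable_one_sub_delta_smul_iff, integrable_delta_smul_iff, integral_one_sub_delta_smul,
    integral_delta_smul]
  constructor
  · have ha := integrable_map_measure (μ := P.restrict (observed 𝒳 𝒴)ᶜ) (g := G)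
      hG.aestronglyMeasurable hbx.aemeasurable
    have hd := integrable_map_measure (μ := (P.restrict (observed 𝒳 𝒴)).withDensity fun w =>
      ENNReal.ofReal (odds P * expRatio b lam w.1)) (g := G) hG.aestronglyMeasurable
      hbx.aemeasurable
    rw [← hmap, ha, integrable_withDensity_iff_integrable_smul' hem
      (Eventually.of_forall fun _ => ENNReal.ofReal_lt_top)] at hd
    simp only [hto] at hd
    exact hd
  · rw [← integral_map (μ := P.restrict (observed 𝒳 𝒴)ᶜ) (f := G) hbx.aemeasurable
      hG.aestronglyMeasurable, hmap, integral_map hbx.aemeasurable hG.aestronglyMeasurable,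
      integral_withDensity_eq_integral_toReal_smul hem
      (Eventually.of_forall fun _ => ENNReal.ofReal_lt_top)]
    simp only [hto]

/-- What holds for the covariate of almost every respondent holds almost surely. -/
lemma ae_of_ae_observed (h0 : 0 < P {w | w.2.2 = false})
    (hmodel : DensityRatioModel P b lam) {p : 𝒳 → Prop} (hp : MeasurableSet {x | p x})
    (h : ∀ᵐ w ∂P, delta w = 1 → p w.1) : ∀ᵐ w ∂P, p w.1 := by
  have hD := measurableSet_observed (𝒳 := 𝒳) (𝒴 := 𝒴)
  have hiff : ∀ w : Obs 𝒳 𝒴, w ∈ observed 𝒳 𝒴 → delta w = 1 := fun w hw => by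
    have hw' : w.2.2 = true := hw
    simp [delta, hw']
  have ho : ∀ᵐ w ∂P.restrict (observed 𝒳 𝒴), p w.1 :=
    (ae_restrict_iff' hD).2 (h.mono fun w hw hwD => hw (hiff w hwD))
  have hl1 : ∀ᵐ x ∂lawGiven P true, p x := by
    rw [lawGiven_true]
    refine Measure.ae_smul_measure ?_ _
    exact (ae_map_iff measurable_fst.aemeasurable hp).2 ho
  have hl0 : ∀ᵐ x ∂lawGiven P false, p x := hmodel.1.ae_le hl1
  have h0' : P (observed 𝒳 𝒴)ᶜ ≠ 0 := by rw [compl_observed]; exact h0.ne'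
  rw [lawGiven_false,
    Measure.ae_ennreal_smul_measure_iff (ENNReal.inv_ne_zero.2 (measure_ne_top _ _)),
    ae_map_iff measurable_fst.aemeasurable hp] at hl0
  have hu : ∀ᵐ w ∂(P.restrict (observed 𝒳 𝒴) + P.restrict (observed 𝒳 𝒴)ᶜ), p w.1 :=
    ae_add_measure_iff.2 ⟨ho, hl0⟩
  rwa [Measure.restrict_add_restrict_compl hD] at hu

end DensityRatio

/-! ### Exponential envelopes and unbiasedness of the weighted equation -/

section Tilt

variable {𝒳 𝒴 : Type*} {L p : ℕ}

/-- The envelope `exp (zᵀ lam + ε ‖z‖)` of the density ratios `exp (zᵀ l)` with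
`‖l - lam‖ ≤ ε`. -/
def tilt (b : 𝒳 → Vec L) (lam : Vec (L + 1)) (ε : ℝ) (x : 𝒳) : ℝ :=
  Real.exp (inner ℝ (zvec b x) lam + ε * ‖zvec b x‖)

lemma tilt_eq (b : 𝒳 → Vec L) (lam : Vec (L + 1)) (ε : ℝ) (x : 𝒳) :
    tilt b lam ε x = expRatio b lam x * Real.exp (ε * ‖zvec b x‖) := Real.exp_add _ _

lemma tilt_pos (b : 𝒳 → Vec L) (lam : Vec (L + 1)) (ε : ℝ) (x : 𝒳) : 0 < tilt b lam ε x :=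
  Real.exp_pos _

lemma norm_sq_mul_expRatio_le (b : 𝒳 → Vec L) (lam : Vec (L + 1)) {ε : ℝ} (hε : 0 < ε) (x : 𝒳) :
    ‖zvec b x‖ ^ 2 * expRatio b lam x ≤ 2 / ε ^ 2 * tilt b lam ε x := by
  rw [tilt_eq, mul_comm (expRatio _ _ _), ← mul_assoc]
  refine mul_le_mul_of_nonneg_right ?_ (expRatio_pos b lam x).le
  have h := Real.quadratic_le_exp_of_nonneg (mul_nonneg hε.le (norm_nonneg (zvec b x)))
  have h' : 0 ≤ ε * ‖zvec b x‖ := by positivity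
  rw [div_mul_eq_mul_div, le_div_iff₀ (by positivity)]
  nlinarith

end Tilt

section Envelope

variable {𝒳 𝒴 : Type*} [MeasurableSpace 𝒳] [MeasurableSpace 𝒴] {L p : ℕ}

/-- The smoothness and domination conditions near `θ₀`, for a given radius `ρ`, exponent `ε` and
envelope `G`. -/
structure LocalEnvelope (P : Measure (Obs 𝒳 𝒴)) (U : Vec p → 𝒳 → 𝒴 → Vec p) (b : 𝒳 → Vec L)
    (Θ : Set (Vec p)) (θ₀ : Vec p) (lam : Vec (L + 1)) (ρ ε : ℝ) (G : 𝒳 → 𝒴 → ℝ) : Prop where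
  rho_pos : 0 < ρ
  eps_pos : 0 < ε
  ball_subset : Metric.ball θ₀ ρ ⊆ Θ
  contDiffOn : ∀ᵐ w ∂P, ContDiffOn ℝ 1 (fun θ => U θ w.1 w.2.1) (Metric.ball θ₀ ρ)
  bound : ∀ᵐ w ∂P, ∀ θ ∈ Θ, ‖U θ w.1 w.2.1‖ ≤ G w.1 w.2.1
  bound_fderiv : ∀ᵐ w ∂P, ∀ θ ∈ Metric.ball θ₀ ρ,
    ‖fderiv ℝ (fun t => U t w.1 w.2.1) θ‖ ≤ G w.1 w.2.1
  integrable_G : Integrable (fun w => G w.1 w.2.1) P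
  integrable_tilt : Integrable (fun w => delta w * tilt b lam ε w.1 * (1 + G w.1 w.2.1)) P

variable {P : Measure (Obs 𝒳 𝒴)} {U : Vec p → 𝒳 → 𝒴 → Vec p} {b : 𝒳 → Vec L}
  {Θ : Set (Vec p)} {θ₀ : Vec p} {lam : Vec (L + 1)} {ρ ε : ℝ} {G : 𝒳 → 𝒴 → ℝ}

lemma RegularityConditions.exists_localEnvelope (hreg : RegularityConditions P U b Θ θ₀ lam) :
    ∃ ρ ε G, LocalEnvelope P U b Θ θ₀ lam ρ ε G := by
  obtain ⟨ρ, hρ, ε, hε, G, h1, h2, h3, h4, h5, h6⟩ := hreg.envelope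
  exact ⟨ρ, ε, G, hρ, hε, h1, h2, h3, h4, h5, h6⟩

lemma RegularityConditions.mem (hreg : RegularityConditions P U b Θ θ₀ lam) : θ₀ ∈ Θ :=
  interior_subset hreg.interior

lemma RegularityConditions.measurable_U_obs (hreg : RegularityConditions P U b Θ θ₀ lam)
    {θ : Vec p} (hθ : θ ∈ Θ) : Measurable fun w : Obs 𝒳 𝒴 => U θ w.1 w.2.1 := by
  have hxy : Measurable fun w : Obs 𝒳 𝒴 => (w.1, w.2.1) := by fun_prop
  exact (hreg.measurable_U θ hθ).comp hxy

namespace LocalEnvelope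

lemma G_nonneg (henv : LocalEnvelope P U b Θ θ₀ lam ρ ε G) : ∀ᵐ w ∂P, 0 ≤ G w.1 w.2.1 := by
  filter_upwards [henv.bound] with w hw
  exact (norm_nonneg _).trans (hw θ₀ (henv.ball_subset (Metric.mem_ball_self henv.rho_pos)))

lemma integrable_of_le {E : Type*} [NormedAddCommGroup E]
    (henv : LocalEnvelope P U b Θ θ₀ lam ρ ε G) {f : Obs 𝒳 𝒴 → E}
    (hf : AEStronglyMeasurable f P) (C : ℝ)
    (h : ∀ᵐ w ∂P, ‖f w‖ ≤ C * (delta w * tilt b lam ε w.1 * (1 + G w.1 w.2.1))) :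
    Integrable f P :=
  (henv.integrable_tilt.const_mul C).mono' hf h

/-- Integrability of `δ exp (zᵀ lam) q(x) f` when `q` grows at most like `‖z‖²` and `f` is
dominated by a multiple of `1 + G`. -/
lemma integrable_weighted {E : Type*} [NormedAddCommGroup E] [NormedSpace ℝ E]
    (henv : LocalEnvelope P U b Θ θ₀ lam ρ ε G) (hb : Measurable b)
    {q : 𝒳 → ℝ} (hq : Measurable q) {A : ℝ} (hqb : ∀ x, |q x| ≤ A * ‖zvec b x‖ ^ 2)
    {f : Obs 𝒳 𝒴 → E} (hf : AEStronglyMeasurable f P) {K : ℝ}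
    (h : ∀ᵐ w ∂P, ‖f w‖ ≤ K * (1 + G w.1 w.2.1)) :
    Integrable (fun w => (delta w * expRatio b lam w.1 * q w.1) • f w) P := by
  have hm : Measurable fun w : Obs 𝒳 𝒴 => delta w * expRatio b lam w.1 * q w.1 :=
    (measurable_delta.mul ((measurable_expRatio hb lam).comp measurable_fst)).mul
      (hq.comp measurable_fst)
  refine henv.integrable_of_le (hm.aestronglyMeasurable.smul hf) (2 / ε ^ 2 * A * K) ?_
  filter_upwards [h, henv.G_nonneg] with w hw hG
  have he := expRatio_pos b lam w.1
  have hd := delta_nonneg w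
  have h1 := norm_sq_mul_expRatio_le b lam henv.eps_pos w.1
  have hA : 0 ≤ A := by
    have h2 := (abs_nonneg _).trans (hqb w.1)
    have h3 : 0 < ‖zvec b w.1‖ ^ 2 := by
      have := one_le_norm_zvec b w.1
      positivity
    exact nonneg_of_mul_nonneg_left h2 h3
  calc ‖(delta w * expRatio b lam w.1 * q w.1) • f w‖
      = delta w * expRatio b lam w.1 * |q w.1| * ‖f w‖ := by
        rw [norm_smul, Real.norm_eq_abs, abs_mul, abs_of_nonneg (by positivity)]
    _ ≤ delta w * expRatio b lam w.1 * (A * ‖zvec b w.1‖ ^ 2) * (K * (1 + G w.1 w.2.1)) := by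
        gcongr
        exact hqb w.1
    _ = delta w * A * (‖zvec b w.1‖ ^ 2 * expRatio b lam w.1) * (K * (1 + G w.1 w.2.1)) := by ring
    _ ≤ delta w * A * (2 / ε ^ 2 * tilt b lam ε w.1) * (K * (1 + G w.1 w.2.1)) := by
        have : 0 ≤ K * (1 + G w.1 w.2.1) := (norm_nonneg _).trans hw
        gcongr
    _ = _ := by ring

lemma bound_one (henv : LocalEnvelope P U b Θ θ₀ lam ρ ε G) :
    ∀ᵐ w ∂P, ‖(1 : ℝ)‖ ≤ 1 * (1 + G w.1 w.2.1) := by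
  filter_upwards [henv.G_nonneg] with w hw
  rw [norm_one]
  linarith

lemma bound_U (henv : LocalEnvelope P U b Θ θ₀ lam ρ ε G) {θ : Vec p} (hθ : θ ∈ Θ) :
    ∀ᵐ w ∂P, ‖U θ w.1 w.2.1‖ ≤ 1 * (1 + G w.1 w.2.1) := by
  filter_upwards [henv.bound] with w hw
  linarith [hw θ hθ]

end LocalEnvelope

lemma measurable_coord_zvec {b : 𝒳 → Vec L} (hb : Measurable b) (k : Fin (L + 1)) :
    Measurable fun x => zvec b x k := by
  have := measurable_zvec hb
  fun_prop

omit [MeasurableSpace 𝒳] in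
lemma abs_zvec_le (b : 𝒳 → Vec L) (x : 𝒳) (k : Fin (L + 1)) : |zvec b x k| ≤ ‖zvec b x‖ :=
  PiLp.norm_apply_le (zvec b x) k

omit [MeasurableSpace 𝒳] in
lemma norm_zvec_le_sq (b : 𝒳 → Vec L) (x : 𝒳) : ‖zvec b x‖ ≤ ‖zvec b x‖ ^ 2 := by
  nlinarith [one_le_norm_zvec b x]

omit [MeasurableSpace 𝒳] in
lemma one_le_norm_zvec_sq (b : 𝒳 → Vec L) (x : 𝒳) : 1 ≤ ‖zvec b x‖ ^ 2 :=
  (one_le_norm_zvec b x).trans (norm_zvec_le_sq b x)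

end Envelope

section Moments

variable {𝒳 𝒴 : Type*} [MeasurableSpace 𝒳] [StandardBorelSpace 𝒳]
  [MeasurableSpace 𝒴] [StandardBorelSpace 𝒴] {L p : ℕ}
  {P : Measure (Obs 𝒳 𝒴)} [IsProbabilityMeasure P] {U : Vec p → 𝒳 → 𝒴 → Vec p} {b : 𝒳 → Vec L}
  {Θ : Set (Vec p)} {θ₀ : Vec p} {lam : Vec (L + 1)} {ρ ε : ℝ} {G : 𝒳 → 𝒴 → ℝ}

/-- The residual `U - zᵀ β` is orthogonal to functions of `X` among the respondents. -/
theorem integral_delta_smul_residual (hMAR : MissingAtRandom P)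
    (hreg : RegularityConditions P U b Θ θ₀ lam) {θ : Vec p} (hθ : θ ∈ Θ)
    {β : Fin (L + 1) → Vec p} (hβ : Ubar P U θ =ᵐ[P] fun w => linComb b β w.1)
    {g : 𝒳 → ℝ} (hg : Measurable g)
    (hgU : Integrable (fun w => (delta w * g w.1) • U θ w.1 w.2.1) P) :
    Integrable (fun w => (delta w * g w.1) • linComb b β w.1) P ∧
      ∫ w, (delta w * g w.1) • linComb b β w.1 ∂P
        = ∫ w, (delta w * g w.1) • U θ w.1 w.2.1 ∂P ∧
      ∫ w, (delta w * g w.1) • (U θ w.1 w.2.1 - linComb b β w.1) ∂P = 0 := by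
  simp only [mul_smul] at hgU ⊢
  have h := integral_delta_smul_condExp hMAR hg (k := fun v : 𝒳 × 𝒴 => U θ v.1 v.2)
    (hreg.measurable_U θ hθ).stronglyMeasurable
    ((hreg.moment_U θ hθ).integrable (by norm_num)) hgU
  have heq : (fun w => delta w • (g w.1 •
      condExp (sigmaX 𝒳 𝒴) P (fun w => U θ w.1 w.2.1) w))
      =ᵐ[P] fun w => delta w • (g w.1 • linComb b β w.1) := by
    filter_upwards [hβ] with w hw
    rw [← hw]
    rfl
  have hi := h.1.congr heq
  have he := (integral_congr_ae heq).symm.trans h.2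
  refine ⟨hi, he, ?_⟩
  simp only [smul_sub]
  rw [integral_sub hgU hi, he, sub_self]

omit [StandardBorelSpace 𝒳] [StandardBorelSpace 𝒴] [IsProbabilityMeasure P] in
lemma LocalEnvelope.integrable_expRatio_U (henv : LocalEnvelope P U b Θ θ₀ lam ρ ε G)
    (hreg : RegularityConditions P U b Θ θ₀ lam) {θ : Vec p} (hθ : θ ∈ Θ) :
    Integrable (fun w => (delta w * expRatio b lam w.1) • U θ w.1 w.2.1) P := by
  have h := henv.integrable_weighted hreg.measurable_b (q := fun _ => 1) measurable_const
    (A := 1) (fun x => by simpa using one_le_norm_zvec_sq b x)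
    (hreg.measurable_U_obs hθ).aestronglyMeasurable (henv.bound_U hθ)
  simpa using h

omit [StandardBorelSpace 𝒳] [StandardBorelSpace 𝒴] in
lemma RegularityConditions.integrable_delta_U (hreg : RegularityConditions P U b Θ θ₀ lam)
    {θ : Vec p} (hθ : θ ∈ Θ) :
    Integrable (fun w => delta w • U θ w.1 w.2.1) P := by
  have h : Integrable (fun w => U θ w.1 w.2.1) P := (hreg.moment_U θ hθ).integrable (by norm_num)
  exact integrable_delta_smul_iff.2 h.integrableOn

/-- The propensity score estimating equation is unbiased at every `θ ∈ Θ`. -/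
theorem integral_weighted_U (hMAR : MissingAtRandom P) (hmodel : DensityRatioModel P b lam)
    (hreg : RegularityConditions P U b Θ θ₀ lam) (henv : LocalEnvelope P U b Θ θ₀ lam ρ ε G)
    {θ : Vec p} (hθ : θ ∈ Θ) (hspan : UbarInSpan P U b θ) :
    Integrable (fun w => (delta w * omegaStar (odds P) b lam w.1) • U θ w.1 w.2.1) P ∧
      ∫ w, (delta w * omegaStar (odds P) b lam w.1) • U θ w.1 w.2.1 ∂P
        = ∫ w, U θ w.1 w.2.1 ∂P := by
  obtain ⟨β, hβ⟩ := hspan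
  have hb := hreg.measurable_b
  have hdU := hreg.integrable_delta_U hθ
  have heU := henv.integrable_expRatio_U hreg hθ
  have hsplit : ∀ (w : Obs 𝒳 𝒴) (v : Vec p), (delta w * omegaStar (odds P) b lam w.1) • v
      = delta w • v + odds P • ((delta w * expRatio b lam w.1) • v) := by
    intro w v
    rw [omegaStar, smul_smul, ← add_smul]
    congr 1
    ring
  have hr1 := integral_delta_smul_residual hMAR hreg hθ hβ (g := fun _ => 1) measurable_const
    (by simpa using hdU)
  have hr2 := integral_delta_smul_residual hMAR hreg hθ hβ (measurable_expRatio hb lam) heU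
  simp only [mul_one] at hr1
  have hdr := integral_one_sub_delta (P := P) hreg.observed_pos hb hmodel
    (G := fun v : Vec L => linComb (fun v : Vec L => v) β v)
    (measurable_linComb measurable_id β).stronglyMeasurable
  have hlin : ∀ x, linComb (fun v : Vec L => v) β (b x) = linComb b β x := fun x => rfl
  simp only [hlin] at hdr
  have hre : ∀ w : Obs 𝒳 𝒴, delta w • ((odds P * expRatio b lam w.1) • linComb b β w.1)
      = odds P • ((delta w * expRatio b lam w.1) • linComb b β w.1) := by
    intro w
    simp only [smul_smul]
    congr 1
    ring
  simp only [hre] at hdr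
  have hi0 := hdr.1.2 (hr2.1.smul (odds P))
  have heU' : Integrable (fun w => odds P • ((delta w * expRatio b lam w.1) • U θ w.1 w.2.1)) P :=
    heU.smul (odds P)
  constructor
  · simp only [hsplit]
    exact hdU.add heU'
  · simp only [hsplit]
    rw [integral_add hdU heU', integral_smul, ← hr2.2.1, ← integral_smul, ← hdr.2,
      ← hr1.2.1, ← integral_add hr1.1 hi0]
    have : ∀ w : Obs 𝒳 𝒴, delta w • linComb b β w.1 + (1 - delta w) • linComb b β w.1
        = linComb b β w.1 := by
      intro w
      rw [← add_smul]
      simp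
    simp only [this]
    rw [← integral_congr_ae hβ, Ubar, integral_condExp sigmaX_le]

end Moments

/-! ### The calibration score and the influence function -/

section Influence

variable {𝒳 𝒴 : Type*} [MeasurableSpace 𝒳] [MeasurableSpace 𝒴] {L p : ℕ}
  {P : Measure (Obs 𝒳 𝒴)} [IsProbabilityMeasure P] {U : Vec p → 𝒳 → 𝒴 → Vec p} {b : 𝒳 → Vec L}
  {Θ : Set (Vec p)} {θ₀ : Vec p} {lam : Vec (L + 1)} {ρ ε : ℝ} {G : 𝒳 → 𝒴 → ℝ}

lemma memLp_of_sq_le {Ω E : Type*} [MeasurableSpace Ω] [NormedAddCommGroup E] {ν : Measure Ω}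
    {f : Ω → E} (hf : AEStronglyMeasurable f ν) {H : Ω → ℝ} (hH : Integrable H ν)
    (h : ∀ᵐ w ∂ν, ‖f w‖ ^ 2 ≤ H w) : MemLp f 2 ν := by
  rw [memLp_two_iff_integrable_sq_norm hf]
  refine hH.mono' (hf.norm.pow 2) (h.mono fun w hw => ?_)
  rwa [Real.norm_of_nonneg (sq_nonneg _)]

omit [IsProbabilityMeasure P] in
lemma memLp_expRatio_zvec (hreg : RegularityConditions P U b Θ θ₀ lam) :
    MemLp (fun w => (delta w * expRatio b lam w.1) • zvec b w.1) 2 P := by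
  have hb := hreg.measurable_b
  have hm : Measurable fun w : Obs 𝒳 𝒴 => (delta w * expRatio b lam w.1) • zvec b w.1 :=
    (measurable_delta.mul ((measurable_expRatio hb lam).comp measurable_fst)).smul
      ((measurable_zvec hb).comp measurable_fst)
  refine memLp_of_sq_le hm.aestronglyMeasurable hreg.weighted_moment (Eventually.of_forall ?_)
  intro w
  rw [norm_smul, mul_pow, Real.norm_eq_abs, sq_abs, mul_pow, sq (delta w), delta_mul_self,
    mul_assoc]
  have := delta_nonneg w
  rw [mul_assoc]
  gcongr
  linarith [sq_nonneg ‖U θ₀ w.1 w.2.1‖]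

omit [IsProbabilityMeasure P] in
lemma memLp_expRatio_U (hreg : RegularityConditions P U b Θ θ₀ lam) :
    MemLp (fun w => (delta w * expRatio b lam w.1) • U θ₀ w.1 w.2.1) 2 P := by
  have hb := hreg.measurable_b
  have hm : Measurable fun w : Obs 𝒳 𝒴 => (delta w * expRatio b lam w.1) • U θ₀ w.1 w.2.1 :=
    (measurable_delta.mul ((measurable_expRatio hb lam).comp measurable_fst)).smul
      (hreg.measurable_U_obs hreg.mem)
  refine memLp_of_sq_le hm.aestronglyMeasurable hreg.weighted_moment (Eventually.of_forall ?_)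
  intro w
  rw [norm_smul, mul_pow, Real.norm_eq_abs, sq_abs, mul_pow, sq (delta w), delta_mul_self,
    mul_assoc]
  have := delta_nonneg w
  rw [mul_assoc]
  gcongr
  linarith [sq_nonneg ‖zvec b w.1‖]

omit [IsProbabilityMeasure P] in
lemma LocalEnvelope.integrable_expRatio_norm_sq (henv : LocalEnvelope P U b Θ θ₀ lam ρ ε G)
    (hb : Measurable b) :
    Integrable (fun w => delta w * expRatio b lam w.1 * ‖zvec b w.1‖ ^ 2) P := by
  have h := henv.integrable_weighted hb (q := fun x => ‖zvec b x‖ ^ 2)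
    ((measurable_zvec hb).norm.pow_const 2) (A := 1) (fun x => by
      rw [abs_of_nonneg (sq_nonneg _), one_mul]) (f := fun _ => (1 : ℝ))
    aestronglyMeasurable_const henv.bound_one
  simpa using h

/-- The nonrespondents have second moments of `z`, although only first moments are assumed: by
the density ratio model they are moments of the respondents with the weight `exp (zᵀ lam)`. -/
lemma memLp_one_sub_delta_zvec (hmodel : DensityRatioModel P b lam)
    (hreg : RegularityConditions P U b Θ θ₀ lam) (henv : LocalEnvelope P U b Θ θ₀ lam ρ ε G) :
    MemLp (fun w => (1 - delta w) • zvec b w.1) 2 P := by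
  have hb := hreg.measurable_b
  have hm : Measurable fun w : Obs 𝒳 𝒴 => (1 - delta w) • zvec b w.1 :=
    (measurable_const.sub measurable_delta).smul ((measurable_zvec hb).comp measurable_fst)
  have h := integral_one_sub_delta (P := P) hreg.observed_pos hb hmodel
    (G := fun v : Vec L => ‖zvec (fun v : Vec L => v) v‖ ^ 2)
    ((measurable_zvec measurable_id).norm.pow_const 2).stronglyMeasurable
  have hz : ∀ x, zvec (fun v : Vec L => v) (b x) = zvec b x := fun x => rfl
  simp only [hz, smul_eq_mul] at h
  have hi := h.1.2 (((henv.integrable_expRatio_norm_sq hb).const_mul (odds P)).congr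
    (Eventually.of_forall fun w => by ring))
  refine memLp_of_sq_le hm.aestronglyMeasurable hi (Eventually.of_forall fun w => ?_)
  rw [norm_smul, mul_pow, Real.norm_eq_abs, sq_abs]
  have h1 : (1 - delta w) ^ 2 = 1 - delta w := by
    have := delta_mul_self w
    linear_combination this
  rw [h1]

/-- The score of the calibration equation at the true density ratio. -/
def calibScore (c : ℝ) (b : 𝒳 → Vec L) (lam : Vec (L + 1)) (w : Obs 𝒳 𝒴) : Vec (L + 1) :=
  (delta w * (c * expRatio b lam w.1) - (1 - delta w)) • zvec b w.1

omit [MeasurableSpace 𝒳] [MeasurableSpace 𝒴] in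
lemma calibScore_eq (c : ℝ) (b : 𝒳 → Vec L) (lam : Vec (L + 1)) (w : Obs 𝒳 𝒴) :
    calibScore c b lam w = c • ((delta w * expRatio b lam w.1) • zvec b w.1)
      - (1 - delta w) • zvec b w.1 := by
  rw [calibScore, sub_smul, smul_smul]
  congr 2
  ring

lemma memLp_calibScore (hmodel : DensityRatioModel P b lam)
    (hreg : RegularityConditions P U b Θ θ₀ lam) (henv : LocalEnvelope P U b Θ θ₀ lam ρ ε G) :
    MemLp (calibScore (𝒴 := 𝒴) (odds P) b lam) 2 P := by
  have h := ((memLp_expRatio_zvec hreg).const_smul (odds P)).sub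
    (memLp_one_sub_delta_zvec hmodel hreg henv)
  refine (memLp_congr_ae (Eventually.of_forall fun w => ?_)).1 h
  rw [calibScore_eq]
  rfl

lemma integral_calibScore (hmodel : DensityRatioModel P b lam)
    (hreg : RegularityConditions P U b Θ θ₀ lam) (henv : LocalEnvelope P U b Θ θ₀ lam ρ ε G) :
    ∫ w, calibScore (𝒴 := 𝒴) (odds P) b lam w ∂P = 0 := by
  have hb := hreg.measurable_b
  have h := integral_one_sub_delta (P := P) hreg.observed_pos hb hmodel
    (G := fun v : Vec L => zvec (fun v : Vec L => v) v)
    (measurable_zvec measurable_id).stronglyMeasurable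
  have hz : ∀ x, zvec (fun v : Vec L => v) (b x) = zvec b x := fun x => rfl
  simp only [hz] at h
  have h1 : Integrable (fun w => (odds P) • ((delta w * expRatio b lam w.1) • zvec b w.1)) P :=
    ((memLp_expRatio_zvec hreg).integrable (by norm_num)).smul (odds P)
  have h2 := (memLp_one_sub_delta_zvec hmodel hreg henv).integrable (by norm_num)
  simp only [calibScore_eq]
  rw [integral_sub h1 h2, h.2, sub_eq_zero]
  refine integral_congr_ae (Eventually.of_forall fun w => ?_)
  simp only [smul_smul]
  congr 1
  ring

lemma integral_one_sub_delta_sub (h1 : 0 < P {w | w.2.2 = true}) :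
    ∫ w, ((1 - delta w) - odds P * delta w : ℝ) ∂P = 0 := by
  have hi := integrable_delta (P := P)
  have hpos : 0 < P.real (observed 𝒳 𝒴) := ENNReal.toReal_pos h1.ne' (measure_ne_top _ _)
  have hd := integral_delta (P := P)
  have hi' : Integrable (fun w : Obs 𝒳 𝒴 => 1 - delta w) P := (integrable_const _).sub hi
  rw [integral_sub hi' (hi.const_mul _),
    integral_sub (integrable_const _) hi, integral_const_mul, hd, odds_eq,
    measureReal_compl measurableSet_observed]
  field_simp
  simp

/-- The influence function `zᵀβ + δ ω⋆ (U - zᵀβ)` of the estimating equation, before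
normalization with `τ⁻¹`. -/
def influence (c : ℝ) (U : Vec p → 𝒳 → 𝒴 → Vec p) (b : 𝒳 → Vec L) (lam : Vec (L + 1))
    (θ : Vec p) (β : Fin (L + 1) → Vec p) (w : Obs 𝒳 𝒴) : Vec p :=
  linComb b β w.1 + (delta w * omegaStar c b lam w.1) • (U θ w.1 w.2.1 - linComb b β w.1)

omit [IsProbabilityMeasure P] in
/-- Square integrability of the two parts of the influence function. The weighted part of `zᵀβ`
is controlled by the moments of `exp (zᵀ lam) z`. -/
lemma memLp_weighted_residual (hreg : RegularityConditions P U b Θ θ₀ lam)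
    {β : Fin (L + 1) → Vec p} (hβ : Ubar P U θ₀ =ᵐ[P] fun w => linComb b β w.1) (c : ℝ) :
    MemLp (fun w => linComb b β w.1) 2 P ∧
      MemLp (fun w => (delta w * omegaStar c b lam w.1) • U θ₀ w.1 w.2.1) 2 P ∧
      MemLp (fun w => (delta w * omegaStar c b lam w.1) • (U θ₀ w.1 w.2.1 - linComb b β w.1))
        2 P := by
  have hb := hreg.measurable_b
  have hU := hreg.moment_U θ₀ hreg.mem
  have hL : MemLp (fun w : Obs 𝒳 𝒴 => linComb b β w.1) 2 P := by
    refine (memLp_congr_ae hβ).1 ?_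
    exact hU.condExp one_le_two
  have hδ : ∀ {f : Obs 𝒳 𝒴 → Vec p}, MemLp f 2 P → MemLp (fun w => delta w • f w) 2 P := by
    intro f hf
    rw [delta_smul_eq_indicator]
    exact hf.indicator measurableSet_observed
  have heL : MemLp (fun w => (delta w * expRatio b lam w.1) • linComb b β w.1) 2 P := by
    have h : ∀ k : Fin (L + 1),
        MemLp (fun w : Obs 𝒳 𝒴 => (delta w * expRatio b lam w.1 * zvec b w.1 k) • β k) 2 P := by
      intro k
      have h1 := (EuclideanSpace.proj (𝕜 := ℝ) k).comp_memLp' (memLp_expRatio_zvec hreg)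
      exact (ContinuousLinearMap.toSpanSingleton ℝ (β k)).comp_memLp' h1
    have h2 := memLp_finsetSum Finset.univ fun k _ => h k
    refine (memLp_congr_ae (Eventually.of_forall fun w => ?_)).1 h2
    simp only [linComb, Finset.smul_sum, smul_smul]
  have hsplit : ∀ (w : Obs 𝒳 𝒴) (v : Vec p), (delta w * omegaStar c b lam w.1) • v
      = delta w • v + c • ((delta w * expRatio b lam w.1) • v) := by
    intro w v
    rw [omegaStar, smul_smul, ← add_smul]
    congr 1
    ring
  have hwU : MemLp (fun w => (delta w * omegaStar c b lam w.1) • U θ₀ w.1 w.2.1) 2 P := by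
    simp only [hsplit]
    exact (hδ hU).add ((memLp_expRatio_U hreg).const_smul c)
  have hwL : MemLp (fun w : Obs 𝒳 𝒴 => (delta w * omegaStar c b lam w.1) • linComb b β w.1)
      2 P := by
    simp only [hsplit]
    exact (hδ hL).add (heL.const_smul c)
  refine ⟨hL, hwU, ?_⟩
  simp only [smul_sub]
  exact hwU.sub hwL

omit [IsProbabilityMeasure P] in
lemma memLp_influence (hreg : RegularityConditions P U b Θ θ₀ lam)
    {β : Fin (L + 1) → Vec p} (hβ : Ubar P U θ₀ =ᵐ[P] fun w => linComb b β w.1) (c : ℝ) :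
    MemLp (influence c U b lam θ₀ β) 2 P :=
  (memLp_weighted_residual hreg hβ c).1.add (memLp_weighted_residual hreg hβ c).2.2

end Influence

section Covariance

variable {𝒳 𝒴 : Type*} [MeasurableSpace 𝒳] [StandardBorelSpace 𝒳]
  [MeasurableSpace 𝒴] [StandardBorelSpace 𝒴] {L p : ℕ}
  {P : Measure (Obs 𝒳 𝒴)} [IsProbabilityMeasure P] {U : Vec p → 𝒳 → 𝒴 → Vec p} {b : 𝒳 → Vec L}
  {Θ : Set (Vec p)} {θ₀ : Vec p} {lam : Vec (L + 1)}
  {β : Fin (L + 1) → Vec p}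

omit [StandardBorelSpace 𝒳] [StandardBorelSpace 𝒴] in
lemma integral_linComb_eq_zero (hreg : RegularityConditions P U b Θ θ₀ lam)
    (hβ : Ubar P U θ₀ =ᵐ[P] fun w => linComb b β w.1) :
    ∫ w, linComb b β w.1 ∂P = 0 := by
  rw [← integral_congr_ae hβ, Ubar, integral_condExp sigmaX_le]
  exact (hreg.unique_zero θ₀ hreg.mem).2 rfl

lemma integral_influence (hMAR : MissingAtRandom P)
    (hreg : RegularityConditions P U b Θ θ₀ lam)
    (hβ : Ubar P U θ₀ =ᵐ[P] fun w => linComb b β w.1) (c : ℝ) :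
    ∫ w, influence c U b lam θ₀ β w ∂P = 0 := by
  obtain ⟨h1, h2, h3⟩ := memLp_weighted_residual hreg hβ c
  have hr := integral_delta_smul_residual hMAR hreg hreg.mem hβ
    (measurable_omegaStar hreg.measurable_b c lam) (h2.integrable (by norm_num))
  simp only [influence]
  rw [integral_add (h1.integrable (by norm_num)) (h3.integrable (by norm_num)), hr.2.2,
    integral_linComb_eq_zero hreg hβ, add_zero]

/-- A coordinate of `zᵀβ` is orthogonal to a coordinate of the weighted residual. -/
lemma integral_linComb_mul_residual (hMAR : MissingAtRandom P)
    (hreg : RegularityConditions P U b Θ θ₀ lam)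
    (hβ : Ubar P U θ₀ =ᵐ[P] fun w => linComb b β w.1) (c : ℝ) (j k : Fin p) :
    ∫ w, linComb b β w.1 j *
      (delta w * omegaStar c b lam w.1 * (U θ₀ w.1 w.2.1 - linComb b β w.1) k) ∂P = 0 := by
  obtain ⟨h1, h2, h3⟩ := memLp_weighted_residual hreg hβ c
  have hb := hreg.measurable_b
  have hLj : Measurable fun x => linComb b β x j := by
    have := measurable_linComb hb β
    fun_prop
  have hLj2 : MemLp (fun w : Obs 𝒳 𝒴 => linComb b β w.1 j) 2 P :=
    memLp_coord (ψ := fun w : Obs 𝒳 𝒴 => linComb b β w.1) h1 j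
  have hg : Measurable fun x => omegaStar c b lam x * linComb b β x j :=
    (measurable_omegaStar hb c lam).mul hLj
  have hi : Integrable (fun w => (delta w * (omegaStar c b lam w.1 * linComb b β w.1 j)) •
      U θ₀ w.1 w.2.1) P := by
    have h := h2.smul (p := 2) (q := 2) (r := 1) hLj2
    refine (memLp_one_iff_integrable.1 h).congr (Eventually.of_forall fun w => ?_)
    simp only [Pi.smul_apply', smul_smul]
    congr 1
    ring
  have hr := integral_delta_smul_residual hMAR hreg hreg.mem hβ hg hi
  have hir : Integrable (fun w => (delta w * (omegaStar c b lam w.1 * linComb b β w.1 j)) •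
      (U θ₀ w.1 w.2.1 - linComb b β w.1)) P := by
    simp only [smul_sub]
    exact hi.sub hr.1
  have h := (EuclideanSpace.proj (𝕜 := ℝ) k).integral_comp_comm hir
  rw [hr.2.2, map_zero] at h
  rw [← h]
  refine integral_congr_ae (Eventually.of_forall fun w => ?_)
  simp
  ring

/-- The covariance matrix of the influence function is `V₁`. -/
theorem integral_influence_mul (hMAR : MissingAtRandom P)
    (hreg : RegularityConditions P U b Θ θ₀ lam)
    (hβ : Ubar P U θ₀ =ᵐ[P] fun w => linComb b β w.1) (j k : Fin p) :
    ∫ w, influence (odds P) U b lam θ₀ β w j * influence (odds P) U b lam θ₀ β w k ∂P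
      = V1 P U b θ₀ lam j k := by
  set c := odds P with hc
  obtain ⟨h1, h2, h3⟩ := memLp_weighted_residual hreg hβ c
  have hb := hreg.measurable_b
  have hU := hreg.moment_U θ₀ hreg.mem
  have hL2 : ∀ i, MemLp (fun w : Obs 𝒳 𝒴 => linComb b β w.1 i) 2 P := fun i =>
    memLp_coord (ψ := fun w : Obs 𝒳 𝒴 => linComb b β w.1) h1 i
  have hR2 : ∀ i, MemLp (fun w => delta w * omegaStar c b lam w.1 *
      (U θ₀ w.1 w.2.1 - linComb b β w.1) i) 2 P := fun i => memLp_coord h3 i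
  have hres : MemLp (fun w => U θ₀ w.1 w.2.1 - linComb b β w.1) 2 P := hU.sub h1
  have hres2 : ∀ i, MemLp (fun w => (U θ₀ w.1 w.2.1 - linComb b β w.1) i) 2 P := fun i =>
    memLp_coord hres i
  -- the conditional covariance term
  have hcov : ∫ w, delta w * omegaStar c b lam w.1 ^ 2 * condCov P U θ₀ j k w ∂P
      = ∫ w, (delta w * omegaStar c b lam w.1 * (U θ₀ w.1 w.2.1 - linComb b β w.1) j) *
        (delta w * omegaStar c b lam w.1 * (U θ₀ w.1 w.2.1 - linComb b β w.1) k) ∂P := by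
    let κ : 𝒳 × 𝒴 → ℝ := fun v =>
      (U θ₀ v.1 v.2 - linComb b β v.1) j * (U θ₀ v.1 v.2 - linComb b β v.1) k
    have hκ : StronglyMeasurable κ := by
      have hm1 := hreg.measurable_U θ₀ hreg.mem
      have hm2 : Measurable fun v : 𝒳 × 𝒴 => linComb b β v.1 :=
        (measurable_linComb hb β).comp measurable_fst
      have hm3 := hm1.sub hm2
      have hm4 : ∀ i, Measurable fun v : 𝒳 × 𝒴 => (U θ₀ v.1 v.2 - linComb b β v.1) i := by
        intro i
        exact (EuclideanSpace.proj (𝕜 := ℝ) i).measurable.comp hm3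
      exact ((hm4 j).mul (hm4 k)).stronglyMeasurable
    have hκi : Integrable (fun w : Obs 𝒳 𝒴 => κ (w.1, w.2.1)) P :=
      (hres2 j).integrable_mul (hres2 k)
    have hprod : ∀ w : Obs 𝒳 𝒴, delta w • (omegaStar c b lam w.1 ^ 2 • κ (w.1, w.2.1))
        = (delta w * omegaStar c b lam w.1 * (U θ₀ w.1 w.2.1 - linComb b β w.1) j) *
        (delta w * omegaStar c b lam w.1 * (U θ₀ w.1 w.2.1 - linComb b β w.1) k) := by
      intro w
      have := delta_mul_self w
      simp only [smul_eq_mul, κ]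
      linear_combination (-(omegaStar c b lam w.1 ^ 2 *
        ((U θ₀ w.1 w.2.1 - linComb b β w.1) j * (U θ₀ w.1 w.2.1 - linComb b β w.1) k))) * this
    have hki : Integrable (fun w : Obs 𝒳 𝒴 =>
        delta w • (omegaStar c b lam w.1 ^ 2 • κ (w.1, w.2.1))) P := by
      simp only [hprod]
      exact (hR2 j).integrable_mul (hR2 k)
    have h := (integral_delta_smul_condExp hMAR ((measurable_omegaStar hb c lam).pow_const 2)
      hκ hκi hki).2
    simp only [hprod] at h
    rw [← h]
    have hcc : condCov P U θ₀ j k =ᵐ[P]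
        condExp (sigmaX 𝒳 𝒴) P (fun w => κ (w.1, w.2.1)) := by
      refine condExp_congr_ae ?_
      filter_upwards [hβ] with w hw
      simp [κ, hw]
    refine integral_congr_ae ?_
    filter_upwards [hcc] with w hw
    simp only [hw, smul_eq_mul, mul_assoc]
  have hmean : ∀ i, ∫ w : Obs 𝒳 𝒴, linComb b β w.1 i ∂P = 0 := fun i => by
    have h := (EuclideanSpace.proj (𝕜 := ℝ) i).integral_comp_comm
      (h1.integrable (by norm_num))
    rw [integral_linComb_eq_zero hreg hβ, map_zero] at h
    exact h
  have hcovar : covariance (fun w => Ubar P U θ₀ w j) (fun w => Ubar P U θ₀ w k) P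
      = ∫ w, linComb b β w.1 j * linComb b β w.1 k ∂P := by
    have e : ∀ i, (fun w => Ubar P U θ₀ w i) =ᵐ[P] fun w => linComb b β w.1 i := fun i => by
      filter_upwards [hβ] with w hw
      rw [hw]
    rw [covariance]
    simp only [integral_congr_ae (e _), hmean, sub_zero]
    refine integral_congr_ae ?_
    filter_upwards [e j, e k] with w h1 h2
    rw [h1, h2]
  rw [V1, Matrix.of_apply, hcov, hcovar]
  have hexp : ∀ w, influence c U b lam θ₀ β w j * influence c U b lam θ₀ β w k
      = (linComb b β w.1 j * linComb b β w.1 k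
        + (delta w * omegaStar c b lam w.1 * (U θ₀ w.1 w.2.1 - linComb b β w.1) j) *
          (delta w * omegaStar c b lam w.1 * (U θ₀ w.1 w.2.1 - linComb b β w.1) k))
        + (linComb b β w.1 j *
            (delta w * omegaStar c b lam w.1 * (U θ₀ w.1 w.2.1 - linComb b β w.1) k)
          + linComb b β w.1 k *
            (delta w * omegaStar c b lam w.1 * (U θ₀ w.1 w.2.1 - linComb b β w.1) j)) := by
    intro w
    simp only [influence, PiLp.add_apply, PiLp.smul_apply, smul_eq_mul]
    ring
  simp only [hexp]
  have i1 := (hL2 j).integrable_mul (hL2 k)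
  have i2 := (hR2 j).integrable_mul (hR2 k)
  have i3 := (hL2 j).integrable_mul (hR2 k)
  have i4 := (hL2 k).integrable_mul (hR2 j)
  have e0 := integral_add (i1.add i2) (i3.add i4)
  have e1 := integral_add i1 i2
  have e2 := integral_add i3 i4
  simp only [Pi.add_apply, Pi.mul_apply] at e0 e1 e2
  rw [e0, e1, e2, integral_linComb_mul_residual hMAR hreg hβ c j k,
    integral_linComb_mul_residual hMAR hreg hβ c k j]
  simp

end Covariance

/-! ### Derivatives of the estimating function -/

section Derivative

variable {𝒳 𝒴 : Type*} [MeasurableSpace 𝒳] [MeasurableSpace 𝒴] {L p : ℕ}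
  {P : Measure (Obs 𝒳 𝒴)} {U : Vec p → 𝒳 → 𝒴 → Vec p} {b : 𝒳 → Vec L}
  {Θ : Set (Vec p)} {θ₀ : Vec p} {lam : Vec (L + 1)} {ρ ε : ℝ} {G : 𝒳 → 𝒴 → ℝ}

/-- The derivative `∂U(θ; x, y) / ∂θᵀ`. -/
def dU (U : Vec p → 𝒳 → 𝒴 → Vec p) (θ : Vec p) (w : Obs 𝒳 𝒴) : Vec p →L[ℝ] Vec p :=
  fderiv ℝ (fun t => U t w.1 w.2.1) θ

/-- The remainder of the first-order expansion of `U` at `θ₀`, divided by `‖θ - θ₀‖`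
(and `0` at `θ = θ₀`). -/
def remainder (U : Vec p → 𝒳 → 𝒴 → Vec p) (θ₀ θ : Vec p) (w : Obs 𝒳 𝒴) : Vec p :=
  ‖θ - θ₀‖⁻¹ • (U θ w.1 w.2.1 - U θ₀ w.1 w.2.1 - dU U θ₀ w (θ - θ₀))

namespace LocalEnvelope

lemma integrable_omega [IsProbabilityMeasure P] {E : Type*} [NormedAddCommGroup E] [NormedSpace ℝ E]
    (henv : LocalEnvelope P U b Θ θ₀ lam ρ ε G) (hb : Measurable b) (c : ℝ)
    {f : Obs 𝒳 𝒴 → E} (hf : AEStronglyMeasurable f P) {K : ℝ}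
    (h : ∀ᵐ w ∂P, ‖f w‖ ≤ K * (1 + G w.1 w.2.1)) :
    Integrable (fun w => (delta w * omegaStar c b lam w.1) • f w) P := by
  have h1 := henv.integrable_weighted hb (q := fun _ => 1) measurable_const
    (A := 1) (fun x => by simpa using one_le_norm_zvec_sq b x) hf h
  simp only [mul_one] at h1
  have hfi : Integrable f P :=
    (((integrable_const (1 : ℝ)).add henv.integrable_G).const_mul K).mono' hf h
  have h2 : Integrable (fun w => delta w • f w) P := integrable_delta_smul_iff.2 hfi.integrableOn
  refine (h2.add (h1.smul c)).congr (Eventually.of_forall fun w => ?_)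
  simp only [omegaStar, Pi.add_apply, Pi.smul_apply, smul_smul, ← add_smul]
  congr 1
  ring

lemma differentiableAt (henv : LocalEnvelope P U b Θ θ₀ lam ρ ε G) :
    ∀ᵐ w ∂P, ∀ θ ∈ Metric.ball θ₀ ρ, DifferentiableAt ℝ (fun t => U t w.1 w.2.1) θ := by
  filter_upwards [henv.contDiffOn] with w hw θ hθ
  exact (hw.differentiableOn one_ne_zero).differentiableAt (Metric.isOpen_ball.mem_nhds hθ)

lemma norm_sub_le (henv : LocalEnvelope P U b Θ θ₀ lam ρ ε G) :
    ∀ᵐ w ∂P, ∀ θ ∈ Metric.ball θ₀ ρ,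
      ‖U θ w.1 w.2.1 - U θ₀ w.1 w.2.1‖ ≤ G w.1 w.2.1 * ‖θ - θ₀‖ := by
  filter_upwards [henv.differentiableAt, henv.bound_fderiv] with w h1 h2 θ hθ
  exact (convex_ball θ₀ ρ).norm_image_sub_le_of_norm_fderiv_le (𝕜 := ℝ) h1 h2
    (Metric.mem_ball_self henv.rho_pos) hθ

lemma norm_dU_le (henv : LocalEnvelope P U b Θ θ₀ lam ρ ε G) :
    ∀ᵐ w ∂P, ‖dU U θ₀ w‖ ≤ G w.1 w.2.1 := by
  filter_upwards [henv.bound_fderiv] with w hw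
  exact hw θ₀ (Metric.mem_ball_self henv.rho_pos)

lemma norm_dU_apply_le (henv : LocalEnvelope P U b Θ θ₀ lam ρ ε G) (v : Vec p) :
    ∀ᵐ w ∂P, ‖dU U θ₀ w v‖ ≤ ‖v‖ * (1 + G w.1 w.2.1) := by
  filter_upwards [henv.norm_dU_le] with w hw
  have h := (dU U θ₀ w).le_opNorm v
  have h' : ‖dU U θ₀ w‖ * ‖v‖ ≤ G w.1 w.2.1 * ‖v‖ := by gcongr
  nlinarith [norm_nonneg v]

/-- Difference quotients of `U` along `v`, evaluated inside the ball around `θ₀`, converge to the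
directional derivative. -/
lemma exists_quotient (henv : LocalEnvelope P U b Θ θ₀ lam ρ ε G) (v : Vec p) :
    ∃ t : ℕ → ℝ, (∀ n, 0 < t n) ∧ (∀ n, θ₀ + t n • v ∈ Metric.ball θ₀ ρ) ∧
      ∀ᵐ w ∂P, Tendsto
        (fun n => (t n)⁻¹ • (U (θ₀ + t n • v) w.1 w.2.1 - U θ₀ w.1 w.2.1)) atTop
        (𝓝 (dU U θ₀ w v)) := by
  have hρ := henv.rho_pos
  set r := ρ / (‖v‖ + 1) with hr
  have hr0 : 0 < r := by positivity
  have hrv : r * ‖v‖ < ρ := by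
    rw [hr, div_mul_eq_mul_div, div_lt_iff₀ (by positivity)]
    nlinarith
  have htr : ∀ n : ℕ, r / ((n : ℝ) + 1) ≤ r := fun n =>
    div_le_self hr0.le (by linarith [(Nat.cast_nonneg n : (0 : ℝ) ≤ n)])
  have htpos : ∀ n : ℕ, 0 < r / ((n : ℝ) + 1) := fun n => by positivity
  refine ⟨fun n => r / ((n : ℝ) + 1), htpos, fun n => ?_, ?_⟩
  · rw [Metric.mem_ball, dist_eq_norm, add_sub_cancel_left, norm_smul,
      Real.norm_of_nonneg (htpos n).le]
    exact lt_of_le_of_lt (mul_le_mul_of_nonneg_right (htr n) (norm_nonneg _)) hrv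
  · filter_upwards [henv.differentiableAt] with w hw
    have hd := ((hw θ₀ (Metric.mem_ball_self hρ)).hasFDerivAt.hasLineDerivAt v)
    have hs := hasDerivAt_iff_tendsto_slope_zero.1 hd
    have ht0 : Tendsto (fun n : ℕ => r / ((n : ℝ) + 1)) atTop (𝓝[≠] 0) := by
      refine tendsto_nhdsWithin_iff.2 ⟨?_, Eventually.of_forall fun n => (htpos n).ne'⟩
      have h := (tendsto_const_div_atTop_nhds_zero_nat r).comp (tendsto_add_atTop_nat 1)
      simpa [Function.comp_def] using h
    have := hs.comp ht0
    simpa [Function.comp_def, dU] using this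

/-- The derivative is measurable as a limit of difference quotients. -/
lemma aestronglyMeasurable_dU (henv : LocalEnvelope P U b Θ θ₀ lam ρ ε G)
    (hreg : RegularityConditions P U b Θ θ₀ lam) (v : Vec p) :
    AEStronglyMeasurable (fun w => dU U θ₀ w v) P := by
  obtain ⟨t, -, htb, hlim⟩ := henv.exists_quotient v
  refine aestronglyMeasurable_of_tendsto_ae atTop (fun n => ?_) hlim
  exact (((hreg.measurable_U_obs (henv.ball_subset (htb n))).sub
    (hreg.measurable_U_obs hreg.mem)).const_smul (t n)⁻¹).aestronglyMeasurable

lemma integrable_dU [IsProbabilityMeasure P] (henv : LocalEnvelope P U b Θ θ₀ lam ρ ε G)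
    (hreg : RegularityConditions P U b Θ θ₀ lam) (v : Vec p) :
    Integrable (fun w => dU U θ₀ w v) P :=
  (((integrable_const (1 : ℝ)).add henv.integrable_G).const_mul ‖v‖).mono'
    (henv.aestronglyMeasurable_dU hreg v) (henv.norm_dU_apply_le v)

lemma aestronglyMeasurable_remainder (henv : LocalEnvelope P U b Θ θ₀ lam ρ ε G)
    (hreg : RegularityConditions P U b Θ θ₀ lam) {θ : Vec p} (hθ : θ ∈ Metric.ball θ₀ ρ) :
    AEStronglyMeasurable (remainder U θ₀ θ) P :=
  (((hreg.measurable_U_obs (henv.ball_subset hθ)).sub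
    (hreg.measurable_U_obs hreg.mem)).aestronglyMeasurable.sub
    (henv.aestronglyMeasurable_dU hreg (θ - θ₀))).const_smul ‖θ - θ₀‖⁻¹

lemma norm_remainder_le (henv : LocalEnvelope P U b Θ θ₀ lam ρ ε G) :
    ∀ᵐ w ∂P, ∀ θ ∈ Metric.ball θ₀ ρ, ‖remainder U θ₀ θ w‖ ≤ 2 * (1 + G w.1 w.2.1) := by
  filter_upwards [henv.norm_sub_le, henv.norm_dU_le, henv.G_nonneg] with w h1 h2 h3 θ hθ
  rw [remainder, norm_smul, norm_inv, norm_norm]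
  rcases (norm_nonneg (θ - θ₀)).eq_or_lt with h0 | h0
  · rw [← h0]
    simp only [inv_zero, zero_mul]
    positivity
  · rw [inv_mul_le_iff₀ h0]
    have h4 := _root_.norm_sub_le (U θ w.1 w.2.1 - U θ₀ w.1 w.2.1) (dU U θ₀ w (θ - θ₀))
    have h5 := (dU U θ₀ w).le_opNorm (θ - θ₀)
    have h6 : ‖dU U θ₀ w‖ * ‖θ - θ₀‖ ≤ G w.1 w.2.1 * ‖θ - θ₀‖ := by gcongr
    nlinarith [h1 θ hθ]

lemma continuousOn_remainder (henv : LocalEnvelope P U b Θ θ₀ lam ρ ε G) :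
    ∀ᵐ w ∂P, ContinuousOn (fun θ => remainder U θ₀ θ w) (Metric.ball θ₀ ρ) := by
  filter_upwards [henv.differentiableAt] with w hw θ hθ
  refine ContinuousAt.continuousWithinAt ?_
  rcases eq_or_ne θ θ₀ with rfl | hne
  · have hd := (hw θ hθ).hasFDerivAt
    rw [hasFDerivAt_iff_tendsto] at hd
    rw [ContinuousAt]
    have h0 : remainder U θ θ w = 0 := by simp [remainder]
    rw [h0, tendsto_zero_iff_norm_tendsto_zero]
    refine hd.congr fun x => ?_
    rw [remainder, norm_smul, norm_inv, norm_norm]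
    rfl
  · have hc : ContinuousAt (fun t => U t w.1 w.2.1) θ := (hw θ hθ).continuousAt
    have hn : ‖θ - θ₀‖ ≠ 0 := norm_ne_zero_iff.2 (sub_ne_zero.2 hne)
    have h1 : ContinuousAt (fun t => ‖t - θ₀‖⁻¹) θ :=
      ContinuousAt.inv₀ (by fun_prop) hn
    have h2 : ContinuousAt (fun t => dU U θ₀ w (t - θ₀)) θ := by fun_prop
    exact h1.smul ((hc.sub continuousAt_const).sub h2)

end LocalEnvelope

omit [MeasurableSpace 𝒳] [MeasurableSpace 𝒴] in
lemma sub_eq_dU_add_remainder (U : Vec p → 𝒳 → 𝒴 → Vec p) (θ₀ θ : Vec p) (w : Obs 𝒳 𝒴) :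
    U θ w.1 w.2.1 - U θ₀ w.1 w.2.1
      = dU U θ₀ w (θ - θ₀) + ‖θ - θ₀‖ • remainder U θ₀ θ w := by
  rcases eq_or_ne θ θ₀ with rfl | hne
  · simp
  · have hn : ‖θ - θ₀‖ ≠ 0 := norm_ne_zero_iff.2 (sub_ne_zero.2 hne)
    rw [remainder, smul_inv_smul₀ hn]
    abel

omit [MeasurableSpace 𝒳] [MeasurableSpace 𝒴] in
lemma dU_apply_eq_sum (U : Vec p → 𝒳 → 𝒴 → Vec p) (θ₀ : Vec p) (w : Obs 𝒳 𝒴) (v : Vec p) :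
    dU U θ₀ w v = ∑ k, v k • dU U θ₀ w (EuclideanSpace.single k 1) := by
  have h : v = ∑ k, v k • EuclideanSpace.single k (1 : ℝ) := by
    ext j
    simp [Pi.single_apply]
  conv_lhs => rw [h]
  simp [map_sum]

/-- `τ v` is the mean of the directional derivatives of `U` along `v`. -/
lemma tau_mulVec [IsProbabilityMeasure P] (henv : LocalEnvelope P U b Θ θ₀ lam ρ ε G)
    (hreg : RegularityConditions P U b Θ θ₀ lam) (v : Vec p) :
    ∫ w, dU U θ₀ w v ∂P = WithLp.toLp 2 ((tau P U θ₀).mulVec v) := by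
  have hi := henv.integrable_dU hreg
  ext j
  have h := (EuclideanSpace.proj (𝕜 := ℝ) j).integral_comp_comm (hi v)
  refine h.symm.trans ?_
  change ∫ w, dU U θ₀ w v j ∂P = (tau P U θ₀).mulVec v j
  have hj : ∀ k, Integrable (fun w => dU U θ₀ w (EuclideanSpace.single k 1) j) P := fun k =>
    (EuclideanSpace.proj (𝕜 := ℝ) j).integrable_comp (hi _)
  have hs : ∀ w, (dU U θ₀ w v) j = ∑ k, v k * dU U θ₀ w (EuclideanSpace.single k 1) j := by
    intro w
    rw [dU_apply_eq_sum]
    simp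
  simp only [hs]
  rw [integral_finsetSum _ fun k _ => (hj k).const_mul (v k)]
  simp only [Matrix.mulVec, dotProduct, tau, Matrix.of_apply]
  refine Finset.sum_congr rfl fun k _ => ?_
  rw [integral_const_mul, mul_comm]
  rfl

end Derivative

section WeightedDerivative

variable {𝒳 𝒴 : Type*} [MeasurableSpace 𝒳] [StandardBorelSpace 𝒳]
  [MeasurableSpace 𝒴] [StandardBorelSpace 𝒴] {L p : ℕ}
  {P : Measure (Obs 𝒳 𝒴)} [IsProbabilityMeasure P] {U : Vec p → 𝒳 → 𝒴 → Vec p} {b : 𝒳 → Vec L}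
  {Θ : Set (Vec p)} {θ₀ : Vec p} {lam : Vec (L + 1)} {ρ ε : ℝ} {G : 𝒳 → 𝒴 → ℝ}

/-- The weighted estimating function and `U` have the same mean at every `θ` near `θ₀`; hence
their derivatives at `θ₀` have the same mean. -/
theorem integral_weighted_dU (hMAR : MissingAtRandom P) (hmodel : DensityRatioModel P b lam)
    (hreg : RegularityConditions P U b Θ θ₀ lam) (henv : LocalEnvelope P U b Θ θ₀ lam ρ ε G)
    (hspan : ∀ θ ∈ Θ, UbarInSpan P U b θ) (v : Vec p) :
    ∫ w, (delta w * omegaStar (odds P) b lam w.1) • dU U θ₀ w v ∂P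
      = ∫ w, dU U θ₀ w v ∂P := by
  obtain ⟨t, htp, htb, hlim⟩ := henv.exists_quotient v
  have hb := hreg.measurable_b
  have hU : ∀ θ ∈ Θ, Integrable (fun w => U θ w.1 w.2.1) P := fun θ hθ =>
    (hreg.moment_U θ hθ).integrable (by norm_num)
  have hm : ∀ n, AEStronglyMeasurable
      (fun w : Obs 𝒳 𝒴 => (t n)⁻¹ • (U (θ₀ + t n • v) w.1 w.2.1 - U θ₀ w.1 w.2.1)) P := fun n =>
    (((hreg.measurable_U_obs (henv.ball_subset (htb n))).sub
      (hreg.measurable_U_obs hreg.mem)).const_smul (t n)⁻¹).aestronglyMeasurable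
  have hbd : ∀ n, ∀ᵐ w ∂P, ‖(t n)⁻¹ • (U (θ₀ + t n • v) w.1 w.2.1 - U θ₀ w.1 w.2.1)‖
      ≤ ‖v‖ * (1 + G w.1 w.2.1) := by
    intro n
    filter_upwards [henv.norm_sub_le] with w hw
    have h := hw _ (htb n)
    rw [add_sub_cancel_left, norm_smul, Real.norm_of_nonneg (htp n).le] at h
    rw [norm_smul, norm_inv, Real.norm_of_nonneg (htp n).le, inv_mul_le_iff₀ (htp n)]
    nlinarith [norm_nonneg v, mul_nonneg (htp n).le (norm_nonneg v)]
  have hgi : Integrable (fun w : Obs 𝒳 𝒴 => ‖v‖ * (1 + G w.1 w.2.1)) P :=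
    ((integrable_const (1 : ℝ)).add henv.integrable_G).const_mul ‖v‖
  have hwm : Measurable fun w : Obs 𝒳 𝒴 => delta w * omegaStar (odds P) b lam w.1 :=
    measurable_delta.mul ((measurable_omegaStar hb _ lam).comp measurable_fst)
  have hwi : Integrable (fun w : Obs 𝒳 𝒴 => ‖(delta w * omegaStar (odds P) b lam w.1) •
      (‖v‖ * (1 + G w.1 w.2.1))‖) P := by
    refine Integrable.norm (henv.integrable_omega hb (odds P) hgi.aestronglyMeasurable
      (K := ‖v‖) ?_)
    filter_upwards [henv.G_nonneg] with w hw
    rw [Real.norm_of_nonneg (by positivity)]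
  have l1 := tendsto_integral_of_dominated_convergence _ hm hgi hbd hlim
  have l2 := tendsto_integral_of_dominated_convergence _
    (fun n => hwm.aestronglyMeasurable.smul (hm n)) hwi
    (fun n => by
      filter_upwards [hbd n, henv.G_nonneg] with w hw hG
      rw [Pi.smul_apply', norm_smul, norm_smul (delta w * omegaStar (odds P) b lam w.1)
        (‖v‖ * (1 + G w.1 w.2.1))]
      exact mul_le_mul_of_nonneg_left (hw.trans (le_abs_self (‖v‖ * (1 + G w.1 w.2.1))))
        (norm_nonneg (delta w * omegaStar (odds P) b lam w.1)))
    (by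
      filter_upwards [hlim] with w hw
      exact hw.const_smul (delta w * omegaStar (odds P) b lam w.1))
  refine tendsto_nhds_unique l2 (l1.congr fun n => ?_)
  have w1 := integral_weighted_U hMAR hmodel hreg henv (henv.ball_subset (htb n))
    (hspan _ (henv.ball_subset (htb n)))
  have w0 := integral_weighted_U hMAR hmodel hreg henv hreg.mem (hspan _ hreg.mem)
  rw [integral_smul, integral_sub (hU _ (henv.ball_subset (htb n))) (hU _ hreg.mem), ← w1.2,
    ← w0.2, ← integral_sub w1.1 w0.1, ← integral_smul]
  refine integral_congr_ae (Eventually.of_forall fun w => ?_)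
  rw [Pi.smul_apply', smul_comm, smul_sub]

end WeightedDerivative

/-! ### Sample odds and the information form -/

section Sample

variable {𝒳 𝒴 Ω : Type*} [MeasurableSpace 𝒳] [MeasurableSpace 𝒴] [MeasurableSpace Ω]
  {μ : Measure Ω} [IsProbabilityMeasure μ] {L p : ℕ}
  {P : Measure (Obs 𝒳 𝒴)} [IsProbabilityMeasure P] {U : Vec p → 𝒳 → 𝒴 → Vec p} {b : 𝒳 → Vec L}
  {Θ : Set (Vec p)} {θ₀ : Vec p} {lam : Vec (L + 1)} {ρ ε : ℝ} {G : 𝒳 → 𝒴 → ℝ}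
  {W : ℕ → Ω → Obs 𝒳 𝒴}

omit [IsProbabilityMeasure μ] in
lemma tendsto_inv_sqrt_whp : Tendsto (fun q : ℕ × Ω => (√(q.1 : ℝ))⁻¹) (whp μ) (𝓝 0) :=
  (tendsto_inv_atTop_zero.comp (Real.tendsto_sqrt_atTop.comp
    tendsto_natCast_atTop_atTop)).comp tendsto_fst_whp

omit [IsProbabilityMeasure μ] in
/-- A sequence of order `N ^ (-1 / 2)` in probability tends to zero in probability. -/
lemma BoundedInProb.tendsto_zero {X : ℕ × Ω → ℝ}
    (hX : BoundedInProb μ fun q => √(q.1 : ℝ) * X q) : Tendsto X (whp μ) (𝓝 0) := by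
  refine (hX.mul_tendsto_zero tendsto_inv_sqrt_whp).congr' ?_
  filter_upwards [tendsto_fst_whp.eventually_gt_atTop 0] with q hq
  have : √(q.1 : ℝ) ≠ 0 := (Real.sqrt_pos.2 (by exact_mod_cast hq)).ne'
  field_simp

lemma boundedInProb_sqrt_mul_norm_avg {𝒮 : Type*} [MeasurableSpace 𝒮] {Q : Measure 𝒮}
    {X : ℕ → Ω → 𝒮} (hlaw : ∀ i, HasLaw (X i) Q μ) (hindep : iIndepFun X μ) {n : ℕ}
    {f : 𝒮 → Vec n} (hf : MemLp f 2 Q) (h0 : ∫ w, f w ∂Q = 0) :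
    BoundedInProb μ (fun q => √(q.1 : ℝ) * ‖avg X f q‖) := by
  have hQ : IsProbabilityMeasure Q := (hlaw 0).isProbabilityMeasure_iff.1 inferInstance
  have hk : ∀ k : Fin n, BoundedInProb μ (fun q => √(q.1 : ℝ) * avg X (fun w => f w k) q) := by
    intro k
    refine boundedInProb_sqrt_mul_avg hlaw hindep (memLp_coord hf k) ?_
    have h := (EuclideanSpace.proj (𝕜 := ℝ) k).integral_comp_comm (hf.integrable (by norm_num))
    rw [h0, map_zero] at h
    exact h
  have hk' : ∀ k : Fin n, BoundedInProb μ (fun q => |√(q.1 : ℝ) * avg X (fun w => f w k) q|) :=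
    fun k => (hk k).mono (Eventually.of_forall fun q => by rw [abs_abs])
  refine (BoundedInProb.sum (s := Finset.univ) fun k _ => hk' k).mono (Eventually.of_forall ?_)
  intro q
  have hco : ∀ k, (avg X f q) k = avg X (fun w => f w k) q := fun k =>
    (avg_map X f (EuclideanSpace.proj (𝕜 := ℝ) k).toLinearMap q).symm
  have hn : ‖avg X f q‖ ≤ ∑ k, |avg X (fun w => f w k) q| := by
    simpa only [hco] using norm_le_sum_abs (avg X f q)
  simp only [abs_mul, abs_norm, abs_of_nonneg (Real.sqrt_nonneg _), ← Finset.mul_sum]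
  rw [abs_of_nonneg (Finset.sum_nonneg fun _ _ => abs_nonneg _)]
  gcongr

/-- The odds `N₀ / N₁` in the sample, as a function of the sample size and the outcome. -/
def oddsHat (W : ℕ → Ω → Obs 𝒳 𝒴) (q : ℕ × Ω) : ℝ := cHat (fun i => W i q.2) q.1

omit [MeasurableSpace 𝒳] [MeasurableSpace 𝒴] [MeasurableSpace Ω] in
lemma oddsHat_eq (q : ℕ × Ω) :
    oddsHat W q = avg W (fun w => 1 - delta w) q / avg W delta q := by
  rw [oddsHat, cHat, avg, avg, smul_eq_mul, smul_eq_mul]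
  rcases Nat.eq_zero_or_pos q.1 with h | h
  · simp [h]
  · rw [mul_div_mul_left]
    have : (0 : ℝ) < q.1 := by exact_mod_cast h
    positivity

/-- The sample odds converge at the rate `N ^ (-1 / 2)`. -/
lemma boundedInProb_oddsHat (hlaw : ∀ i, HasLaw (W i) P μ) (hindep : iIndepFun W μ)
    (h1 : 0 < P {w | w.2.2 = true}) :
    BoundedInProb μ (fun q => √(q.1 : ℝ) * (oddsHat W q - odds P)) := by
  have hpos : 0 < P.real (observed 𝒳 𝒴) := ENNReal.toReal_pos h1.ne' (measure_ne_top _ _)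
  have hd := tendsto_avg hlaw hindep (integrable_delta (P := P))
  rw [integral_delta] at hd
  have hmem : MemLp (fun w : Obs 𝒳 𝒴 => (1 - delta w) - odds P * delta w) 2 P := by
    refine MemLp.of_bound (Measurable.aestronglyMeasurable (by fun_prop)) (1 + |odds P|)
      (Eventually.of_forall fun w => ?_)
    have h0 := delta_nonneg w
    have h1 := delta_le_one w
    refine (norm_sub_le _ _).trans ?_
    rw [norm_mul, Real.norm_eq_abs, Real.norm_eq_abs, Real.norm_eq_abs, abs_of_nonneg h0,
      abs_of_nonneg (by linarith)]
    nlinarith [abs_nonneg (odds P)]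
  have hb := (boundedInProb_sqrt_mul_avg hlaw hindep hmem
    (integral_one_sub_delta_sub h1)).const_mul (2 / P.real (observed 𝒳 𝒴))
  refine hb.mono ?_
  filter_upwards [hd.eventually (lt_mem_nhds (half_lt_self hpos))] with q hq
  have hq0 : 0 < avg W delta q := (half_pos hpos).trans hq
  have he : oddsHat W q - odds P
      = avg W (fun w => (1 - delta w) - odds P * delta w) q / avg W delta q := by
    have hs := avg_sub W (fun w => 1 - delta w) (fun w => odds P * delta w) q
    rw [oddsHat_eq, hs, avg_const_mul W delta (odds P) q]
    field_simp
  rw [he, abs_mul, abs_div, abs_mul, abs_mul, abs_of_pos hq0, abs_of_pos (by positivity :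
    0 < 2 / P.real (observed 𝒳 𝒴)), div_eq_mul_inv, mul_comm (|avg W _ q|), ← mul_assoc,
    mul_comm _ (avg W delta q)⁻¹, mul_assoc]
  refine mul_le_mul_of_nonneg_right ?_ (by positivity)
  rw [inv_le_comm₀ hq0 (by positivity), inv_div]
  exact hq.le

lemma tendsto_oddsHat (hlaw : ∀ i, HasLaw (W i) P μ) (hindep : iIndepFun W μ)
    (h1 : 0 < P {w | w.2.2 = true}) : Tendsto (oddsHat W) (whp μ) (𝓝 (odds P)) := by
  have h := (boundedInProb_oddsHat hlaw hindep h1).tendsto_zero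
  simpa using h.add_const (odds P)

end Sample

section Information

variable {𝒳 𝒴 Ω : Type*} [MeasurableSpace 𝒳] [MeasurableSpace 𝒴] [MeasurableSpace Ω]
  {μ : Measure Ω} [IsProbabilityMeasure μ] {L p : ℕ}
  {P : Measure (Obs 𝒳 𝒴)} [IsProbabilityMeasure P] {U : Vec p → 𝒳 → 𝒴 → Vec p} {b : 𝒳 → Vec L}
  {Θ : Set (Vec p)} {θ₀ : Vec p} {lam : Vec (L + 1)} {ρ ε : ℝ} {G : 𝒳 → 𝒴 → ℝ}
  {W : ℕ → Ω → Obs 𝒳 𝒴}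

/-- The quadratic form `δ exp (zᵀ lam) (zᵀu)² / (1 + ‖z‖)`. Its mean is positive definite, and
it bounds from below both the curvature of the calibration equation and the design matrix of the
weighted regression. -/
def infoForm (b : 𝒳 → Vec L) (lam : Vec (L + 1)) (u : Vec (L + 1)) (w : Obs 𝒳 𝒴) : ℝ :=
  delta w * expRatio b lam w.1 * ((inner ℝ (zvec b w.1) u) ^ 2 / (1 + ‖zvec b w.1‖))

omit [MeasurableSpace 𝒳] [MeasurableSpace 𝒴] in
lemma infoForm_nonneg (b : 𝒳 → Vec L) (lam u : Vec (L + 1)) (w : Obs 𝒳 𝒴) :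
    0 ≤ infoForm b lam u w := by
  have := delta_nonneg w
  have := expRatio_pos b lam w.1
  unfold infoForm
  positivity

lemma measurable_infoForm (hb : Measurable b) (lam u : Vec (L + 1)) :
    Measurable (infoForm (𝒴 := 𝒴) b lam u) := by
  have h1 := measurable_expRatio hb lam
  have h2 := measurable_zvec hb
  unfold infoForm
  fun_prop

omit [MeasurableSpace 𝒳] [MeasurableSpace 𝒴] in
lemma infoForm_le (b : 𝒳 → Vec L) (lam u : Vec (L + 1)) (w : Obs 𝒳 𝒴) :
    infoForm b lam u w ≤ ‖u‖ ^ 2 * (delta w * expRatio b lam w.1 * ‖zvec b w.1‖ ^ 2) := by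
  have hd := delta_nonneg w
  have he := expRatio_pos b lam w.1
  have h1 : (inner ℝ (zvec b w.1) u) ^ 2 ≤ (‖zvec b w.1‖ * ‖u‖) ^ 2 := by
    rw [← sq_abs]
    gcongr
    exact abs_real_inner_le_norm _ _
  have h2 : (inner ℝ (zvec b w.1) u) ^ 2 / (1 + ‖zvec b w.1‖) ≤ (‖zvec b w.1‖ * ‖u‖) ^ 2 :=
    (div_le_self (sq_nonneg _) (by linarith [norm_nonneg (zvec b w.1)])).trans h1
  calc infoForm b lam u w
      ≤ delta w * expRatio b lam w.1 * (‖zvec b w.1‖ * ‖u‖) ^ 2 := by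
        unfold infoForm
        gcongr
    _ = _ := by ring

omit [MeasurableSpace 𝒳] [MeasurableSpace 𝒴] in
lemma infoForm_smul (b : 𝒳 → Vec L) (lam u : Vec (L + 1)) (r : ℝ) (w : Obs 𝒳 𝒴) :
    infoForm b lam (r • u) w = r ^ 2 * infoForm b lam u w := by
  simp only [infoForm, inner_smul_right]
  ring

/-- If the form vanishes at `u`, then `zᵀu = 0` for the respondents, hence, by absolute continuity,
for everybody; linear independence gives `u = 0`. -/
lemma integral_infoForm_pos (hmodel : DensityRatioModel P b lam)
    (hreg : RegularityConditions P U b Θ θ₀ lam) (henv : LocalEnvelope P U b Θ θ₀ lam ρ ε G)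
    {u : Vec (L + 1)} (hu : u ≠ 0) : 0 < ∫ w, infoForm b lam u w ∂P := by
  have hb := hreg.measurable_b
  have hi : Integrable (infoForm (𝒴 := 𝒴) b lam u) P := by
    refine ((henv.integrable_expRatio_norm_sq hb).const_mul (‖u‖ ^ 2)).mono'
      (measurable_infoForm hb lam u).aestronglyMeasurable (Eventually.of_forall fun w => ?_)
    rw [Real.norm_of_nonneg (infoForm_nonneg b lam u w)]
    exact infoForm_le b lam u w
  refine lt_of_le_of_ne (integral_nonneg fun w => infoForm_nonneg b lam u w) fun h0 => hu ?_
  have hz := (integral_eq_zero_iff_of_nonneg (fun w => infoForm_nonneg b lam u w) hi).1 h0.symm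
  refine hreg.indep_b u (ae_of_ae_observed (p := fun x => inner ℝ (zvec b x) u = 0)
    hreg.missing_pos hmodel ?_ ?_)
  · exact measurableSet_eq_fun ((measurable_zvec hb).inner measurable_const) measurable_const
  · filter_upwards [hz] with w hw hd
    have he := expRatio_pos b lam w.1
    have hn : 0 < 1 + ‖zvec b w.1‖ := by positivity
    simpa [infoForm, hd, he.ne', hn.ne'] using hw

/-- With probability tending to one, the sample mean of `infoForm` is bounded from below by a
fixed positive definite form. -/
theorem eventually_infoForm (hlaw : ∀ i, HasLaw (W i) P μ) (hindep : iIndepFun W μ)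
    (hmodel : DensityRatioModel P b lam)
    (hreg : RegularityConditions P U b Θ θ₀ lam) (henv : LocalEnvelope P U b Θ θ₀ lam ρ ε G) :
    ∃ a > 0, ∀ᶠ q in whp μ, ∀ u : Vec (L + 1), a * ‖u‖ ^ 2 ≤ avg W (infoForm b lam u) q := by
  have hb := hreg.measurable_b
  have hsph : ∀ u : Metric.sphere (0 : Vec (L + 1)) 1, ‖(u : Vec (L + 1))‖ = 1 := fun u =>
    mem_sphere_zero_iff_norm.1 u.2
  obtain ⟨hcont, hunif⟩ := uniform_avg (T := Metric.sphere (0 : Vec (L + 1)) 1) hlaw hindep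
    (f := fun u w => infoForm b lam u w)
    (fun u => (measurable_infoForm hb lam u).aestronglyMeasurable)
    (Eventually.of_forall fun w => by unfold infoForm; fun_prop)
    (henv.integrable_expRatio_norm_sq hb)
    (Eventually.of_forall fun w u => by
      rw [Real.norm_of_nonneg (infoForm_nonneg b lam u w)]
      simpa [hsph u] using infoForm_le b lam u w)
  have hne : Nonempty (Metric.sphere (0 : Vec (L + 1)) 1) :=
    ⟨⟨EuclideanSpace.single 0 1, by simp⟩⟩
  -- the constant is half of the minimum of the limit over the unit sphere
  obtain ⟨u₀, -, hu₀⟩ := isCompact_univ.exists_isMinOn Set.univ_nonempty hcont.continuousOn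
  have hu₀ne : (u₀ : Vec (L + 1)) ≠ 0 := by
    intro h
    have := hsph u₀
    rw [h, norm_zero] at this
    exact zero_ne_one this
  have hpos := integral_infoForm_pos hmodel hreg henv hu₀ne
  refine ⟨_, half_pos hpos, ?_⟩
  filter_upwards [hunif _ (half_pos hpos)] with q hq u
  rcases eq_or_ne u 0 with rfl | hu
  · have h0 : avg W (infoForm b lam 0) q = 0 := by
      simp [avg, infoForm]
    simp [h0]
  · have hn : ‖u‖ ≠ 0 := norm_ne_zero_iff.2 hu
    let v : Metric.sphere (0 : Vec (L + 1)) 1 := ⟨‖u‖⁻¹ • u, by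
      rw [mem_sphere_zero_iff_norm, norm_smul, norm_inv, norm_norm, inv_mul_cancel₀ hn]⟩
    have hv : u = ‖u‖ • (v : Vec (L + 1)) := by simp [v, smul_smul, hn]
    have h1 := (abs_le.1 ((Real.norm_eq_abs _).symm.le.trans (hq v))).1
    have h2 : ∫ w, infoForm b lam u₀ w ∂P ≤ ∫ w, infoForm b lam v w ∂P := hu₀ (Set.mem_univ v)
    have h3 : avg W (infoForm b lam u) q = ‖u‖ ^ 2 * avg W (infoForm b lam v) q := by
      rw [← avg_const_mul]
      refine avg_congr fun i => ?_
      conv_lhs => rw [hv]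
      exact infoForm_smul b lam _ _ _
    rw [h3, mul_comm]
    have : 0 ≤ ‖u‖ ^ 2 := sq_nonneg _
    gcongr
    linarith

end Information

/-! ### Rate of convergence of the calibration parameter -/

section CalibrationBound

variable {𝒳 𝒴 Ω : Type*} {L : ℕ} {b : 𝒳 → Vec L} {lam : Vec (L + 1)}
  {W : ℕ → Ω → Obs 𝒳 𝒴}

lemma sq_div_one_add_abs_le (x : ℝ) : x ^ 2 / (1 + |x|) ≤ (Real.exp x - 1) * x := by
  rw [div_le_iff₀ (by positivity)]
  rcases le_total 0 x with hx | hx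
  · rw [abs_of_nonneg hx]
    have h := Real.add_one_le_exp x
    nlinarith [mul_nonneg hx (sub_nonneg.2 h), mul_nonneg (mul_nonneg hx hx) (sub_nonneg.2 h),
      mul_nonneg (mul_nonneg hx hx) hx]
  · rw [abs_of_nonpos hx]
    have h := Real.add_one_le_exp (-x)
    have h1 : Real.exp x * Real.exp (-x) = 1 := by rw [← Real.exp_add]; simp
    have h2 : Real.exp x * (1 - x) ≤ 1 := by
      rw [← h1]
      exact mul_le_mul_of_nonneg_left (by linarith) (Real.exp_pos x).le
    nlinarith

lemma expRatio_add (b : 𝒳 → Vec L) (lam d : Vec (L + 1)) (x : 𝒳) :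
    expRatio b (lam + d) x = expRatio b lam x * Real.exp (inner ℝ (zvec b x) d) := by
  rw [expRatio, expRatio, inner_add_right, Real.exp_add]

/-- Strict convexity of the calibration problem along the segment from `lam` to `lam + d`. -/
lemma infoForm_div_le (b : 𝒳 → Vec L) (lam d : Vec (L + 1)) (w : Obs 𝒳 𝒴) :
    infoForm b lam d w / (1 + ‖d‖)
      ≤ delta w * (expRatio b (lam + d) w.1 - expRatio b lam w.1) * inner ℝ (zvec b w.1) d := by
  set x : ℝ := inner ℝ (zvec b w.1) d with hx
  have hd := delta_nonneg w
  have he := expRatio_pos b lam w.1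
  have hxn : |x| ≤ ‖zvec b w.1‖ * ‖d‖ := abs_real_inner_le_norm _ _
  have h1 : x ^ 2 / (1 + ‖zvec b w.1‖) / (1 + ‖d‖) ≤ x ^ 2 / (1 + |x|) := by
    rw [div_div]
    refine div_le_div_of_nonneg_left (sq_nonneg x) (by positivity) ?_
    nlinarith [norm_nonneg (zvec b w.1), norm_nonneg d]
  calc infoForm b lam d w / (1 + ‖d‖)
      = delta w * expRatio b lam w.1 * (x ^ 2 / (1 + ‖zvec b w.1‖) / (1 + ‖d‖)) := by
        rw [infoForm, mul_div_assoc]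
    _ ≤ delta w * expRatio b lam w.1 * ((Real.exp x - 1) * x) := by
        gcongr
        exact h1.trans (sq_div_one_add_abs_le x)
    _ = _ := by
        rw [expRatio_add]
        ring

lemma Calibrates.avg_calibScore {q : ℕ × Ω} {l : Vec (L + 1)}
    (h : Calibrates b (fun i => W i q.2) q.1 l) :
    avg W (calibScore (oddsHat W q) b l) q = 0 := by
  have h1 : ∀ w : Obs 𝒳 𝒴, calibScore (oddsHat W q) b l w
      = (delta w * omegaStar (oddsHat W q) b l w.1) • zvec b w.1 - zvec b w.1 := by
    intro w
    have : (delta w * omegaStar (oddsHat W q) b l w.1) • zvec b w.1 - zvec b w.1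
        = (delta w * omegaStar (oddsHat W q) b l w.1 - 1) • zvec b w.1 := by
      rw [sub_smul, one_smul]
    rw [this, calibScore, omegaStar]
    congr 1
    ring
  rw [funext h1, avg_sub, sub_eq_zero]
  exact congrArg ((q.1 : ℝ)⁻¹ • ·) h

/-- A solution of the calibration equation is close to `lam` when the score at `lam` is small. -/
lemma Calibrates.norm_le {q : ℕ × Ω} {l : Vec (L + 1)}
    (h : Calibrates b (fun i => W i q.2) q.1 l) (hc : 0 ≤ oddsHat W q) {a : ℝ}
    (ha : ∀ u : Vec (L + 1), a * ‖u‖ ^ 2 ≤ avg W (infoForm b lam u) q) :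
    oddsHat W q * a * ‖l - lam‖
      ≤ ‖avg W (calibScore (oddsHat W q) b lam) q‖ * (1 + ‖l - lam‖) := by
  set c := oddsHat W q
  set d := l - lam with hd
  have hl : l = lam + d := by rw [hd]; abel
  have hn : 0 < 1 + ‖d‖ := by positivity
  have hinner : ∀ f : Obs 𝒳 𝒴 → Vec (L + 1),
      inner ℝ d (avg W f q) = avg W (fun w => inner ℝ d (f w)) q := fun f =>
    (avg_map W f (innerₛₗ ℝ d) q).symm
  have h0 : inner ℝ d (avg W (calibScore c b l) q) = 0 := by
    rw [h.avg_calibScore, inner_zero_right]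
  have h1 : inner ℝ d (avg W (calibScore c b l) q) - inner ℝ d (avg W (calibScore c b lam) q)
      = c * avg W (fun w => delta w * (expRatio b l w.1 - expRatio b lam w.1)
          * inner ℝ (zvec b w.1) d) q := by
    rw [hinner, hinner, ← avg_sub, ← avg_const_mul]
    refine avg_congr fun i => ?_
    simp only [calibScore, inner_smul_right, real_inner_comm d]
    ring
  have h2 : a * ‖d‖ ^ 2 / (1 + ‖d‖) ≤ avg W (fun w => delta w *
      (expRatio b l w.1 - expRatio b lam w.1) * inner ℝ (zvec b w.1) d) q := by
    have h3 : avg W (fun w => infoForm b lam d w / (1 + ‖d‖)) q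
        = avg W (infoForm b lam d) q / (1 + ‖d‖) := by
      simp only [div_eq_inv_mul]
      exact avg_const_mul W _ _ q
    refine (div_le_div_of_nonneg_right (ha d) hn.le).trans ?_
    rw [← h3, hl]
    exact avg_mono fun i => infoForm_div_le b lam d _
  have h4 : c * (a * ‖d‖ ^ 2 / (1 + ‖d‖)) ≤ ‖d‖ * ‖avg W (calibScore c b lam) q‖ := by
    have h5 := (abs_le.1 (abs_real_inner_le_norm d (avg W (calibScore c b lam) q))).1
    have h6 := mul_le_mul_of_nonneg_left h2 hc
    linarith
  rcases (norm_nonneg d).eq_or_lt with h5 | h5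
  · rw [← h5, mul_zero]
    positivity
  · rw [← mul_div_assoc, div_le_iff₀ hn] at h4
    refine le_of_mul_le_mul_left ?_ h5
    linarith

end CalibrationBound

section CalibrationRate

variable {𝒳 𝒴 Ω : Type*} [MeasurableSpace 𝒳] [MeasurableSpace 𝒴] [MeasurableSpace Ω]
  {μ : Measure Ω} [IsProbabilityMeasure μ] {L p : ℕ}
  {P : Measure (Obs 𝒳 𝒴)} [IsProbabilityMeasure P] {U : Vec p → 𝒳 → 𝒴 → Vec p} {b : 𝒳 → Vec L}
  {Θ : Set (Vec p)} {θ₀ : Vec p} {lam : Vec (L + 1)} {ρ ε : ℝ} {G : 𝒳 → 𝒴 → ℝ}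
  {W : ℕ → Ω → Obs 𝒳 𝒴}

/-- The score of the calibration equation, with the sample odds, is of order `N ^ (-1 / 2)`. -/
lemma boundedInProb_calibScore (hlaw : ∀ i, HasLaw (W i) P μ) (hindep : iIndepFun W μ)
    (hmodel : DensityRatioModel P b lam)
    (hreg : RegularityConditions P U b Θ θ₀ lam) (henv : LocalEnvelope P U b Θ θ₀ lam ρ ε G) :
    BoundedInProb μ
      (fun q => √(q.1 : ℝ) * ‖avg W (calibScore (oddsHat W q) b lam) q‖) := by
  have h1 := boundedInProb_sqrt_mul_norm_avg hlaw hindep (memLp_calibScore hmodel hreg henv)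
    (integral_calibScore hmodel hreg henv)
  have h2 := boundedInProb_oddsHat hlaw hindep hreg.observed_pos
  have h3 := (tendsto_avg hlaw hindep
    ((memLp_expRatio_zvec hreg).integrable (by norm_num))).norm
  set M := ‖∫ w, (delta w * expRatio b lam w.1) • zvec b w.1 ∂P‖ with hM
  have h4 : BoundedInProb μ (fun q => |√(q.1 : ℝ) * (oddsHat W q - odds P)|) :=
    h2.mono (Eventually.of_forall fun q => by rw [abs_abs])
  refine (h1.add (h4.const_mul (M + 1))).mono ?_
  filter_upwards [h3.eventually (gt_mem_nhds (lt_add_one M))] with q hq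
  have h5 : avg W (calibScore (oddsHat W q) b lam) q = avg W (calibScore (odds P) b lam) q
      + (oddsHat W q - odds P) •
        avg W (fun w => (delta w * expRatio b lam w.1) • zvec b w.1) q := by
    rw [← avg_const_smul, ← avg_add]
    refine avg_congr fun i => ?_
    rw [calibScore_eq, calibScore_eq]
    module
  rw [abs_of_nonneg (by positivity), abs_of_nonneg (by positivity), abs_mul,
    abs_of_nonneg (Real.sqrt_nonneg _), h5]
  refine (mul_le_mul_of_nonneg_left (norm_add_le _ _) (Real.sqrt_nonneg _)).trans ?_
  rw [mul_add, norm_smul, Real.norm_eq_abs, mul_comm (M + 1), mul_assoc]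
  gcongr

/-- The estimated density ratio parameter converges at the rate `N ^ (-1 / 2)`. -/
theorem boundedInProb_lamHat (hlaw : ∀ i, HasLaw (W i) P μ) (hindep : iIndepFun W μ)
    (hmodel : DensityRatioModel P b lam)
    (hreg : RegularityConditions P U b Θ θ₀ lam) (henv : LocalEnvelope P U b Θ θ₀ lam ρ ε G)
    {lh : ℕ × Ω → Vec (L + 1)}
    (hcal : ∀ᶠ q in whp μ, Calibrates b (fun i => W i q.2) q.1 (lh q)) :
    BoundedInProb μ (fun q => √(q.1 : ℝ) * ‖lh q - lam‖) := by
  obtain ⟨a, ha, hinfo⟩ := eventually_infoForm hlaw hindep hmodel hreg henv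
  have hg := boundedInProb_calibScore hlaw hindep hmodel hreg henv
  have hc := odds_pos hreg.observed_pos hreg.missing_pos
  set κ := odds P / 2 * a with hκ
  have hκ0 : 0 < κ := by positivity
  refine (hg.const_mul (2 / κ)).mono ?_
  filter_upwards [hinfo, hcal, hg.tendsto_zero.eventually (gt_mem_nhds (half_pos hκ0)),
    (tendsto_oddsHat hlaw hindep hreg.observed_pos).eventually
      (lt_mem_nhds (half_lt_self hc))] with q h1 h2 h3 h4
  have h5 := h2.norm_le ((half_pos hc).le.trans h4.le) h1
  set g := ‖avg W (calibScore (oddsHat W q) b lam) q‖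
  have hd := norm_nonneg (lh q - lam)
  have h6 : κ * ‖lh q - lam‖ ≤ oddsHat W q * a * ‖lh q - lam‖ := by
    rw [hκ]
    gcongr
  have h7 : ‖lh q - lam‖ ≤ 2 / κ * g := by
    rw [div_mul_eq_mul_div, le_div_iff₀ hκ0]
    nlinarith
  rw [abs_of_nonneg (by positivity), abs_of_nonneg (by positivity), mul_left_comm]
  gcongr

end CalibrationRate

/-! ### Estimated weights -/

section Expansion

variable {𝒳 𝒴 : Type*} {L : ℕ} {b : 𝒳 → Vec L} {lam d : Vec (L + 1)} {ε : ℝ}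

lemma abs_exp_sub_one_le_mul_exp (x : ℝ) : |Real.exp x - 1| ≤ |x| * Real.exp |x| := by
  have h := Complex.norm_exp_sub_sum_le_norm_mul_exp (x : ℂ) 1
  rw [Finset.sum_range_one, pow_zero, Nat.factorial_zero, Nat.cast_one, div_one, pow_one,
    ← Complex.ofReal_exp, ← Complex.ofReal_one, ← Complex.ofReal_sub, Complex.norm_real,
    Complex.norm_real] at h
  exact h

lemma abs_exp_sub_one_sub_le_sq_mul_exp (x : ℝ) :
    |Real.exp x - 1 - x| ≤ x ^ 2 * Real.exp |x| := by
  have h := Complex.norm_exp_sub_sum_le_norm_mul_exp (x : ℂ) 2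
  rw [Finset.sum_range_succ, Finset.sum_range_one, pow_zero, Nat.factorial_zero, Nat.cast_one,
    div_one, pow_one, Nat.factorial_one, Nat.cast_one, div_one, ← Complex.ofReal_exp,
    ← Complex.ofReal_one, ← Complex.ofReal_add, ← Complex.ofReal_sub, Complex.norm_real,
    Complex.norm_real, Real.norm_eq_abs, Real.norm_eq_abs, sq_abs] at h
  rwa [sub_sub]

/-- Powers of `‖z‖` are absorbed by half of the exponent of the envelope. -/
lemma norm_pow_mul_tilt_half_le (b : 𝒳 → Vec L) (lam : Vec (L + 1)) (hε : 0 < ε) {n : ℕ}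
    (hn : n ≤ 3) (x : 𝒳) :
    ‖zvec b x‖ ^ n * tilt b lam (ε / 2) x ≤ 48 / ε ^ 3 * tilt b lam ε x := by
  have hz := one_le_norm_zvec b x
  have he := expRatio_pos b lam x
  have h1 : ‖zvec b x‖ ^ n ≤ ‖zvec b x‖ ^ 3 := pow_le_pow_right₀ hz hn
  have h2 := Real.pow_div_factorial_le_exp (ε / 2 * ‖zvec b x‖) (by positivity) 3
  have h3 : ‖zvec b x‖ ^ 3 ≤ 48 / ε ^ 3 * Real.exp (ε / 2 * ‖zvec b x‖) := by
    rw [div_mul_eq_mul_div, le_div_iff₀ (by positivity)]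
    rw [div_le_iff₀ (by positivity)] at h2
    norm_num [Nat.factorial] at h2
    nlinarith
  have h4 : Real.exp (ε * ‖zvec b x‖)
      = Real.exp (ε / 2 * ‖zvec b x‖) * Real.exp (ε / 2 * ‖zvec b x‖) := by
    rw [← Real.exp_add]
    congr 1
    ring
  rw [tilt_eq, tilt_eq, h4]
  calc ‖zvec b x‖ ^ n * (expRatio b lam x * Real.exp (ε / 2 * ‖zvec b x‖))
      ≤ (48 / ε ^ 3 * Real.exp (ε / 2 * ‖zvec b x‖)) *
        (expRatio b lam x * Real.exp (ε / 2 * ‖zvec b x‖)) := by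
        gcongr
        exact h1.trans h3
    _ = _ := by ring

lemma exp_abs_inner_le (b : 𝒳 → Vec L) (hd : ‖d‖ ≤ ε / 2) (x : 𝒳) :
    Real.exp |inner ℝ (zvec b x) d| ≤ Real.exp (ε / 2 * ‖zvec b x‖) := by
  refine Real.exp_le_exp.2 ((abs_real_inner_le_norm _ _).trans ?_)
  rw [mul_comm]
  gcongr

lemma abs_expRatio_sub_le (b : 𝒳 → Vec L) (lam : Vec (L + 1)) (hd : ‖d‖ ≤ ε / 2) (x : 𝒳) :
    |expRatio b (lam + d) x - expRatio b lam x|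
      ≤ ‖d‖ * (‖zvec b x‖ ^ 1 * tilt b lam (ε / 2) x) := by
  have he := expRatio_pos b lam x
  have h : expRatio b (lam + d) x - expRatio b lam x
      = expRatio b lam x * (Real.exp (inner ℝ (zvec b x) d) - 1) := by
    rw [expRatio_add]
    ring
  rw [h, abs_mul, abs_of_pos he, tilt_eq, pow_one]
  calc expRatio b lam x * |Real.exp (inner ℝ (zvec b x) d) - 1|
      ≤ expRatio b lam x * ((‖zvec b x‖ * ‖d‖) * Real.exp (ε / 2 * ‖zvec b x‖)) := by
        gcongr
        refine (abs_exp_sub_one_le_mul_exp _).trans ?_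
        gcongr
        · exact abs_real_inner_le_norm _ _
        · exact (Real.exp_le_exp.1 (exp_abs_inner_le b hd x))
    _ = _ := by ring

lemma abs_expRatio_sub_sub_le (b : 𝒳 → Vec L) (lam : Vec (L + 1)) (hd : ‖d‖ ≤ ε / 2) (x : 𝒳) :
    |expRatio b (lam + d) x - expRatio b lam x - expRatio b lam x * inner ℝ (zvec b x) d|
      ≤ ‖d‖ ^ 2 * (‖zvec b x‖ ^ 2 * tilt b lam (ε / 2) x) := by
  have he := expRatio_pos b lam x
  have h : expRatio b (lam + d) x - expRatio b lam x - expRatio b lam x * inner ℝ (zvec b x) d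
      = expRatio b lam x * (Real.exp (inner ℝ (zvec b x) d) - 1 - inner ℝ (zvec b x) d) := by
    rw [expRatio_add]
    ring
  rw [h, abs_mul, abs_of_pos he, tilt_eq]
  calc expRatio b lam x * |Real.exp (inner ℝ (zvec b x) d) - 1 - inner ℝ (zvec b x) d|
      ≤ expRatio b lam x * ((‖zvec b x‖ * ‖d‖) ^ 2 * Real.exp (ε / 2 * ‖zvec b x‖)) := by
        gcongr
        refine (abs_exp_sub_one_sub_le_sq_mul_exp _).trans ?_
        rw [← sq_abs]
        gcongr
        · exact abs_real_inner_le_norm _ _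
        · exact (Real.exp_le_exp.1 (exp_abs_inner_le b hd x))
    _ = _ := by ring

lemma abs_weight_sub_le (b : 𝒳 → Vec L) (lam : Vec (L + 1)) (hε : 0 < ε) (hd : ‖d‖ ≤ ε / 2)
    (c c' : ℝ) (w : Obs 𝒳 𝒴) :
    |delta w * omegaStar c' b (lam + d) w.1 - delta w * omegaStar c b lam w.1|
      ≤ (|c'| * ‖d‖ + |c' - c|) * (48 / ε ^ 3) * (delta w * tilt b lam ε w.1) := by
  have hδ := delta_nonneg w
  have he := expRatio_pos b lam w.1
  have h : delta w * omegaStar c' b (lam + d) w.1 - delta w * omegaStar c b lam w.1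
      = delta w * (c' * (expRatio b (lam + d) w.1 - expRatio b lam w.1)
        + (c' - c) * expRatio b lam w.1) := by
    rw [omegaStar, omegaStar]
    ring
  have h1 := (abs_expRatio_sub_le b lam hd w.1).trans (mul_le_mul_of_nonneg_left
    (norm_pow_mul_tilt_half_le b lam hε (by norm_num) w.1) (norm_nonneg d))
  have h2 : expRatio b lam w.1 ≤ 48 / ε ^ 3 * tilt b lam ε w.1 := by
    refine le_trans ?_ (norm_pow_mul_tilt_half_le b lam hε (n := 0) (by norm_num) w.1)
    rw [pow_zero, one_mul, tilt_eq]
    exact le_mul_of_one_le_right he.le (Real.one_le_exp (by positivity))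
  rw [h, abs_mul, abs_of_nonneg hδ]
  calc delta w * |c' * (expRatio b (lam + d) w.1 - expRatio b lam w.1)
        + (c' - c) * expRatio b lam w.1|
      ≤ delta w * (|c'| * (‖d‖ * (48 / ε ^ 3 * tilt b lam ε w.1))
        + |c' - c| * (48 / ε ^ 3 * tilt b lam ε w.1)) := by
        gcongr
        refine (abs_add_le _ _).trans ?_
        rw [abs_mul, abs_mul, abs_of_pos he]
        gcongr
    _ = _ := by ring

end Expansion

section Weights

variable {𝒳 𝒴 Ω : Type*} [MeasurableSpace 𝒳] [MeasurableSpace 𝒴] [MeasurableSpace Ω]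
  {μ : Measure Ω} [IsProbabilityMeasure μ] {L p : ℕ}
  {P : Measure (Obs 𝒳 𝒴)} [IsProbabilityMeasure P] {U : Vec p → 𝒳 → 𝒴 → Vec p} {b : 𝒳 → Vec L}
  {Θ : Set (Vec p)} {θ₀ : Vec p} {lam : Vec (L + 1)} {ρ ε : ℝ} {G : 𝒳 → 𝒴 → ℝ}
  {W : ℕ → Ω → Obs 𝒳 𝒴}

/-- The estimated weight `δ ω⋆(x; l)`, with the sample odds. -/
def weightHat (b : 𝒳 → Vec L) (W : ℕ → Ω → Obs 𝒳 𝒴) (q : ℕ × Ω) (l : Vec (L + 1))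
    (w : Obs 𝒳 𝒴) : ℝ :=
  delta w * omegaStar (oddsHat W q) b l w.1

/-- Replacing the true weights by estimated weights has a negligible effect on sample means,
uniformly over all functions dominated by a multiple of `1 + G`. -/
theorem exists_weightHat_sub (hlaw : ∀ i, HasLaw (W i) P μ) (hindep : iIndepFun W μ)
    (hreg : RegularityConditions P U b Θ θ₀ lam) (henv : LocalEnvelope P U b Θ θ₀ lam ρ ε G)
    {lh : ℕ × Ω → Vec (L + 1)} (hlh : Tendsto (fun q => ‖lh q - lam‖) (whp μ) (𝓝 0)) :
    ∃ r : ℕ × Ω → ℝ, Tendsto r (whp μ) (𝓝 0) ∧ ∀ᶠ q in whp μ,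
      ∀ (f : Obs 𝒳 𝒴 → Vec p) (K : ℝ), (∀ i, ‖f (W i q.2)‖ ≤
        K * (1 + G (W i q.2).1 (W i q.2).2.1)) →
      ‖avg W (fun w => weightHat b W q (lh q) w • f w) q
        - avg W (fun w => (delta w * omegaStar (odds P) b lam w.1) • f w) q‖ ≤ K * r q := by
  have hε := henv.eps_pos
  have hc := tendsto_oddsHat hlaw hindep hreg.observed_pos
  have hS := tendsto_avg hlaw hindep henv.integrable_tilt
  refine ⟨fun q => ((|oddsHat W q| * ‖lh q - lam‖ + |oddsHat W q - odds P|) * (48 / ε ^ 3)) *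
    avg W (fun w => delta w * tilt b lam ε w.1 * (1 + G w.1 w.2.1)) q, ?_, ?_⟩
  · have h1 := (((hc.abs.mul hlh).add (hc.sub_const (odds P)).abs).mul_const (48 / ε ^ 3)).mul hS
    simpa using h1
  · filter_upwards [hlh.eventually (ge_mem_nhds (half_pos hε)),
      whp_sample hlaw henv.G_nonneg] with q hq hG f K hf
    have hl : lh q = lam + (lh q - lam) := by abel
    rw [← avg_sub, ← avg_const_mul, ← avg_const_mul]
    refine (norm_avg_le _ _ _).trans (avg_mono fun i => ?_)
    rw [← sub_smul, norm_smul, Real.norm_eq_abs]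
    have h1 := abs_weight_sub_le b lam hε hq (odds P) (oddsHat W q) (W i q.2)
    rw [← hl] at h1
    have h2 : 0 ≤ K * (1 + G (W i q.2).1 (W i q.2).2.1) := (norm_nonneg _).trans (hf i)
    refine (mul_le_mul h1 (hf i) (norm_nonneg _) ((abs_nonneg _).trans h1)).trans (le_of_eq ?_)
    ring

end Weights

/-! ### Consistency and local expansion -/

section Consistency

variable {𝒳 𝒴 Ω : Type*} [MeasurableSpace 𝒳] [StandardBorelSpace 𝒳]
  [MeasurableSpace 𝒴] [StandardBorelSpace 𝒴] [MeasurableSpace Ω]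
  {μ : Measure Ω} [IsProbabilityMeasure μ] {L p : ℕ}
  {P : Measure (Obs 𝒳 𝒴)} [IsProbabilityMeasure P] {U : Vec p → 𝒳 → 𝒴 → Vec p} {b : 𝒳 → Vec L}
  {Θ : Set (Vec p)} {θ₀ : Vec p} {lam : Vec (L + 1)} {ρ ε : ℝ} {G : 𝒳 → 𝒴 → ℝ}
  {W : ℕ → Ω → Obs 𝒳 𝒴} {lh : ℕ × Ω → Vec (L + 1)} {th : ℕ × Ω → Vec p}

omit [StandardBorelSpace 𝒳] [StandardBorelSpace 𝒴] in
lemma LocalEnvelope.integrable_norm_omega (henv : LocalEnvelope P U b Θ θ₀ lam ρ ε G)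
    (hb : Measurable b) (c K : ℝ) :
    Integrable (fun w => ‖(delta w * omegaStar c b lam w.1) • (K * (1 + G w.1 w.2.1))‖) P := by
  have hgi : Integrable (fun w : Obs 𝒳 𝒴 => K * (1 + G w.1 w.2.1)) P :=
    ((integrable_const (1 : ℝ)).add henv.integrable_G).const_mul K
  refine (henv.integrable_omega hb c hgi.aestronglyMeasurable (K := |K|) ?_).norm
  filter_upwards [henv.G_nonneg] with w hw
  rw [norm_mul, Real.norm_eq_abs, Real.norm_of_nonneg (by positivity : 0 ≤ 1 + G w.1 w.2.1)]

omit [StandardBorelSpace 𝒳] [StandardBorelSpace 𝒴] [IsProbabilityMeasure P] in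
lemma measurable_weight (hb : Measurable b) (c : ℝ) (lam : Vec (L + 1)) :
    Measurable fun w : Obs 𝒳 𝒴 => delta w * omegaStar c b lam w.1 :=
  measurable_delta.mul ((measurable_omegaStar hb c lam).comp measurable_fst)

/-- The estimator converges in probability to `θ₀`. -/
theorem tendsto_thetaHat (hlaw : ∀ i, HasLaw (W i) P μ) (hindep : iIndepFun W μ)
    (hMAR : MissingAtRandom P) (hmodel : DensityRatioModel P b lam)
    (hreg : RegularityConditions P U b Θ θ₀ lam) (henv : LocalEnvelope P U b Θ θ₀ lam ρ ε G)
    (hspan : ∀ θ ∈ Θ, UbarInSpan P U b θ)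
    (hlh : Tendsto (fun q => ‖lh q - lam‖) (whp μ) (𝓝 0))
    (hth : ∀ᶠ q in whp μ, th q ∈ Θ ∧
      avg W (fun w => weightHat b W q (lh q) w • U (th q) w.1 w.2.1) q = 0) :
    Tendsto th (whp μ) (𝓝 θ₀) := by
  have hb := hreg.measurable_b
  have hcomp : CompactSpace Θ := isCompact_iff_compactSpace.1 hreg.compact
  obtain ⟨hcont, hunif⟩ := uniform_avg (T := Θ) hlaw hindep
    (f := fun θ w => (delta w * omegaStar (odds P) b lam w.1) • U θ w.1 w.2.1)
    (fun θ => ((measurable_weight hb _ _).smul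
      (hreg.measurable_U_obs θ.2)).aestronglyMeasurable)
    (by
      filter_upwards [hreg.continuous_U] with w hw
      exact (continuousOn_iff_continuous_domRestrict.1 hw).const_smul
        (delta w * omegaStar (odds P) b lam w.1))
    (henv.integrable_norm_omega hb (odds P) 1)
    (by
      filter_upwards [henv.bound, henv.G_nonneg] with w hw hG θ
      rw [norm_smul, norm_smul, one_mul]
      refine mul_le_mul_of_nonneg_left ?_ (norm_nonneg _)
      exact (hw θ θ.2).trans ((by linarith : G w.1 w.2.1 ≤ 1 + G w.1 w.2.1).trans (le_abs_self _)))
  obtain ⟨r, hr, hrle⟩ := exists_weightHat_sub hlaw hindep hreg henv hlh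
  rw [Metric.tendsto_nhds]
  intro e he
  have hK : IsCompact {θ : Θ | e ≤ dist (θ : Vec p) θ₀} :=
    (isClosed_le continuous_const (by fun_prop)).isCompact
  rcases Set.eq_empty_or_nonempty {θ : Θ | e ≤ dist (θ : Vec p) θ₀} with hemp | hne
  · filter_upwards [hth] with q hq
    by_contra hcon
    have : (⟨th q, hq.1⟩ : Θ) ∈ {θ : Θ | e ≤ dist (θ : Vec p) θ₀} := not_lt.1 hcon
    rw [hemp] at this
    exact this
  · obtain ⟨θ₁, hθ₁, hmin⟩ := hK.exists_isMinOn hne hcont.norm.continuousOn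
    have hm : 0 < ‖∫ w, (delta w * omegaStar (odds P) b lam w.1) • U θ₁ w.1 w.2.1 ∂P‖ := by
      rw [norm_pos_iff, (integral_weighted_U hMAR hmodel hreg henv θ₁.2 (hspan _ θ₁.2)).2]
      intro h
      have h0 := (hreg.unique_zero θ₁ θ₁.2).1 h
      have h1 : e ≤ dist (θ₁ : Vec p) θ₀ := hθ₁
      rw [h0, dist_self] at h1
      linarith
    -- `m` is the smallest norm of the limiting estimating function at distance `≥ e` from `θ₀`
    set m := ‖∫ w, (delta w * omegaStar (odds P) b lam w.1) • U θ₁ w.1 w.2.1 ∂P‖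
    filter_upwards [hth, hunif (m / 3) (by positivity), hrle,
      hr.eventually (gt_mem_nhds (by positivity : 0 < m / 3)),
      whp_sample hlaw henv.bound, whp_sample hlaw henv.G_nonneg] with q h1 h2 h3 h4 h5 h6
    by_contra hcon
    have hmem : (⟨th q, h1.1⟩ : Θ) ∈ {θ : Θ | e ≤ dist (θ : Vec p) θ₀} := not_lt.1 hcon
    have h7 : m ≤ _ := hmin hmem
    have h8 := h2 ⟨th q, h1.1⟩
    have h9 := h3 (fun w => U (th q) w.1 w.2.1) 1 fun i => by
      linarith [h5 i _ h1.1]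
    rw [h1.2, zero_sub, norm_neg] at h9
    have h10 := norm_sub_norm_le
      (∫ w, (delta w * omegaStar (odds P) b lam w.1) • U (th q) w.1 w.2.1 ∂P)
      (avg W (fun w => (delta w * omegaStar (odds P) b lam w.1) • U (th q) w.1 w.2.1) q)
    rw [norm_sub_rev] at h10
    simp only at h7 h8
    linarith

/-- The weighted sample mean of the derivative converges to `τ`, uniformly over directions. -/
lemma tendsto_avg_dU (hlaw : ∀ i, HasLaw (W i) P μ) (hindep : iIndepFun W μ)
    (hMAR : MissingAtRandom P) (hmodel : DensityRatioModel P b lam)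
    (hreg : RegularityConditions P U b Θ θ₀ lam) (henv : LocalEnvelope P U b Θ θ₀ lam ρ ε G)
    (hspan : ∀ θ ∈ Θ, UbarInSpan P U b θ)
    (hlh : Tendsto (fun q => ‖lh q - lam‖) (whp μ) (𝓝 0)) {η : ℝ} (hη : 0 < η) :
    ∀ᶠ q in whp μ, ∀ v : Vec p,
      ‖avg W (fun w => weightHat b W q (lh q) w • dU U θ₀ w v) q - ∫ w, dU U θ₀ w v ∂P‖
        ≤ η * ‖v‖ := by
  have hb := hreg.measurable_b
  obtain ⟨r, hr, hrle⟩ := exists_weightHat_sub hlaw hindep hreg henv hlh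
  let e : Fin p → Vec p := fun k => EuclideanSpace.single k 1
  have hlim : ∀ k, Tendsto (fun q =>
      ‖avg W (fun w => (delta w * omegaStar (odds P) b lam w.1) • dU U θ₀ w (e k)) q
        - ∫ w, dU U θ₀ w (e k) ∂P‖ + r q) (whp μ) (𝓝 0) := by
    intro k
    have h1 := tendsto_avg hlaw hindep (henv.integrable_omega hb (odds P)
      (henv.aestronglyMeasurable_dU hreg (e k)) (henv.norm_dU_apply_le (e k)))
    rw [integral_weighted_dU hMAR hmodel hreg henv hspan] at h1
    have h2 := (h1.sub_const (∫ w, dU U θ₀ w (e k) ∂P)).norm.add hr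
    simpa using h2
  have hsum := tendsto_finsetSum Finset.univ fun k _ => hlim k
  rw [Finset.sum_const_zero] at hsum
  filter_upwards [hrle, hsum.eventually (ge_mem_nhds hη),
    whp_sample hlaw (ae_all_iff.2 fun k => henv.norm_dU_apply_le (e k))] with q h1 h2 h3 v
  have hex : avg W (fun w => weightHat b W q (lh q) w • dU U θ₀ w v) q
      - ∫ w, dU U θ₀ w v ∂P
      = ∑ k, v k • (avg W (fun w => weightHat b W q (lh q) w • dU U θ₀ w (e k)) q
        - ∫ w, dU U θ₀ w (e k) ∂P) := by
    simp only [smul_sub, Finset.sum_sub_distrib, ← avg_const_smul, ← avg_sum, ← integral_smul]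
    have hi : ∀ k, Integrable (fun w => v k • dU U θ₀ w (e k)) P := fun k =>
      (henv.integrable_dU hreg (e k)).smul (v k)
    rw [← integral_finsetSum _ fun k _ => hi k]
    congr 1
    · refine avg_congr fun i => ?_
      rw [dU_apply_eq_sum U θ₀ _ v, Finset.smul_sum]
      exact Finset.sum_congr rfl fun k _ => smul_comm _ _ _
    · refine integral_congr_ae (Eventually.of_forall fun w => ?_)
      exact dU_apply_eq_sum U θ₀ w v
  rw [hex]
  calc ‖∑ k, v k • (avg W (fun w => weightHat b W q (lh q) w • dU U θ₀ w (e k)) q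
        - ∫ w, dU U θ₀ w (e k) ∂P)‖
      ≤ ∑ k, ‖v‖ * (‖avg W (fun w => (delta w * omegaStar (odds P) b lam w.1) •
          dU U θ₀ w (e k)) q - ∫ w, dU U θ₀ w (e k) ∂P‖ + r q) := by
        refine (norm_sum_le _ _).trans (Finset.sum_le_sum fun k _ => ?_)
        rw [norm_smul]
        have h4 := h1 (fun w => dU U θ₀ w (e k)) 1 fun i => by
          have := h3 i k
          simpa [e] using this
        refine mul_le_mul (PiLp.norm_apply_le v k) ?_ (norm_nonneg _) (norm_nonneg _)
        refine (norm_sub_le_norm_sub_add_norm_sub _ (avg W (fun w => (delta w *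
          omegaStar (odds P) b lam w.1) • dU U θ₀ w (e k)) q) _).trans ?_
        linarith
    _ ≤ η * ‖v‖ := by
        rw [← Finset.mul_sum, mul_comm]
        gcongr

/-- First-order expansion of the weighted estimating function between `θ₀` and a consistent
estimator. -/
theorem eventually_expansion (hlaw : ∀ i, HasLaw (W i) P μ) (hindep : iIndepFun W μ)
    (hMAR : MissingAtRandom P) (hmodel : DensityRatioModel P b lam)
    (hreg : RegularityConditions P U b Θ θ₀ lam) (henv : LocalEnvelope P U b Θ θ₀ lam ρ ε G)
    (hspan : ∀ θ ∈ Θ, UbarInSpan P U b θ)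
    (hlh : Tendsto (fun q => ‖lh q - lam‖) (whp μ) (𝓝 0))
    (hth : Tendsto th (whp μ) (𝓝 θ₀)) {η : ℝ} (hη : 0 < η) :
    ∀ᶠ q in whp μ,
      ‖avg W (fun w => weightHat b W q (lh q) w • U (th q) w.1 w.2.1) q
        - avg W (fun w => weightHat b W q (lh q) w • U θ₀ w.1 w.2.1) q
        - ∫ w, dU U θ₀ w (th q - θ₀) ∂P‖ ≤ η * ‖th q - θ₀‖ := by
  have hb := hreg.measurable_b
  have hρ := henv.rho_pos
  have hsub : Metric.closedBall θ₀ (ρ / 2) ⊆ Metric.ball θ₀ ρ :=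
    Metric.closedBall_subset_ball (half_lt_self hρ)
  have hcomp : CompactSpace (Metric.closedBall θ₀ (ρ / 2)) :=
    isCompact_iff_compactSpace.1 (isCompact_closedBall _ _)
  obtain ⟨hcont, hunif⟩ := uniform_avg (T := Metric.closedBall θ₀ (ρ / 2)) hlaw hindep
    (f := fun θ w => (delta w * omegaStar (odds P) b lam w.1) • remainder U θ₀ θ w)
    (fun θ => (measurable_weight hb _ _).aestronglyMeasurable.smul
      (henv.aestronglyMeasurable_remainder hreg (hsub θ.2)))
    (by
      filter_upwards [henv.continuousOn_remainder] with w hw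
      exact (continuousOn_iff_continuous_domRestrict.1 (hw.mono hsub)).const_smul
        (delta w * omegaStar (odds P) b lam w.1))
    (henv.integrable_norm_omega hb (odds P) 2)
    (by
      filter_upwards [henv.norm_remainder_le] with w hw θ
      rw [norm_smul, norm_smul]
      refine mul_le_mul_of_nonneg_left ?_ (norm_nonneg _)
      exact (hw θ (hsub θ.2)).trans (le_abs_self _))
  obtain ⟨r, hr, hrle⟩ := exists_weightHat_sub hlaw hindep hreg henv hlh
  let t₀ : Metric.closedBall θ₀ (ρ / 2) := ⟨θ₀, Metric.mem_closedBall_self (by positivity)⟩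
  have hη4 : 0 < η / 4 := by positivity
  obtain ⟨s, hs, hsle⟩ := Metric.continuousAt_iff.1 (hcont.continuousAt (x := t₀)) (η / 4) hη4
  have hz : ∫ w, (delta w * omegaStar (odds P) b lam w.1) • remainder U θ₀ t₀ w ∂P = 0 := by
    simp [t₀, remainder]
  filter_upwards [hunif (η / 4) hη4, hrle, hr.eventually (gt_mem_nhds (by positivity : 0 < η / 8)),
    tendsto_avg_dU hlaw hindep hMAR hmodel hreg henv hspan hlh hη4,
    hth.eventually (Metric.closedBall_mem_nhds θ₀ (half_pos hρ)),
    hth.eventually (Metric.ball_mem_nhds θ₀ hs),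
    whp_sample hlaw henv.norm_remainder_le] with q h1 h2 h3 h4 h5 h6 h7
  have h8 := h1 ⟨th q, h5⟩
  have h9 := hsle (x := ⟨th q, h5⟩) h6
  rw [hz, dist_zero_right] at h9
  have h10 := h2 (remainder U θ₀ (th q)) 2 fun i => h7 i _ (hsub h5)
  have h11 := h4 (th q - θ₀)
  have h12 : ‖avg W (fun w => weightHat b W q (lh q) w • remainder U θ₀ (th q) w) q‖
      ≤ 3 * (η / 4) := by
    have e1 := norm_le_norm_add_norm_sub'
      (avg W (fun w => weightHat b W q (lh q) w • remainder U θ₀ (th q) w) q)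
      (avg W (fun w => (delta w * omegaStar (odds P) b lam w.1) • remainder U θ₀ (th q) w) q)
    have e2 := norm_le_norm_add_norm_sub'
      (avg W (fun w => (delta w * omegaStar (odds P) b lam w.1) • remainder U θ₀ (th q) w) q)
      (∫ w, (delta w * omegaStar (odds P) b lam w.1) • remainder U θ₀ (th q) w ∂P)
    simp only at h8 h9
    linarith
  have hex : avg W (fun w => weightHat b W q (lh q) w • U (th q) w.1 w.2.1) q
        - avg W (fun w => weightHat b W q (lh q) w • U θ₀ w.1 w.2.1) q
      = avg W (fun w => weightHat b W q (lh q) w • dU U θ₀ w (th q - θ₀)) q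
        + ‖th q - θ₀‖ • avg W (fun w => weightHat b W q (lh q) w • remainder U θ₀ (th q) w) q := by
    rw [← avg_const_smul, ← avg_sub, ← avg_add]
    refine avg_congr fun i => ?_
    rw [← smul_sub, sub_eq_dU_add_remainder, smul_add, smul_comm (weightHat b W q (lh q) _)]
  rw [hex, add_sub_right_comm]
  refine (norm_add_le _ _).trans ?_
  rw [norm_smul, norm_norm]
  nlinarith [norm_nonneg (th q - θ₀), mul_le_mul_of_nonneg_left h12 (norm_nonneg (th q - θ₀))]

end Consistency

/-! ### The effect of estimating the weights -/

section Linearization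

variable {𝒳 𝒴 Ω : Type*} {L p : ℕ} {b : 𝒳 → Vec L} {W : ℕ → Ω → Obs 𝒳 𝒴}

/-- Calibrated weights reproduce the sample means of the linear combinations `zᵀβ`. -/
lemma Calibrates.avg_linComb {q : ℕ × Ω} {l : Vec (L + 1)}
    (h : Calibrates b (fun i => W i q.2) q.1 l) (β : Fin (L + 1) → Vec p) :
    avg W (fun w => weightHat b W q l w • linComb b β w.1) q
      = avg W (fun w => linComb b β w.1) q := by
  let T : Vec (L + 1) →ₗ[ℝ] Vec p :=
    ∑ k, (LinearMap.toSpanSingleton ℝ (Vec p) (β k)).comp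
      (EuclideanSpace.proj (𝕜 := ℝ) k).toLinearMap
  have hT : ∀ x, linComb b β x = T (zvec b x) := fun x => by
    simp [T, linComb]
  have hz : avg W (fun w => weightHat b W q l w • zvec b w.1) q
      = avg W (fun w => zvec b w.1) q := congrArg ((q.1 : ℝ)⁻¹ • ·) h
  simp only [hT, ← map_smul]
  rw [avg_map W (fun w => weightHat b W q l w • zvec b w.1) T, hz,
    avg_map W (fun w => zvec b w.1) T]

/-- Expansion of the difference between the estimated and the true weights to first order in
`l - lam`. -/
lemma weightHat_sub (b : 𝒳 → Vec L) (lam l : Vec (L + 1)) (c : ℝ) (q : ℕ × Ω) (w : Obs 𝒳 𝒴) :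
    weightHat b W q l w - delta w * omegaStar c b lam w.1
      = (oddsHat W q - c) * (delta w * expRatio b lam w.1)
        + oddsHat W q * (∑ k, (l - lam) k * (delta w * (expRatio b lam w.1 * zvec b w.1 k))
          + delta w * (expRatio b l w.1 - expRatio b lam w.1
            - expRatio b lam w.1 * inner ℝ (zvec b w.1) (l - lam))) := by
  have h : ∑ k, (l - lam) k * (delta w * (expRatio b lam w.1 * zvec b w.1 k))
      = delta w * (expRatio b lam w.1 * inner ℝ (zvec b w.1) (l - lam)) := by
    rw [inner_eq_sum, Finset.mul_sum, Finset.mul_sum]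
    exact Finset.sum_congr rfl fun k _ => by ring
  rw [h, weightHat, omegaStar, omegaStar]
  ring

/-- The second-order term of the expansion of the weights, times the residual `U - zᵀβ`. The three
factors `‖z‖`, two from the expansion and one from `zᵀβ`, are absorbed by the envelope. -/
lemma norm_second_order_le {lam d : Vec (L + 1)} {ε : ℝ} (hε : 0 < ε) (hd : ‖d‖ ≤ ε / 2)
    {w : Obs 𝒳 𝒴} {u : Vec p} {g : ℝ} (hu : ‖u‖ ≤ g) (β : Fin (L + 1) → Vec p) :
    ‖(delta w * (expRatio b (lam + d) w.1 - expRatio b lam w.1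
        - expRatio b lam w.1 * inner ℝ (zvec b w.1) d)) • (u - linComb b β w.1)‖
      ≤ ‖d‖ ^ 2 * ((1 + ∑ k, ‖β k‖) * (48 / ε ^ 3)) * (delta w * tilt b lam ε w.1 * (1 + g)) := by
  have hδ := delta_nonneg w
  have hg : 0 ≤ g := (norm_nonneg _).trans hu
  have hz := one_le_norm_zvec b w.1
  have hB : 0 ≤ ∑ k, ‖β k‖ := Finset.sum_nonneg fun _ _ => norm_nonneg _
  have hR : ‖u - linComb b β w.1‖ ≤ (1 + ∑ k, ‖β k‖) * ((1 + g) * ‖zvec b w.1‖) := by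
    refine (norm_sub_le _ _).trans ((add_le_add hu (norm_linComb_le b β w.1)).trans ?_)
    nlinarith [mul_nonneg hB (mul_nonneg hg (norm_nonneg (zvec b w.1))),
      mul_nonneg hg (sub_nonneg.2 hz)]
  have h3 := norm_pow_mul_tilt_half_le b lam hε le_rfl w.1
  have ht := tilt_pos b lam (ε / 2) w.1
  rw [norm_smul, Real.norm_eq_abs, abs_mul, abs_of_nonneg hδ]
  calc delta w * |expRatio b (lam + d) w.1 - expRatio b lam w.1
        - expRatio b lam w.1 * inner ℝ (zvec b w.1) d| * ‖u - linComb b β w.1‖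
      ≤ delta w * (‖d‖ ^ 2 * (‖zvec b w.1‖ ^ 2 * tilt b lam (ε / 2) w.1)) *
        ((1 + ∑ k, ‖β k‖) * ((1 + g) * ‖zvec b w.1‖)) := by
        gcongr
        exact abs_expRatio_sub_sub_le b lam hd w.1
    _ = ‖d‖ ^ 2 * (1 + ∑ k, ‖β k‖) * (delta w * (1 + g)) *
        (‖zvec b w.1‖ ^ 3 * tilt b lam (ε / 2) w.1) := by ring
    _ ≤ ‖d‖ ^ 2 * (1 + ∑ k, ‖β k‖) * (delta w * (1 + g)) *
        (48 / ε ^ 3 * tilt b lam ε w.1) := by gcongr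
    _ = _ := by ring

end Linearization

section Score

variable {𝒳 𝒴 Ω : Type*} [MeasurableSpace 𝒳] [StandardBorelSpace 𝒳]
  [MeasurableSpace 𝒴] [StandardBorelSpace 𝒴] [MeasurableSpace Ω]
  {μ : Measure Ω} [IsProbabilityMeasure μ] {L p : ℕ}
  {P : Measure (Obs 𝒳 𝒴)} [IsProbabilityMeasure P] {U : Vec p → 𝒳 → 𝒴 → Vec p} {b : 𝒳 → Vec L}
  {Θ : Set (Vec p)} {θ₀ : Vec p} {lam : Vec (L + 1)} {ρ ε : ℝ} {G : 𝒳 → 𝒴 → ℝ}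
  {W : ℕ → Ω → Obs 𝒳 𝒴} {lh : ℕ × Ω → Vec (L + 1)} {β : Fin (L + 1) → Vec p}

/-- The weighted residuals have mean zero, also after multiplication by a coordinate of `z`. -/
lemma tendsto_avg_residual (hlaw : ∀ i, HasLaw (W i) P μ) (hindep : iIndepFun W μ)
    (hMAR : MissingAtRandom P) (hreg : RegularityConditions P U b Θ θ₀ lam)
    (henv : LocalEnvelope P U b Θ θ₀ lam ρ ε G) {θ : Vec p} (hθ : θ ∈ Θ)
    (hβ : Ubar P U θ =ᵐ[P] fun w => linComb b β w.1) {g : 𝒳 → ℝ} (hg : Measurable g)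
    (hgz : ∀ x, |g x| ≤ ‖zvec b x‖) :
    Tendsto (avg W fun w => (delta w * (expRatio b lam w.1 * g w.1)) •
      (U θ w.1 w.2.1 - linComb b β w.1)) (whp μ) (𝓝 0) := by
  have hb := hreg.measurable_b
  have hi := henv.integrable_weighted hb hg (A := 1)
    (fun x => by rw [one_mul]; exact (hgz x).trans (norm_zvec_le_sq b x))
    (hreg.measurable_U_obs hθ).aestronglyMeasurable (henv.bound_U hθ)
  simp only [mul_assoc] at hi
  obtain ⟨h1, h2, h3⟩ := integral_delta_smul_residual hMAR hreg hθ hβ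
    ((measurable_expRatio hb lam).mul hg) hi
  rw [← h3]
  refine tendsto_avg hlaw hindep ?_
  simp only [smul_sub]
  exact hi.sub h1

/-- Estimating the weights changes the estimating function at `θ₀`, to first order, from the
weighted mean of `U` to the mean of the influence function. -/
theorem tendsto_sqrt_mul_sub_influence (hlaw : ∀ i, HasLaw (W i) P μ) (hindep : iIndepFun W μ)
    (hMAR : MissingAtRandom P) (hmodel : DensityRatioModel P b lam)
    (hreg : RegularityConditions P U b Θ θ₀ lam) (henv : LocalEnvelope P U b Θ θ₀ lam ρ ε G)
    (hβ : Ubar P U θ₀ =ᵐ[P] fun w => linComb b β w.1)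
    (hcal : ∀ᶠ q in whp μ, Calibrates b (fun i => W i q.2) q.1 (lh q)) :
    Tendsto (fun q => √(q.1 : ℝ) *
      ‖avg W (fun w => weightHat b W q (lh q) w • U θ₀ w.1 w.2.1) q
        - avg W (influence (odds P) U b lam θ₀ β) q‖) (whp μ) (𝓝 0) := by
  have hb := hreg.measurable_b
  have hε := henv.eps_pos
  let R : Obs 𝒳 𝒴 → Vec p := fun w => U θ₀ w.1 w.2.1 - linComb b β w.1
  set A : ℕ × Ω → Vec p := avg W fun w => (delta w * expRatio b lam w.1) • R w with hA
  set B : Fin (L + 1) → ℕ × Ω → Vec p := fun k =>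
    avg W fun w => (delta w * (expRatio b lam w.1 * zvec b w.1 k)) • R w with hB
  set S : ℕ × Ω → ℝ := avg W fun w => delta w * tilt b lam ε w.1 * (1 + G w.1 w.2.1) with hS
  set C : ℝ := (1 + ∑ k, ‖β k‖) * (48 / ε ^ 3) with hC
  have hd := boundedInProb_lamHat hlaw hindep hmodel hreg henv hcal
  have hd0 := hd.tendsto_zero
  have hc := boundedInProb_oddsHat hlaw hindep hreg.observed_pos
  have hc0 := tendsto_oddsHat hlaw hindep hreg.observed_pos
  have hc' : BoundedInProb μ (fun q => |√(q.1 : ℝ) * (oddsHat W q - odds P)|) :=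
    hc.mono (Eventually.of_forall fun q => by rw [abs_abs])
  have lA : Tendsto (fun q => ‖A q‖) (whp μ) (𝓝 0) := by
    have h := tendsto_avg_residual hlaw hindep hMAR hreg henv hreg.mem hβ
      (g := fun _ => 1) measurable_const (fun x => by simpa using one_le_norm_zvec b x)
    simp only [mul_one] at h
    simpa using h.norm
  have lB : Tendsto (fun q => ∑ k, ‖B k q‖) (whp μ) (𝓝 0) := by
    have h : ∀ k, Tendsto (fun q => ‖B k q‖) (whp μ) (𝓝 0) := fun k => by
      simpa using (tendsto_avg_residual hlaw hindep hMAR hreg henv hreg.mem hβ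
        (measurable_coord_zvec hb k) (fun x => abs_zvec_le b x k)).norm
    simpa using tendsto_finsetSum Finset.univ fun k _ => h k
  have lS : Tendsto S (whp μ) _ := tendsto_avg hlaw hindep henv.integrable_tilt
  -- `l1` bounds the effect of the sample odds, `l2` that of `lh`, to first and second order
  have l1 := hc'.mul_tendsto_zero lA
  have l2 : Tendsto (fun q => |oddsHat W q| * (∑ k, ‖B k q‖ + ‖lh q - lam‖ * (C * S q)))
      (whp μ) (𝓝 0) := by
    simpa using hc0.abs.mul (lB.add (hd0.mul (lS.const_mul C)))
  have l3 := l1.add (hd.mul_tendsto_zero l2)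
  rw [add_zero] at l3
  refine squeeze_zero' (Eventually.of_forall fun q => by positivity) ?_ l3
  filter_upwards [hcal, hd0.eventually (ge_mem_nhds (half_pos hε)),
    whp_sample hlaw henv.bound] with q h1 h2 h3
  set T : Vec p := avg W (fun w => (delta w * (expRatio b (lh q) w.1 - expRatio b lam w.1
    - expRatio b lam w.1 * inner ℝ (zvec b w.1) (lh q - lam))) • R w) q with hT
  have hT' : ‖T‖ ≤ ‖lh q - lam‖ ^ 2 * C * S q := by
    rw [hS, ← avg_const_mul]
    refine (norm_avg_le _ _ _).trans (avg_mono fun i => ?_)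
    have h := norm_second_order_le (b := b) (lam := lam) hε h2 (w := W i q.2)
      (h3 i θ₀ hreg.mem) β
    rwa [add_sub_cancel] at h
  have hex : avg W (fun w => weightHat b W q (lh q) w • U θ₀ w.1 w.2.1) q
        - avg W (influence (odds P) U b lam θ₀ β) q
      = (oddsHat W q - odds P) • A q
        + oddsHat W q • (∑ k, (lh q - lam) k • B k q + T) := by
    have e1 : avg W (fun w => weightHat b W q (lh q) w • U θ₀ w.1 w.2.1) q
        = avg W (fun w => linComb b β w.1) q
          + avg W (fun w => weightHat b W q (lh q) w • R w) q := by
      rw [← h1.avg_linComb β, ← avg_add]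
      refine avg_congr fun i => ?_
      rw [← smul_add]
      congr 1
      simp only [R]
      abel
    have e2 : avg W (influence (odds P) U b lam θ₀ β) q
        = avg W (fun w => linComb b β w.1) q
          + avg W (fun w => (delta w * omegaStar (odds P) b lam w.1) • R w) q := by
      rw [← avg_add]
      rfl
    rw [e1, e2, add_sub_add_left_eq_sub, hT, hA, hB]
    simp only [← avg_sub, ← avg_const_smul, ← avg_sum, ← avg_add]
    refine avg_congr fun i => ?_
    rw [← sub_smul, weightHat_sub]
    simp only [add_smul, mul_smul, Finset.sum_smul, smul_add]
  rw [hex]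
  have hK : ‖∑ k, (lh q - lam) k • B k q‖ ≤ ‖lh q - lam‖ * ∑ k, ‖B k q‖ := by
    rw [Finset.mul_sum]
    refine (norm_sum_le _ _).trans (Finset.sum_le_sum fun k _ => ?_)
    rw [norm_smul]
    gcongr
    exact PiLp.norm_apply_le _ k
  have hs := Real.sqrt_nonneg (q.1 : ℝ)
  calc √(q.1 : ℝ) * ‖(oddsHat W q - odds P) • A q
        + oddsHat W q • (∑ k, (lh q - lam) k • B k q + T)‖
      ≤ √(q.1 : ℝ) * (|oddsHat W q - odds P| * ‖A q‖ + |oddsHat W q| *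
        (‖lh q - lam‖ * ∑ k, ‖B k q‖ + ‖lh q - lam‖ ^ 2 * C * S q)) := by
        gcongr
        refine (norm_add_le _ _).trans ?_
        rw [norm_smul, norm_smul, Real.norm_eq_abs, Real.norm_eq_abs]
        gcongr
        exact (norm_add_le _ _).trans (add_le_add hK hT')
    _ = _ := by
        rw [abs_mul, abs_of_nonneg hs]
        ring

end Score

/-! ### The weighted regression of `U` on `z` -/

section Regression

variable {𝒳 𝒴 Ω : Type*} {L p : ℕ}

lemma linComb_add (b : 𝒳 → Vec L) (β β' : Fin (L + 1) → Vec p) (x : 𝒳) :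
    linComb b (β + β') x = linComb b β x + linComb b β' x := by
  simp [linComb, smul_add, Finset.sum_add_distrib]

lemma linComb_smul (b : 𝒳 → Vec L) (r : ℝ) (β : Fin (L + 1) → Vec p) (x : 𝒳) :
    linComb b (r • β) x = r • linComb b β x := by
  simp only [linComb, Finset.smul_sum, Pi.smul_apply]
  exact Finset.sum_congr rfl fun k _ => smul_comm _ _ _

lemma linComb_apply (b : 𝒳 → Vec L) (β : Fin (L + 1) → Vec p) (x : 𝒳) (j : Fin p) :
    linComb b β x j = inner ℝ (zvec b x) (WithLp.toLp 2 fun k => β k j) := by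
  simp [linComb, inner_eq_sum]

/-- The linear map `β ↦ N⁻¹ ∑ δᵢ exp (zᵢᵀ lam) zᵢ zᵢᵀ β` of the normal equations of the weighted
regression on `z`. -/
def normalMap (b : 𝒳 → Vec L) (lam : Vec (L + 1)) (W : ℕ → Ω → Obs 𝒳 𝒴) (q : ℕ × Ω) :
    (Fin (L + 1) → Vec p) →ₗ[ℝ] (Fin (L + 1) → Vec p) where
  toFun β k := avg W (fun w => (delta w * expRatio b lam w.1 * zvec b w.1 k) •
    linComb b β w.1) q
  map_add' β β' := by
    ext1 k
    simp only [linComb_add, smul_add, avg_add, Pi.add_apply]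
  map_smul' r β := by
    ext1 k
    simp only [linComb_smul, RingHom.id_apply, Pi.smul_apply, ← avg_const_smul]
    exact avg_congr fun i => smul_comm _ _ _

variable {b : 𝒳 → Vec L} {lam : Vec (L + 1)} {W : ℕ → Ω → Obs 𝒳 𝒴} {q : ℕ × Ω}

/-- Coercivity of the normal equations. -/
lemma norm_le_normalMap {a : ℝ} (ha : 0 < a)
    (h : ∀ u : Vec (L + 1), a * ‖u‖ ^ 2 ≤ avg W (infoForm b lam u) q)
    (β : Fin (L + 1) → Vec p) :
    a * ‖β‖ ≤ p * ∑ k, ‖normalMap b lam W q β k‖ := by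
  set s := ∑ k, ‖normalMap b lam W q β k‖ with hs
  have hs0 : 0 ≤ s := Finset.sum_nonneg fun _ _ => norm_nonneg _
  -- the estimate for one column `u` of `β`
  have hcol : ∀ j, a * ‖(WithLp.toLp 2 fun k => β k j : Vec (L + 1))‖ ≤ s := by
    intro j
    set u : Vec (L + 1) := WithLp.toLp 2 fun k => β k j with hu
    have h1 : ∑ k, u k * normalMap b lam W q β k j
        = avg W (fun w => delta w * expRatio b lam w.1 * (inner ℝ (zvec b w.1) u) ^ 2) q := by
      have hco : ∀ k, normalMap b lam W q β k j
          = avg W (fun w => (delta w * expRatio b lam w.1 * zvec b w.1 k) *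
            inner ℝ (zvec b w.1) u) q := by
        intro k
        have hp := avg_map W (fun w => (delta w * expRatio b lam w.1 * zvec b w.1 k) •
          linComb b β w.1) (EuclideanSpace.proj (𝕜 := ℝ) j).toLinearMap q
        refine hp.symm.trans (avg_congr fun i => ?_)
        rw [hu, ← linComb_apply]
        rfl
      simp only [hco, ← avg_const_mul, ← avg_sum]
      refine avg_congr fun i => ?_
      have hx := inner_eq_sum (zvec b (W i q.2).1) u
      set x : ℝ := inner ℝ (zvec b (W i q.2).1) u
      have hxx : x ^ 2 = x * ∑ k, zvec b (W i q.2).1 k * u k := by rw [← hx, sq]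
      rw [hxx, Finset.mul_sum, Finset.mul_sum]
      exact Finset.sum_congr rfl fun k _ => by ring
    have h2 : a * ‖u‖ ^ 2 ≤ ∑ k, u k * normalMap b lam W q β k j := by
      rw [h1]
      refine (h u).trans (avg_mono fun i => ?_)
      have hδ := delta_nonneg (W i q.2)
      have he := expRatio_pos b lam (W i q.2).1
      unfold infoForm
      gcongr
      exact div_le_self (sq_nonneg _) (by linarith [norm_nonneg (zvec b (W i q.2).1)])
    have h3 : ∑ k, u k * normalMap b lam W q β k j ≤ ‖u‖ * s := by
      rw [hs, Finset.mul_sum]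
      refine Finset.sum_le_sum fun k _ => (le_abs_self _).trans ?_
      rw [abs_mul]
      gcongr
      · exact PiLp.norm_apply_le u k
      · exact PiLp.norm_apply_le (normalMap b lam W q β k) j
    rcases (norm_nonneg u).eq_or_lt with h4 | h4
    · rw [← h4, mul_zero]
      exact hs0
    · refine le_of_mul_le_mul_left ?_ h4
      linarith
  rw [← le_div_iff₀' ha, pi_norm_le_iff_of_nonneg (by positivity)]
  intro k
  rw [le_div_iff₀' ha]
  have h5 := norm_le_sum_abs (β k)
  calc a * ‖β k‖ ≤ ∑ j, a * |β k j| := by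
        rw [← Finset.mul_sum]
        gcongr
    _ ≤ ∑ _j : Fin p, s := by
        refine Finset.sum_le_sum fun j _ => le_trans ?_ (hcol j)
        gcongr
        exact PiLp.norm_apply_le (WithLp.toLp 2 fun k => β k j : Vec (L + 1)) k
    _ = p * s := by simp

/-- The normal equations in matrix form. (In an empty sample every `β` is a solution, whereas sample
means are taken to be `0`.) -/
lemma solvesBeta_iff (U : Vec p → 𝒳 → 𝒴 → Vec p) (θ : Vec p) (hq : 0 < q.1)
    (β : Fin (L + 1) → Vec p) :
    SolvesBeta U b lam (fun i => W i q.2) q.1 θ β ↔ normalMap b lam W q β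
      = fun k => avg W (fun w => (delta w * expRatio b lam w.1 * zvec b w.1 k) •
          U θ w.1 w.2.1) q := by
  have hN : ((q.1 : ℝ)⁻¹) ≠ 0 := by positivity
  rw [SolvesBeta, funext_iff]
  refine forall_congr' fun k => ?_
  rw [eq_comm (a := normalMap b lam W q β k), ← sub_eq_zero (b := normalMap b lam W q β k),
    ← smul_eq_zero_iff_right hN]
  have h := avg_sub W (fun w => (delta w * expRatio b lam w.1 * zvec b w.1 k) • U θ w.1 w.2.1)
    (fun w => (delta w * expRatio b lam w.1 * zvec b w.1 k) • linComb b β w.1) q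
  simp only [← smul_sub] at h
  exact Eq.congr_left h

end Regression

section RegressionLimit

variable {𝒳 𝒴 Ω : Type*} [MeasurableSpace 𝒳] [StandardBorelSpace 𝒳]
  [MeasurableSpace 𝒴] [StandardBorelSpace 𝒴] [MeasurableSpace Ω]
  {μ : Measure Ω} [IsProbabilityMeasure μ] {L p : ℕ}
  {P : Measure (Obs 𝒳 𝒴)} [IsProbabilityMeasure P] {U : Vec p → 𝒳 → 𝒴 → Vec p} {b : 𝒳 → Vec L}
  {Θ : Set (Vec p)} {θ₀ : Vec p} {lam : Vec (L + 1)} {ρ ε : ℝ} {G : 𝒳 → 𝒴 → ℝ}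
  {W : ℕ → Ω → Obs 𝒳 𝒴} {β : Fin (L + 1) → Vec p}

/-- The weighted regression of `U` on `z` among the respondents consistently estimates the
coefficients of `𝔼{U ∣ X}`. -/
theorem isProbLimitOfSolution_solvesBeta (hlaw : ∀ i, HasLaw (W i) P μ) (hindep : iIndepFun W μ)
    (hMAR : MissingAtRandom P) (hmodel : DensityRatioModel P b lam)
    (hreg : RegularityConditions P U b Θ θ₀ lam) {θ : Vec p} (hθ : θ ∈ Θ)
    (hβ : Ubar P U θ =ᵐ[P] fun w => linComb b β w.1) :
    IsProbLimitOfSolution μ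
      (fun N ω β' => SolvesBeta U b lam (fun i => W i ω) N θ β') β := by
  obtain ⟨ρ, ε, G, henv⟩ := hreg.exists_localEnvelope
  obtain ⟨a, ha, hinfo⟩ := eventually_infoForm hlaw hindep hmodel hreg henv
  intro e he
  refine (eventually_whp (μ := μ) (p := fun q => ∃ β', (∀ β'', SolvesBeta U b lam
    (fun i => W i q.2) q.1 θ β'' ↔ β'' = β') ∧ dist β' β < e)).1 ?_
  have hres : Tendsto (fun q => (p : ℝ) * ∑ k, ‖avg W (fun w =>
      (delta w * expRatio b lam w.1 * zvec b w.1 k) • (U θ w.1 w.2.1 - linComb b β w.1)) q‖)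
      (whp μ) (𝓝 0) := by
    have h : ∀ k, Tendsto (fun q => ‖avg W (fun w => (delta w * expRatio b lam w.1 *
        zvec b w.1 k) • (U θ w.1 w.2.1 - linComb b β w.1)) q‖) (whp μ) (𝓝 0) := fun k => by
      simpa only [mul_assoc, norm_zero] using (tendsto_avg_residual hlaw hindep hMAR hreg henv hθ
        hβ (measurable_coord_zvec hreg.measurable_b k) (fun x => abs_zvec_le b x k)).norm
    simpa using (tendsto_finsetSum Finset.univ fun k _ => h k).const_mul (p : ℝ)
  filter_upwards [hinfo, tendsto_fst_whp.eventually_gt_atTop 0,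
    hres.eventually (gt_mem_nhds (mul_pos ha he))] with q h1 hq h2
  have hinj : Function.Injective (normalMap (p := p) b lam W q) := by
    refine (injective_iff_map_eq_zero _).2 fun β' h0 => ?_
    have h := norm_le_normalMap ha h1 β'
    rw [h0] at h
    simp only [Pi.zero_apply, norm_zero, Finset.sum_const_zero, mul_zero] at h
    exact norm_le_zero_iff.1 (nonpos_of_mul_nonpos_right h ha)
  obtain ⟨βh, hβh⟩ := LinearMap.injective_iff_surjective.1 hinj (fun k =>
    avg W (fun w => (delta w * expRatio b lam w.1 * zvec b w.1 k) • U θ w.1 w.2.1) q)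
  refine ⟨βh, fun β' => ?_, ?_⟩
  · rw [solvesBeta_iff U θ hq, ← hβh]
    exact hinj.eq_iff
  · rw [dist_eq_norm]
    have h3 := norm_le_normalMap ha h1 (βh - β)
    have h4 : ∀ k, normalMap b lam W q (βh - β) k = avg W (fun w =>
        (delta w * expRatio b lam w.1 * zvec b w.1 k) • (U θ w.1 w.2.1 - linComb b β w.1)) q := by
      intro k
      rw [map_sub, hβh]
      simp only [smul_sub]
      exact (avg_sub W _ _ q).symm
    simp only [h4] at h3
    exact lt_of_mul_lt_mul_left (h3.trans_lt h2) ha.le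

end RegressionLimit

/-! ### Asymptotic normality -/

section Normality

variable {𝒳 𝒴 Ω : Type*} [MeasurableSpace 𝒳] [StandardBorelSpace 𝒳]
  [MeasurableSpace 𝒴] [StandardBorelSpace 𝒴] [MeasurableSpace Ω]
  {μ : Measure Ω} [IsProbabilityMeasure μ] {L p : ℕ}
  {P : Measure (Obs 𝒳 𝒴)} [IsProbabilityMeasure P] {U : Vec p → 𝒳 → 𝒴 → Vec p} {b : 𝒳 → Vec L}
  {Θ : Set (Vec p)} {θ₀ : Vec p} {lam : Vec (L + 1)} {ρ ε : ℝ} {G : 𝒳 → 𝒴 → ℝ}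
  {W : ℕ → Ω → Obs 𝒳 𝒴} {lh : ℕ × Ω → Vec (L + 1)} {th : ℕ × Ω → Vec p}
  {β : Fin (L + 1) → Vec p}

/-- The inverse of `τ`, as a continuous linear map. -/
def tauInv (P : Measure (Obs 𝒳 𝒴)) (U : Vec p → 𝒳 → 𝒴 → Vec p) (θ : Vec p) :
    Vec p →L[ℝ] Vec p :=
  Matrix.toEuclideanCLM (𝕜 := ℝ) (tau P U θ)⁻¹

omit [StandardBorelSpace 𝒳] [StandardBorelSpace 𝒴] in
/-- `τ⁻¹ τ v = v`, where `τ v` is the mean of the directional derivatives along `v`. -/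
lemma tauInv_integral_dU (henv : LocalEnvelope P U b Θ θ₀ lam ρ ε G)
    (hreg : RegularityConditions P U b Θ θ₀ lam) (v : Vec p) :
    tauInv P U θ₀ (∫ w, dU U θ₀ w v ∂P) = v := by
  rw [tau_mulVec henv hreg, tauInv, Matrix.toEuclideanCLM_toLp, Matrix.mulVec_mulVec,
    Matrix.nonsing_inv_mul _ hreg.nonsingular, Matrix.one_mulVec]

/-- Asymptotic linearity: `√N (θ̂ - θ₀) = - τ⁻¹ √N (mean of the influence function) + o_P(1)`. -/
theorem tendsto_asymptotic_linearity (hlaw : ∀ i, HasLaw (W i) P μ) (hindep : iIndepFun W μ)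
    (hMAR : MissingAtRandom P) (hmodel : DensityRatioModel P b lam)
    (hreg : RegularityConditions P U b Θ θ₀ lam)
    (hspan : ∀ θ ∈ Θ, UbarInSpan P U b θ)
    (hβ : Ubar P U θ₀ =ᵐ[P] fun w => linComb b β w.1)
    (hcal : ∀ᶠ q in whp μ, Calibrates b (fun i => W i q.2) q.1 (lh q))
    (hth : ∀ᶠ q in whp μ, th q ∈ Θ ∧
      avg W (fun w => weightHat b W q (lh q) w • U (th q) w.1 w.2.1) q = 0) :
    Tendsto (fun q => √(q.1 : ℝ) • (th q - θ₀) - √(q.1 : ℝ) •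
      avg W (fun w => -tauInv P U θ₀ (influence (odds P) U b lam θ₀ β w)) q) (whp μ) (𝓝 0) := by
  obtain ⟨ρ, ε, G, henv⟩ := hreg.exists_localEnvelope
  set M := tauInv P U θ₀ with hM
  have hlh := (boundedInProb_lamHat hlaw hindep hmodel hreg henv hcal).tendsto_zero
  have hcons := tendsto_thetaHat hlaw hindep hMAR hmodel hreg henv hspan hlh hth
  have hexp := fun (η : ℝ) (hη : 0 < η) =>
    eventually_expansion hlaw hindep hMAR hmodel hreg henv hspan hlh hcons hη
  have hscore := tendsto_sqrt_mul_sub_influence hlaw hindep hMAR hmodel hreg henv hβ hcal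
  have hinf := boundedInProb_sqrt_mul_norm_avg hlaw hindep (memLp_influence hreg hβ (odds P))
    (integral_influence hMAR hreg hβ (odds P))
  set ψ := influence (odds P) U b lam θ₀ β with hψ
  set V : ℕ × Ω → Vec p := fun q =>
    avg W (fun w => weightHat b W q (lh q) w • U θ₀ w.1 w.2.1) q with hV
  -- the estimating function at `θ₀` is of order `N ^ (-1 / 2)`
  have hVb : BoundedInProb μ (fun q => √(q.1 : ℝ) * ‖V q‖) := by
    refine ((boundedInProb_of_tendsto hscore).add hinf).mono (Eventually.of_forall fun q => ?_)
    have h := norm_le_norm_add_norm_sub' (V q) (avg W ψ q)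
    rw [abs_of_nonneg (by positivity), abs_of_nonneg (by positivity), ← mul_add]
    gcongr
    linarith
  -- hence so is `θ̂ - θ₀`, because `τ` is nonsingular
  have hDb : BoundedInProb μ (fun q => √(q.1 : ℝ) * ‖th q - θ₀‖) := by
    refine (hVb.const_mul (2 * ‖M‖)).mono ?_
    filter_upwards [hexp (1 / (2 * (‖M‖ + 1))) (by positivity), hth] with q h1 h2
    rw [h2.2, zero_sub] at h1
    have h3 : ‖th q - θ₀‖ ≤ ‖M‖ * ‖∫ w, dU U θ₀ w (th q - θ₀) ∂P‖ := by
      conv_lhs => rw [← tauInv_integral_dU henv hreg (th q - θ₀)]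
      exact M.le_opNorm _
    have h4 : ‖∫ w, dU U θ₀ w (th q - θ₀) ∂P‖
        ≤ ‖V q‖ + 1 / (2 * (‖M‖ + 1)) * ‖th q - θ₀‖ := by
      have h := norm_sub_norm_le (∫ w, dU U θ₀ w (th q - θ₀) ∂P) (-V q)
      rw [norm_neg, norm_sub_rev] at h
      linarith
    have h5 : ‖M‖ * (1 / (2 * (‖M‖ + 1))) ≤ 1 / 2 := by
      rw [mul_one_div, div_le_iff₀ (by positivity)]
      linarith
    have h6 : ‖th q - θ₀‖ ≤ 2 * ‖M‖ * ‖V q‖ := by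
      have e1 := h3.trans (mul_le_mul_of_nonneg_left h4 (norm_nonneg M))
      have e2 := mul_le_mul_of_nonneg_right h5 (norm_nonneg (th q - θ₀))
      linarith
    rw [abs_of_nonneg (by positivity), abs_of_nonneg (by positivity), mul_left_comm]
    gcongr
  -- the relative error of the expansion tends to zero
  have hrel : Tendsto (fun q => ‖V q + ∫ w, dU U θ₀ w (th q - θ₀) ∂P‖ / ‖th q - θ₀‖)
      (whp μ) (𝓝 0) := by
    rw [Metric.tendsto_nhds]
    intro e he
    filter_upwards [hexp (e / 2) (half_pos he), hth] with q h1 h2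
    rw [h2.2, zero_sub, ← neg_add', norm_neg] at h1
    rw [dist_zero_right, Real.norm_of_nonneg (by positivity)]
    exact (div_le_of_le_mul₀ (norm_nonneg _) (half_pos he).le h1).trans_lt (half_lt_self he)
  have hrem : Tendsto (fun q => ‖M‖ * (√(q.1 : ℝ) * ‖th q - θ₀‖ *
      (‖V q + ∫ w, dU U θ₀ w (th q - θ₀) ∂P‖ / ‖th q - θ₀‖) + √(q.1 : ℝ) * ‖V q - avg W ψ q‖))
      (whp μ) (𝓝 0) := by
    simpa using ((hDb.mul_tendsto_zero hrel).add hscore).const_mul ‖M‖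
  rw [tendsto_zero_iff_norm_tendsto_zero]
  refine squeeze_zero' (Eventually.of_forall fun q => norm_nonneg _) ?_ hrem
  filter_upwards [hexp 1 one_pos, hth] with q h1 h2
  rw [h2.2, zero_sub, ← neg_add', norm_neg, one_mul] at h1
  have h3 : avg W (fun w => -M (ψ w)) q = -M (avg W ψ q) :=
    avg_map W ψ (-M.toLinearMap) q
  have h4 : √(q.1 : ℝ) • (th q - θ₀) - √(q.1 : ℝ) • avg W (fun w => -M (ψ w)) q
      = √(q.1 : ℝ) • M ((V q + ∫ w, dU U θ₀ w (th q - θ₀) ∂P) - (V q - avg W ψ q)) := by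
    have h5 : M (∫ w, dU U θ₀ w (th q - θ₀) ∂P) = th q - θ₀ :=
      tauInv_integral_dU henv hreg (th q - θ₀)
    rw [h3, ← smul_sub, map_sub, map_add, map_sub, h5]
    congr 1
    abel
  have h6 : ‖th q - θ₀‖ * (‖V q + ∫ w, dU U θ₀ w (th q - θ₀) ∂P‖ / ‖th q - θ₀‖)
      = ‖V q + ∫ w, dU U θ₀ w (th q - θ₀) ∂P‖ := by
    rcases (norm_nonneg (th q - θ₀)).eq_or_lt with h0 | h0
    · rw [← h0] at h1 ⊢
      rw [zero_mul]
      exact (le_antisymm h1 (norm_nonneg _)).symm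
    · field_simp
  rw [h4, norm_smul, Real.norm_of_nonneg (Real.sqrt_nonneg _), mul_assoc, h6, ← mul_add,
    mul_left_comm]
  refine mul_le_mul_of_nonneg_left ?_ (Real.sqrt_nonneg _)
  refine (M.le_opNorm _).trans ?_
  gcongr
  exact norm_sub_le _ _

/-- The covariance matrix of the normalized influence function `-τ⁻¹ψ`. -/
lemma integral_tauInv_influence_mul (hMAR : MissingAtRandom P)
    (hreg : RegularityConditions P U b Θ θ₀ lam)
    (hβ : Ubar P U θ₀ =ᵐ[P] fun w => linComb b β w.1) (j k : Fin p) :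
    ((tau P U θ₀)⁻¹ * V1 P U b θ₀ lam * ((tau P U θ₀)⁻¹).transpose) j k
      = ∫ w, (-tauInv P U θ₀ (influence (odds P) U b lam θ₀ β w)) j *
          (-tauInv P U θ₀ (influence (odds P) U b lam θ₀ β w)) k ∂P := by
  set ψ := influence (odds P) U b lam θ₀ β with hψ
  set T := (tau P U θ₀)⁻¹ with hT
  have hm := memLp_influence hreg hβ (odds P)
  have hi : ∀ a c, Integrable (fun w => ψ w a * ψ w c) P := fun a c =>
    (memLp_coord hm a).integrable_mul (memLp_coord hm c)
  have hco : ∀ w i, (-tauInv P U θ₀ (ψ w)) i = -∑ a, T i a * ψ w a := fun w i => rfl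
  have hexp : ∀ w, (-tauInv P U θ₀ (ψ w)) j * (-tauInv P U θ₀ (ψ w)) k
      = ∑ c, ∑ a, T j a * T k c * (ψ w a * ψ w c) := by
    intro w
    rw [hco, hco, neg_mul_neg, Finset.sum_mul_sum, Finset.sum_comm]
    refine Finset.sum_congr rfl fun c _ => Finset.sum_congr rfl fun a _ => ?_
    ring
  simp only [hexp]
  rw [integral_finsetSum _ fun c _ => integrable_finsetSum _ fun a _ => (hi a c).const_mul _,
    Matrix.mul_apply]
  refine Finset.sum_congr rfl fun c _ => ?_
  rw [integral_finsetSum _ fun a _ => (hi a c).const_mul _, Matrix.mul_apply,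
    Matrix.transpose_apply, Finset.sum_mul]
  refine Finset.sum_congr rfl fun a _ => ?_
  rw [integral_const_mul, integral_influence_mul hMAR hreg hβ]
  ring

end Normality

end

end SPS

theorem mainTheorem2
    {𝒳 𝒴 Ω : Type*}
    [MeasurableSpace 𝒳] [StandardBorelSpace 𝒳] [MeasurableSpace 𝒴] [StandardBorelSpace 𝒴]
    [MeasurableSpace Ω] (μ : Measure Ω) [IsProbabilityMeasure μ]
    {L p : ℕ}
    (P : Measure (SPS.Obs 𝒳 𝒴)) [IsProbabilityMeasure P]
    (U : SPS.Vec p → 𝒳 → 𝒴 → SPS.Vec p) (b : 𝒳 → SPS.Vec L)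
    (Θ : Set (SPS.Vec p)) (θ₀ : SPS.Vec p) (lamStar : SPS.Vec (L + 1))
    -- the sample
    (W : ℕ → Ω → SPS.Obs 𝒳 𝒴)
    (hlaw : ∀ i, HasLaw (W i) P μ) (hindep : iIndepFun W μ)
    -- the model
    (hMAR : SPS.MissingAtRandom P)
    (hmodel : SPS.DensityRatioModel P b lamStar)
    (hreg : SPS.RegularityConditions P U b Θ θ₀ lamStar)
    (hspan : ∀ θ ∈ Θ, SPS.UbarInSpan P U b θ)
    -- the two-step estimator, solving its equations with probability tending to one
    (lamHat : ℕ → Ω → SPS.Vec (L + 1)) (hlamHat : ∀ N, AEMeasurable (lamHat N) μ)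
    (thetaHat : ℕ → Ω → SPS.Vec p) (hthetaHat : ∀ N, AEMeasurable (thetaHat N) μ)
    (hsolves : Tendsto (fun N => μ {ω | ¬ (SPS.Calibrates b (fun i => W i ω) N (lamHat N ω) ∧
      thetaHat N ω ∈ Θ ∧
      SPS.UhatSPS U b (fun i => W i ω) N (lamHat N ω) (thetaHat N ω) = 0)}) atTop (𝓝 0)) :
    (∃ betaStar : SPS.Vec p → Fin (L + 1) → SPS.Vec p, ∀ θ ∈ Θ,
      SPS.IsProbLimitOfSolution μ
        (fun N ω β => SPS.SolvesBeta U b lamStar (fun i => W i ω) N θ β) (betaStar θ) ∧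
      SPS.Ubar P U θ =ᵐ[P] fun w => SPS.linComb b (betaStar θ) w.1) ∧
    TendstoInDistribution
      (fun (N : ℕ) ω => √(N : ℝ) • (thetaHat N ω - θ₀)) atTop
      id (fun _ => μ)
      (multivariateGaussian 0
        ((SPS.tau P U θ₀)⁻¹ * SPS.V1 P U b θ₀ lamStar * ((SPS.tau P U θ₀)⁻¹).transpose)) := by
  have hsol : ∀ᶠ q in SPS.whp μ, SPS.Calibrates b (fun i => W i q.2) q.1 (lamHat q.1 q.2) ∧
      thetaHat q.1 q.2 ∈ Θ ∧
      SPS.UhatSPS U b (fun i => W i q.2) q.1 (lamHat q.1 q.2) (thetaHat q.1 q.2) = 0 :=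
    SPS.eventually_whp.2 hsolves
  constructor
  · choose! betaStar hbeta using hspan
    exact ⟨betaStar, fun θ hθ => ⟨SPS.isProbLimitOfSolution_solvesBeta hlaw hindep hMAR hmodel
      hreg hθ (hbeta θ hθ), hbeta θ hθ⟩⟩
  · obtain ⟨β, hβ⟩ := hspan θ₀ hreg.mem
    have hm := SPS.memLp_influence hreg hβ (SPS.odds P)
    have hlin := SPS.tendsto_asymptotic_linearity (th := fun q => thetaHat q.1 q.2) hlaw hindep
      hMAR hmodel hreg hspan hβ (hsol.mono fun q h => h.1) (hsol.mono fun q h => h.2)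
    have hm' : MemLp (fun w => -SPS.tauInv P U θ₀
        (SPS.influence (SPS.odds P) U b lamStar θ₀ β w)) 2 P :=
      (-SPS.tauInv P U θ₀).comp_memLp' hm
    have h0 : ∫ w, -SPS.tauInv P U θ₀
        (SPS.influence (SPS.odds P) U b lamStar θ₀ β w) ∂P = 0 := by
      have h := (-SPS.tauInv P U θ₀).integral_comp_comm (hm.integrable (by norm_num))
      rw [SPS.integral_influence hMAR hreg hβ, map_zero] at h
      exact h
    have hclt := SPS.tendstoInDistribution_sqrt_smul_avg hlaw hindep hm' h0
      (SPS.integral_tauInv_influence_mul hMAR hreg hβ)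
    refine tendstoInDistribution_of_tendstoInMeasure_sub _ _ hclt ?_ fun N =>
      ((hthetaHat N).sub_const θ₀).const_smul √(N : ℝ)
    exact SPS.tendsto_whp_iff.1 hlin
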